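/- Let $n\ge 2$. Let $F$ be the (complex) vacuum module of the vertex algebra generated by $n$ symplectic bosons $(X_i,Y_i)$, $n-1$ Heisenberg currents $h_a$ and $n-1$ pairs of ghosts $(b_a,c^a)$, with $$X_i(z)Y_j(0)\sim\frac{\delta_{ij}}{z},\qquad h_a(z)h_b(0)\sim\frac{C_{ab}}{z^2},\qquad b_a(z)c^b(0)\sim\frac{\delta_a^b}{z},$$ where $C$ is the Cartan matrix of $\mathfrak{su}(n)$. Operators (fields) are identified with the states they create from the vacuum, and $(AB)_0$ denotes the normally ordered product. Put $$Q=\oint\frac{dz}{2\pi i}\sum_{a=1}^{n-1}c^a\,(X_aY_a-X_{a+1}Y_{a+1}+h_a),$$ $$T=\tfrac12\sum_{i=1}^n(X_i\partial Y_i-\partial X_i\,Y_i)+\tfrac12\sum_{i,j=1}^{n-1}(C^{-1})_{ij}h_ih_j-\sum_{a=1}^{n-1} b_a\partial c^a .$$ A state in the image of $Q$ is called exact. A state $v$ is primary if $T(z)v\sim \frac{h v}{z^2}+\frac{\partial v}{z}$ for some $h\in\mathbb C$; it is primary modulo exact states if this holds up to exact states. Put $\mathcal A_i=-X_iY_i$,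 $U=-\frac1n\sum_i X_iY_i$, $\mathcal X=X_1\cdots X_n$, $\mathcal Y=Y_1\cdots Y_n$ (nested normally ordered products), $$D_i\mathcal O=2(\mathcal A_i\mathcal O)_0+(X_i(Y_i\mathcal O)_0)_0,\qquad T_i=\tfrac12D_i\mathcal A_i,$$ and, for $I\subseteq\{1,\dots,n\}$, $\mathcal X_I=\prod_{i\in I}D_i\mathcal X$ and $\mathcal Y_I=\prod_{i\in I}D_i\mathcal Y$. For $K\subseteq\{1,\dots,n\}$ let $\sigma_K^{(l)}$ be the $l$-th elementary symmetric polynomial in the $D_i$ with $i\notin K$. An admissible pairing $P$ is a (possibly empty) set of pairwise disjoint pairs $(i,j)$, $1\le i<j\le n$, such that no two pairs cross (there are no pairs $(i,j),(k,l)\in P$ with $i<k<j<l$), and every $m$ with $i<m<j$ for some $(i,j)\in P$ belongs to a pair of $P$ lying strictly between $i$ and $j$. Write $L=|P|$, let $K$ be the set of the $2L$ paired points, and put $\Delta_P=\prod_{(i,j)\in P}(D_i-D_j)$. Let $\mathcal O$ be $\mathcal X$ or $\mathcal Y$, and write $\mathcal O_I=\prod_{i\in I}D_i\mathcal O$. Then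 every $\mathcal O_I$ is $Q$-closed, and for each $0\le k\le n$: 1. The operators $\Delta_P\,\sigma_K^{(k-L)}\mathcal O$, where $P$ runs over the admissible pairings with $L\le k\le n-L$ (the empty pairing gives $\sigma_\emptyset^{(k)}\mathcal O$), form a basis of $\operatorname{span}\{\mathcal O_I:|I|=k\}$; moreover they are linearly independent modulo exact states. 2. An element of $\operatorname{span}\{\mathcal O_I:|I|=k\}$ is primary if and only if it is primary modulo exact states, if and only if it is a linear combination of the operators $\Delta_P\mathcal O$ with $P$ an admissible pairing with exactly $k$ pairs. (In particular only $0$ is primary if $k>n/2$.) 3. Each of the remaining basis operators, those with $L<k$, is not primary, even modulo exact states, and is composite: modulo exact states it is a linear combination of operators $\partial\mathcal O_J$, $(U\mathcal O_J)_0$ and $(T_i\mathcal O_J)_0$ with $|J|<k$. Finally, an element of $\operatorname{span}\{\mathcal X_I,\mathcal Y_I: I\subseteq\{1,\dots,n\}\}$ is primary if and only if it is primary modulo exact states, if and only if for some $k$ it is a linear combination of the operators $\Delta_P\mathcal X$ and $\Delta_P\mathcal Y$ with $P$ an admissible pairing with exactly $k$ pairs. -/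

import Mathlib

open scoped TensorProduct VertexOperator

noncomputable section

/-! ### Fields on a vector space -/

namespace ChiralField

variable {V : Type*} [AddCommGroup V] [Module ℂ V]

/-- The field `A(z) = ∑ₙ A₍ₙ₎ z^{-n-1}` with prescribed modes `A₍ₙ₎`. -/
def ofModes (f : ℤ → Module.End ℂ V) (hf : ∀ v, ∃ N : ℤ, ∀ n, N ≤ n → f n v = 0) :
    VertexOperator ℂ V :=
  VertexOperator.of_coeff (fun n => f (-n - 1)) fun v => by
    obtain ⟨N, hN⟩ := hf v
    refine ⟨-N, fun n hn => ?_⟩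
    by_contra h
    exact hn (hN _ (by omega))

@[simp]
theorem ncoeff_ofModes (f : ℤ → Module.End ℂ V) (hf) (n : ℤ) : (ofModes f hf)[[n]] = f n := by
  simp [ofModes]

theorem field_ext {A B : VertexOperator ℂ V} (h : ∀ n v, (A[[n]]) v = (B[[n]]) v) : A = B := by
  refine HVertexOperator.coeff_inj (funext fun n => LinearMap.ext fun v => ?_)
  rw [VertexOperator.coeff_eq_ncoeff, VertexOperator.coeff_eq_ncoeff]
  exact h _ v

/-- A field has only finitely many singular terms on each vector. -/
theorem exists_trunc (A : VertexOperator ℂ V) (v : V) : ∃ N : ℤ, ∀ n, N ≤ n → (A[[n]]) v = 0 :=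
  ⟨-HahnSeries.order ((HahnModule.of ℂ).symm (A v)), fun n hn =>
    VertexOperator.ncoeff_eq_zero_of_lt_order A n v (by omega)⟩

/-- The identity field. -/
def idField : VertexOperator ℂ V :=
  ofModes (fun n => if n = -1 then 1 else 0) fun v =>
    ⟨0, fun n hn => by rw [if_neg (by omega)]; rfl⟩

/-- The derivative `∂A(z)`, with modes `(∂A)₍ₙ₎ = -n A₍ₙ₋₁₎`. -/
def deriv (A : VertexOperator ℂ V) : VertexOperator ℂ V :=
  ofModes (fun n => (-(n : ℂ)) • A[[n - 1]]) fun v => by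
    obtain ⟨N, hN⟩ := exists_trunc A v
    exact ⟨N + 1, fun n hn => by simp [hN (n - 1) (by omega)]⟩

/-- The `r`-th term of the `n`-th mode of the normally ordered product. -/
def nopTerm (ε : ℂ) (A B : VertexOperator ℂ V) (n : ℤ) (v : V) (r : ℕ) : V :=
  (A[[-1 - (r : ℤ)]]) ((B[[n + r]]) v) + ε • (B[[n - 1 - r]]) ((A[[(r : ℤ)]]) v)

theorem nopTerm_finite (ε : ℂ) (A B : VertexOperator ℂ V) (n : ℤ) (v : V) :
    (Function.support (nopTerm ε A B n v)).Finite := by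
  obtain ⟨NA, hA⟩ := exists_trunc A v
  obtain ⟨NB, hB⟩ := exists_trunc B v
  refine (Set.finite_lt_nat (max NA (NB - n)).toNat).subset fun r hr => ?_
  by_contra h
  simp only [Set.mem_ofPred_eq, not_lt] at h
  exact hr (by simp [nopTerm, hA r (by omega), hB (n + r) (by omega)])

/-- The normally ordered product
`(AB)₍ₙ₎ = ∑_{j < 0} A₍ⱼ₎ B₍ₙ₋ⱼ₋₁₎ + ε ∑_{j ≥ 0} B₍ₙ₋ⱼ₋₁₎ A₍ⱼ₎`, that is,
`(AB)(w) = ∮ dz / (2πi) (z - w)⁻¹ A(z) B(w)` with radial ordering, where the sign is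
`ε = (-1)^{|A||B|}`. -/
def nop (ε : ℂ) (A B : VertexOperator ℂ V) : VertexOperator ℂ V :=
  ofModes
    (fun n =>
      { toFun := fun v => ∑ᶠ r : ℕ, nopTerm ε A B n v r
        map_add' := fun u v => by
          rw [← finsum_add_distrib (nopTerm_finite ε A B n u) (nopTerm_finite ε A B n v)]
          refine finsum_congr fun r => ?_
          simp only [nopTerm, map_add, smul_add]
          abel
        map_smul' := fun c v => by
          rw [RingHom.id_apply, smul_finsum' c (nopTerm_finite ε A B n v)]
          refine finsum_congr fun r => ?_
          simp only [nopTerm, map_smul, smul_add, smul_comm c ε] })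
    fun v => by
      obtain ⟨NA, hA⟩ := exists_trunc A v
      obtain ⟨NB, hB⟩ := exists_trunc B v
      choose M hM using fun r : ℕ => exists_trunc B ((A[[(r : ℤ)]]) v)
      obtain ⟨M', hM'⟩ := ((Finset.range NA.toNat).image M).exists_le
      refine ⟨max NB (M' + NA.toNat + 1), fun n hn => ?_⟩
      refine (finsum_congr fun r => ?_).trans finsum_zero
      have h1 : (B[[n + r]]) v = 0 := hB _ (by omega)
      by_cases hr : r < NA.toNat
      · have h2 : (B[[n - 1 - r]]) ((A[[(r : ℤ)]]) v) = 0 := by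
          have := hM' (M r) (Finset.mem_image_of_mem M (Finset.mem_range.2 hr))
          exact hM r _ (by omega)
        simp [nopTerm, h1, h2]
      · have h2 : (A[[(r : ℤ)]]) v = 0 := hA _ (by omega)
        simp [nopTerm, h1, h2]

theorem ncoeff_nop (ε : ℂ) (A B : VertexOperator ℂ V) (n : ℤ) (v : V) :
    ((nop ε A B)[[n]]) v = ∑ᶠ r : ℕ, nopTerm ε A B n v r := by
  simp [nop]

theorem nop_add (ε : ℂ) (A B C : VertexOperator ℂ V) :
    nop ε A (B + C) = nop ε A B + nop ε A C := by
  refine field_ext fun n v => ?_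
  simp only [map_add, Pi.add_apply, LinearMap.add_apply, ncoeff_nop]
  rw [← finsum_add_distrib (nopTerm_finite ε A B n v) (nopTerm_finite ε A C n v)]
  refine finsum_congr fun r => ?_
  simp only [nopTerm, map_add, Pi.add_apply, LinearMap.add_apply, smul_add]
  abel

theorem nop_smul (ε c : ℂ) (A B : VertexOperator ℂ V) : nop ε A (c • B) = c • nop ε A B := by
  refine field_ext fun n v => ?_
  simp only [map_smul, Pi.smul_apply, LinearMap.smul_apply, ncoeff_nop]
  rw [smul_finsum' c (nopTerm_finite ε A B n v)]
  refine finsum_congr fun r => ?_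
  simp only [nopTerm, map_smul, Pi.smul_apply, LinearMap.smul_apply, smul_add, smul_comm c ε]

/-- Normally ordered multiplication `O ↦ (A O)₀` by an even field `A`. -/
def nopLeft (A : VertexOperator ℂ V) : Module.End ℂ (VertexOperator ℂ V) where
  toFun := nop 1 A
  map_add' := nop_add 1 A
  map_smul' c := nop_smul 1 c A

end ChiralField

open ChiralField

/-! ### The Fock space and the free fields -/

/-- Bosonic creation modes: those of `X_i`, `Y_i` and `h_a`; index `r` stands for the mode
`-1 - r`. -/
inductive BosonMode (n : ℕ)
  | x (i : Fin n) (r : ℕ)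
  | y (i : Fin n) (r : ℕ)
  | h (a : Fin (n - 1)) (r : ℕ)

/-- Ghost creation modes: those of `b_a` and `c^a`; index `r` stands for the mode `-1 - r`. -/
inductive GhostMode (n : ℕ)
  | b (a : Fin (n - 1)) (r : ℕ)
  | c (a : Fin (n - 1)) (r : ℕ)

/-- The vacuum module of `n` symplectic bosons, `n - 1` Heisenberg currents and `n - 1` pairs of
`bc`-ghosts. -/
abbrev Fock (n : ℕ) : Type :=
  MvPolynomial (BosonMode n) ℂ ⊗[ℂ] ExteriorAlgebra ℂ (GhostMode n →₀ ℂ)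

namespace Fock

variable {n : ℕ}

/-- The vacuum vector. -/
def vac : Fock n := 1 ⊗ₜ[ℂ] 1

/-- Creation operator of a bosonic mode: multiplication by the variable. -/
def bosonCre (m : BosonMode n) : Module.End ℂ (Fock n) :=
  LinearMap.rTensor _ (LinearMap.mulLeft ℂ (MvPolynomial.X m : MvPolynomial (BosonMode n) ℂ))

/-- Partial derivative with respect to a bosonic mode. -/
def bosonAnn (m : BosonMode n) : Module.End ℂ (Fock n) :=
  LinearMap.rTensor _ (MvPolynomial.pderiv m : Derivation ℂ (MvPolynomial (BosonMode n) ℂ)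
    (MvPolynomial (BosonMode n) ℂ)).toLinearMap

/-- Creation operator of a ghost mode: exterior multiplication on the left. -/
def ghostCre (g : GhostMode n) : Module.End ℂ (Fock n) :=
  LinearMap.lTensor _ (LinearMap.mulLeft ℂ (ExteriorAlgebra.ι ℂ (Finsupp.single g (1 : ℂ))))

/-- Contraction against a ghost mode (an odd derivation of the exterior algebra). -/
def ghostAnn (g : GhostMode n) : Module.End ℂ (Fock n) :=
  LinearMap.lTensor _ (CliffordAlgebra.contractLeft
    (Q := (0 : QuadraticForm ℂ (GhostMode n →₀ ℂ))) (Finsupp.lapply g))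

/-- Each vector involves only finitely many bosonic modes. -/
theorem bosonAnn_trunc (m : ℕ → BosonMode n) (hm : Function.Injective m) (v : Fock n) :
    ∃ N : ℕ, ∀ r, N ≤ r → bosonAnn (m r) v = 0 := by
  induction v using TensorProduct.induction_on with
  | zero => exact ⟨0, fun r _ => map_zero _⟩
  | tmul p w =>
    obtain ⟨N, hN⟩ := (p.vars.finite_toSet.preimage hm.injOn).bddAbove
    refine ⟨N + 1, fun r hr => ?_⟩
    have h : MvPolynomial.pderiv (m r) p = 0 :=
      MvPolynomial.pderiv_eq_zero_of_notMem_vars fun hmem => by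
        have : r ≤ N := hN hmem
        omega
    simp [bosonAnn, h]
  | add u v hu hv =>
    obtain ⟨N, hN⟩ := hu
    obtain ⟨M, hM⟩ := hv
    exact ⟨max N M, fun r hr => by
      rw [map_add, hN r (le_trans (le_max_left _ _) hr), hM r (le_trans (le_max_right _ _) hr),
        add_zero]⟩

/-- Each vector involves only finitely many ghost modes. -/
theorem ghostAnn_trunc (g : ℕ → GhostMode n) (hg : Function.Injective g) (v : Fock n) :
    ∃ N : ℕ, ∀ r, N ≤ r → ghostAnn (g r) v = 0 := by
  have key : ∀ w : ExteriorAlgebra ℂ (GhostMode n →₀ ℂ), ∃ N : ℕ, ∀ r, N ≤ r →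
      CliffordAlgebra.contractLeft (Q := (0 : QuadraticForm ℂ (GhostMode n →₀ ℂ)))
        (Finsupp.lapply (g r)) w = 0 := by
    intro w
    induction w using CliffordAlgebra.left_induction with
    | algebraMap c => exact ⟨0, fun r _ => CliffordAlgebra.contractLeft_algebraMap _ _ _⟩
    | add u v hu hv =>
      obtain ⟨N, hN⟩ := hu
      obtain ⟨M, hM⟩ := hv
      exact ⟨max N M, fun r hr => by
        rw [map_add, hN r (le_trans (le_max_left _ _) hr), hM r (le_trans (le_max_right _ _) hr),
          add_zero]⟩
    | ι_mul w a hw =>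
      obtain ⟨N, hN⟩ := hw
      obtain ⟨M, hM⟩ := (a.support.finite_toSet.preimage hg.injOn).bddAbove
      refine ⟨max N (M + 1), fun r hr => ?_⟩
      have h : a (g r) = 0 := by
        by_contra hne
        have : r ≤ M := hM (by simpa using hne)
        omega
      rw [CliffordAlgebra.contractLeft_ι_mul, hN r (by omega)]
      simp [h]
  induction v using TensorProduct.induction_on with
  | zero => exact ⟨0, fun r _ => map_zero _⟩
  | tmul p w =>
    obtain ⟨N, hN⟩ := key w
    exact ⟨N, fun r hr => by simp [ghostAnn, hN r hr]⟩
  | add u v hu hv =>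
    obtain ⟨N, hN⟩ := hu
    obtain ⟨M, hM⟩ := hv
    exact ⟨max N M, fun r hr => by
      rw [map_add, hN r (le_trans (le_max_left _ _) hr), hM r (le_trans (le_max_right _ _) hr),
        add_zero]⟩

/-- The field with creation modes `A₍₋₁₋ᵣ₎ = cre r` and annihilation modes `A₍ᵣ₎ = ann r`,
`r ≥ 0`. -/
def freeField (cre ann : ℕ → Module.End ℂ (Fock n))
    (h : ∀ v, ∃ N : ℕ, ∀ r, N ≤ r → ann r v = 0) : VertexOperator ℂ (Fock n) :=
  ofModes (fun m => match m with
      | Int.ofNat r => ann r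
      | Int.negSucc r => cre r)
    fun v => by
      obtain ⟨N, hN⟩ := h v
      refine ⟨N, fun m hm => ?_⟩
      obtain ⟨r, rfl⟩ := Int.eq_ofNat_of_zero_le (le_trans (Int.natCast_nonneg N) hm)
      exact hN r (by omega)

/-- The symplectic boson `X_i`, with `X_i(z) Y_j(0) ~ δ_{ij} / z`. -/
def X (i : Fin n) : VertexOperator ℂ (Fock n) :=
  freeField (fun r => bosonCre (.x i r)) (fun r => bosonAnn (.y i r))
    (bosonAnn_trunc _ fun _ _ h => by cases h; rfl)

/-- The symplectic boson `Y_i`, with `Y_i(z) X_j(0) ~ -δ_{ij} / z`. -/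
def Y (i : Fin n) : VertexOperator ℂ (Fock n) :=
  freeField (fun r => bosonCre (.y i r)) (fun r => -bosonAnn (.x i r)) fun v => by
    obtain ⟨N, hN⟩ := bosonAnn_trunc (fun r => BosonMode.x i r) (fun _ _ h => by cases h; rfl) v
    exact ⟨N, fun r hr => by simp [hN r hr]⟩

/-- The Cartan matrix of `𝔰𝔲(n)`, with complex entries. -/
def cartan (n : ℕ) : Matrix (Fin (n - 1)) (Fin (n - 1)) ℂ :=
  (CartanMatrix.A (n - 1)).map (Int.castRingHom ℂ)

/-- The annihilation modes of `h_a`: `h_{a,(r)} = r ∑_b C_{ab} ∂/∂h_{b,(-r)}` for `r ≥ 1`, and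
`h_{a,(0)} = 0`. -/
def hAnn (a : Fin (n - 1)) : ℕ → Module.End ℂ (Fock n)
  | 0 => 0
  | r + 1 => ((r : ℂ) + 1) • ∑ b, cartan n a b • bosonAnn (.h b r)

/-- The Heisenberg current `h_a`, with `h_a(z) h_b(0) ~ C_{ab} / z²`. -/
def H (a : Fin (n - 1)) : VertexOperator ℂ (Fock n) :=
  freeField (fun r => bosonCre (.h a r)) (hAnn a) fun v => by
    choose N hN using fun b : Fin (n - 1) =>
      bosonAnn_trunc (fun r => BosonMode.h b r) (fun _ _ h => by cases h; rfl) v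
    refine ⟨(∑ b, N b) + 1, fun r hr => ?_⟩
    obtain ⟨s, rfl⟩ : ∃ s, r = s + 1 := ⟨r - 1, by omega⟩
    simp only [hAnn, LinearMap.smul_apply, LinearMap.sum_apply]
    rw [Finset.sum_eq_zero, smul_zero]
    intro b _
    have : N b ≤ ∑ b, N b := Finset.single_le_sum (fun _ _ => Nat.zero_le _) (Finset.mem_univ b)
    rw [hN b s (by omega), smul_zero]

/-- The ghost `b_a`, with `b_a(z) c^b(0) ~ δ_a^b / z`. -/
def B (a : Fin (n - 1)) : VertexOperator ℂ (Fock n) :=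
  freeField (fun r => ghostCre (.b a r)) (fun r => ghostAnn (.c a r))
    (ghostAnn_trunc _ fun _ _ h => by cases h; rfl)

/-- The ghost `c^a`. -/
def C (a : Fin (n - 1)) : VertexOperator ℂ (Fock n) :=
  freeField (fun r => ghostCre (.c a r)) (fun r => ghostAnn (.b a r))
    (ghostAnn_trunc _ fun _ _ h => by cases h; rfl)

/-! ### BRST charge, stress tensor and primary operators -/

/-- The state `A₍₋₁₎|0⟩` corresponding to the operator (field) `A`. -/
def state : VertexOperator ℂ (Fock n) →ₗ[ℂ] Fock n where
  toFun A := (A[[-1]]) vac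
  map_add' A A' := by simp
  map_smul' c A := by simp

/-- The `U(1)_a` matter current `X_a Y_a - X_{a+1} Y_{a+1}`. -/
def matterCurrent (a : Fin (n - 1)) : VertexOperator ℂ (Fock n) :=
  nop 1 (X ⟨a, by omega⟩) (Y ⟨a, by omega⟩) - nop 1 (X ⟨a + 1, by omega⟩) (Y ⟨a + 1, by omega⟩)

/-- The BRST current `∑_a c^a (X_a Y_a - X_{a+1} Y_{a+1} + h_a)`. -/
def brstCurrent (n : ℕ) : VertexOperator ℂ (Fock n) :=
  ∑ a, nop 1 (C a) (matterCurrent a + H a)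

/-- The BRST charge `Q = ∮ dz / (2πi) J_BRST(z)`. -/
def brstCharge (n : ℕ) : Module.End ℂ (Fock n) := (brstCurrent n)[[0]]

/-- The subspace of `Q`-exact states. -/
def exact (n : ℕ) : Submodule ℂ (Fock n) := LinearMap.range (brstCharge n)

/-- The stress tensor `T = T_sb + T_h + T_bc`. -/
def stress (n : ℕ) : VertexOperator ℂ (Fock n) :=
  (1 / 2 : ℂ) • ∑ i : Fin n, (nop 1 (X i) (deriv (Y i)) - nop 1 (deriv (X i)) (Y i))
    + (1 / 2 : ℂ) • ∑ i, ∑ j, (cartan n)⁻¹ i j • nop 1 (H i) (H j)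
    - ∑ a, nop (-1) (B a) (deriv (C a))

/-- `v` is primary: `T(z) v ~ h v / z² + ∂v / z` for some weight `h`. (The coefficient of `1 / z`
is `∂v` for every state.) -/
def IsPrimary (v : Fock n) : Prop :=
  ∃ h : ℂ, ((stress n)[[1]]) v = h • v ∧ ∀ m : ℤ, 2 ≤ m → ((stress n)[[m]]) v = 0

/-- `v` is primary up to `Q`-exact states. -/
def IsPrimaryModExact (v : Fock n) : Prop :=
  ∃ h : ℂ, ((stress n)[[1]]) v - h • v ∈ exact n ∧
    ∀ m : ℤ, 2 ≤ m → ((stress n)[[m]]) v ∈ exact n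

/-! ### Covariant derivatives and the operators built from them -/

/-- `𝒜_i = -X_i Y_i`. -/
def gaugeA (i : Fin n) : VertexOperator ℂ (Fock n) := -nop 1 (X i) (Y i)

/-- `U = -(1/n) ∑ X_i Y_i`. -/
def opU (n : ℕ) : VertexOperator ℂ (Fock n) := (-(1 / (n : ℂ))) • ∑ i : Fin n, nop 1 (X i) (Y i)

/-- `𝒟_i O = (𝒜_i O)₀ + (X_i (Y_i O)₀)₀`. -/
def partialD (i : Fin n) : Module.End ℂ (VertexOperator ℂ (Fock n)) :=
  nopLeft (gaugeA i) + nopLeft (X i) * nopLeft (Y i)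

/-- The covariant derivative `D_i O = 𝒟_i O + (𝒜_i O)₀`. -/
def covD (i : Fin n) : Module.End ℂ (VertexOperator ℂ (Fock n)) :=
  partialD i + nopLeft (gaugeA i)

/-- `T_i = ½ D_i 𝒜_i`. -/
def opT (i : Fin n) : VertexOperator ℂ (Fock n) := (1 / 2 : ℂ) • covD i (gaugeA i)

/-- `𝒳 = X_1 X_2 ⋯ X_n`, a right-nested normally ordered product. -/
def opX (n : ℕ) : VertexOperator ℂ (Fock n) := (List.ofFn fun i : Fin n => X i).foldr (nop 1) idField

/-- `𝒴 = Y_1 Y_2 ⋯ Y_n`, a right-nested normally ordered product. -/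
def opY (n : ℕ) : VertexOperator ℂ (Fock n) := (List.ofFn fun i : Fin n => Y i).foldr (nop 1) idField

/-- `∏_{i ∈ I} D_i`. The `D_i` commute on the operators considered, so the enumeration of `I` is
immaterial. -/
def covSet (I : Finset (Fin n)) : Module.End ℂ (VertexOperator ℂ (Fock n)) :=
  (I.toList.map covD).prod

/-- `σ_K^{(l)}`: the `l`-th elementary symmetric polynomial in the `D_i` with `i ∉ K`. -/
def sigma (K : Finset (Fin n)) (l : ℕ) : Module.End ℂ (VertexOperator ℂ (Fock n)) :=
  ∑ J ∈ Finset.powersetCard l Kᶜ, covSet J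

/-- `∏_{(i,j) ∈ P} (D_i - D_j)`; again the enumeration of `P` is immaterial. -/
def diffProd (P : Finset (Fin n × Fin n)) : Module.End ℂ (VertexOperator ℂ (Fock n)) :=
  (P.toList.map fun p => covD p.1 - covD p.2).prod

/-- The set of points that are paired by `P`. -/
def paired (P : Finset (Fin n × Fin n)) : Finset (Fin n) := P.image Prod.fst ∪ P.image Prod.snd

/-- Admissible pairings: disjoint pairs `i < j`; no two pairs cross; and every point strictly
between the members of a pair is itself paired with a point strictly between them. -/
structure IsAdmissible (P : Finset (Fin n × Fin n)) : Prop where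
  lt : ∀ p ∈ P, p.1 < p.2
  disjoint : ∀ p ∈ P, ∀ q ∈ P, p ≠ q →
    p.1 ≠ q.1 ∧ p.1 ≠ q.2 ∧ p.2 ≠ q.1 ∧ p.2 ≠ q.2
  noncrossing : ∀ p ∈ P, ∀ q ∈ P, ¬(p.1 < q.1 ∧ q.1 < p.2 ∧ p.2 < q.2)
  no_blank : ∀ p ∈ P, ∀ m, p.1 < m → m < p.2 →
    ∃ q ∈ P, (m = q.1 ∨ m = q.2) ∧ p.1 < q.1 ∧ q.2 < p.2

/-- `∏_{(i,j) ∈ P} (D_i - D_j) σ_K^{(k - L)} O`, where `K` is the set of points paired by `P` and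
`L = |P| ≤ k`. For `P = ∅` this is `σ_∅^{(k)} O`. -/
def basisOp (O : VertexOperator ℂ (Fock n)) (k : ℕ) (P : Finset (Fin n × Fin n)) :
    VertexOperator ℂ (Fock n) :=
  diffProd P (sigma (paired P) (k - P.card) O)

/-- Indices of the basis operators of level `k`: admissible pairings with `L` pairs,
`L ≤ k ≤ n - L`. -/
abbrev BasisIndex (n k : ℕ) : Type :=
  {P : Finset (Fin n × Fin n) // IsAdmissible P ∧ P.card ≤ k ∧ k + P.card ≤ n}

/-- The span of the `O_I = ∏_{i ∈ I} D_i O` with `|I| = k`. -/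
def levelSpan (O : VertexOperator ℂ (Fock n)) (k : ℕ) : Submodule ℂ (Fock n) :=
  Submodule.span ℂ {v | ∃ I : Finset (Fin n), I.card = k ∧ v = state (covSet I O)}

/-- The span of the admissible products of `k` differences applied to `O`. -/
def primarySpan (O : VertexOperator ℂ (Fock n)) (k : ℕ) : Submodule ℂ (Fock n) :=
  Submodule.span ℂ
    {v | ∃ P : Finset (Fin n × Fin n), IsAdmissible P ∧ P.card = k ∧ v = state (diffProd P O)}

/-- The span of the composites `∂O_J`, `(U O_J)₀` and `(T_i O_J)₀` with `|J| < k`. -/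
def compositeSpan (O : VertexOperator ℂ (Fock n)) (k : ℕ) : Submodule ℂ (Fock n) :=
  Submodule.span ℂ {v | ∃ J : Finset (Fin n), J.card < k ∧
    (v = state (deriv (covSet J O)) ∨ v = state (nop 1 (opU n) (covSet J O)) ∨
      ∃ i, v = state (nop 1 (opT i) (covSet J O)))}

end Fock

end

/-! The operator `D_i` only touches the modes of the `i`-th symplectic boson. Hence the state `O_I`
is a product over the sites, with factor `D_i X_i` for `i ∈ I` and `X_i` otherwise (likewise with
`Y`), and `levelMap` identifies it with the squarefree monomial `∏_{i ∈ I} x_i`. The span of all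
`O_I` thus becomes `(ℂ²)^{⊗n}`, and every question about fields reduces to computations at one site.

Acting on `O_I`, mode 1 of the stress tensor has eigenvalue `n/2 + |I|`, mode 2 is `±2 ∑ ∂/∂x_i`
(`stress_two`), and the higher modes vanish (`stress_ge_three`). Since `∑ ∂/∂x_i` is the `sl₂`
raising operator on `(ℂ²)^{⊗n}`, primaries are its highest weight vectors of fixed degree. A
difference `x_i - x_j` is a singlet; products of differences over admissible pairings are the
noncrossing basis of highest weight vectors, and multiplying by elementary symmetric polynomials in
the unpaired variables gives their descendants. Independence follows from leading monomials and from
applying the raising operator (`linearIndependent_diffPoly`, `eq_zero_of_raising_eq_zero`), spanning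
by adding one site at a time and uncrossing (`new_pair_mem`, `step_mem`). Together they identify the
kernel of the raising operator (`mem_highestSpan_iff`).

Descendants are composite because each site has a null vector (`opT_site0`) expressing `T_i X_i`
through `∂(D_i X_i)` and `𝒜_i D_i X_i`. Summed over the sites it writes the lowering operator in
terms of `∂`, `U` and `T_i` (`sum_levelPoly_insert`).

For the statements modulo exact states there are functionals `levelCoeff`, dual to the `O_I` up to
nonzero scalars, that vanish on the image of `Q` (`levelCoeff_exact`). They come from specializing
the modes to polynomials so that on suitable coefficients the creation modes of `X_a Y_a - X_{a+1}
Y_{a+1} + h_a` act by zero. So no nonzero combination of the `𝒳_I` and `𝒴_I` is exact, and "primary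
modulo exact" imposes the same linear equations as "primary". -/

noncomputable section

/-! ### Elementary symmetric polynomials of subsets of the variables -/

namespace Fock

open MvPolynomial Finset

section Esymm

variable {σ : Type*}

/-- The squarefree monomial `∏_{i ∈ I} X_i`. -/
def sqfree (I : Finset σ) : MvPolynomial σ ℂ := ∏ i ∈ I, MvPolynomial.X i

/-- The elementary symmetric polynomial of degree `l` in the variables indexed by `S`. -/
def esymmOn (S : Finset σ) (l : ℕ) : MvPolynomial σ ℂ := ∑ J ∈ S.powersetCard l, sqfree J

@[simp]
theorem esymmOn_zero (S : Finset σ) : esymmOn S 0 = 1 := by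
  simp [esymmOn, sqfree]

theorem esymmOn_eq_zero {S : Finset σ} {l : ℕ} (h : #S < l) : esymmOn S l = 0 := by
  simp [esymmOn, Finset.powersetCard_eq_empty.2 h]

theorem esymmOn_empty_succ (l : ℕ) : esymmOn (∅ : Finset σ) (l + 1) = 0 :=
  esymmOn_eq_zero (Nat.succ_pos l)

variable [DecidableEq σ]

theorem esymmOn_insert {S : Finset σ} {a : σ} (ha : a ∉ S) (l : ℕ) :
    esymmOn (insert a S) (l + 1) = esymmOn S (l + 1) + MvPolynomial.X a * esymmOn S l := by
  have hmem : ∀ {m : ℕ} {J}, J ∈ S.powersetCard m → a ∉ J := fun hJ h =>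
    ha ((mem_powersetCard.1 hJ).1 h)
  rw [esymmOn, powersetCard_succ_insert ha, sum_union, sum_image, esymmOn, esymmOn, mul_sum]
  · congr 1
    exact sum_congr rfl fun J hJ => prod_insert (hmem hJ)
  · intro J hJ K hK h
    rw [← erase_insert (hmem hJ), ← erase_insert (hmem hK), h]
  · rw [disjoint_left]
    intro J hJ hJ'
    obtain ⟨K, _, rfl⟩ := mem_image.1 hJ'
    exact hmem hJ (mem_insert_self _ _)

/-- Each monomial of degree `l + 1` arises once for every choice of the factor `b` in it. -/
theorem sum_X_mul_esymmOn_erase (S : Finset σ) (l : ℕ) :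
    ∑ b ∈ S, MvPolynomial.X b * esymmOn (S.erase b) l =
      ((l : MvPolynomial σ ℂ) + 1) * esymmOn S (l + 1) := by
  induction S using Finset.induction_on generalizing l with
  | empty => simp [esymmOn_empty_succ]
  | insert a S ha ih =>
    rw [sum_insert ha, erase_insert ha]
    have h : ∀ b ∈ S, (insert a S).erase b = insert a (S.erase b) := fun b hb =>
      erase_insert_of_ne (by rintro rfl; exact ha hb)
    rw [sum_congr rfl fun b hb => by rw [h b hb] ]
    have ha' : ∀ b, a ∉ S.erase b := fun b hb => ha (mem_of_mem_erase hb)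
    cases l with
    | zero =>
      have := ih 0
      simp only [esymmOn_zero, mul_one] at this ⊢
      rw [this, esymmOn_insert ha]
      simp
      ring
    | succ l =>
      simp only [esymmOn_insert (ha' _), mul_add, sum_add_distrib, ih, esymmOn_insert ha]
      rw [sum_congr rfl fun b _ => mul_left_comm _ _ _, ← mul_sum, ih]
      push_cast
      ring

/-- A monomial of degree `l` survives the deletion of exactly those `#S - l` variables that it does
not contain. -/
theorem sum_esymmOn_erase (S : Finset σ) (l : ℕ) :
    ∑ b ∈ S, esymmOn (S.erase b) l = ((#S : MvPolynomial σ ℂ) - l) * esymmOn S l := by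
  induction S using Finset.induction_on generalizing l with
  | empty =>
    cases l with
    | zero => simp
    | succ l => simp [esymmOn_empty_succ]
  | insert a S ha ih =>
    rw [sum_insert ha, erase_insert ha]
    have h : ∀ b ∈ S, (insert a S).erase b = insert a (S.erase b) := fun b hb =>
      erase_insert_of_ne (by rintro rfl; exact ha hb)
    rw [sum_congr rfl fun b hb => by rw [h b hb], card_insert_of_notMem ha]
    have ha' : ∀ b, a ∉ S.erase b := fun b hb => ha (mem_of_mem_erase hb)
    cases l with
    | zero => simp; ring
    | succ l =>
      simp only [esymmOn_insert (ha' _), sum_add_distrib, ih, esymmOn_insert ha, ← mul_sum]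
      push_cast
      ring

end Esymm

/-! ### The raising and lowering operators -/

section Ladder

variable {σ : Type*} [Fintype σ]

/-- The raising operator `∑ ∂/∂X_i`. -/
def raising (σ : Type*) [Fintype σ] : Derivation ℂ (MvPolynomial σ ℂ) (MvPolynomial σ ℂ) :=
  mkDerivation ℂ fun _ => 1

/-- The derivation `∑ X_i² ∂/∂X_i`. -/
def sqDer (σ : Type*) [Fintype σ] : Derivation ℂ (MvPolynomial σ ℂ) (MvPolynomial σ ℂ) :=
  mkDerivation ℂ fun i => MvPolynomial.X i ^ 2

/-- The lowering operator `∑ X_i (1 - X_i ∂/∂X_i)`. -/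
def lowering (σ : Type*) [Fintype σ] : Module.End ℂ (MvPolynomial σ ℂ) :=
  LinearMap.mulLeft ℂ (∑ i, MvPolynomial.X i) - (sqDer σ).toLinearMap

theorem lowering_apply (p : MvPolynomial σ ℂ) :
    lowering σ p = (∑ i, MvPolynomial.X i) * p - sqDer σ p := rfl

@[simp] theorem raising_X (i : σ) : raising σ (MvPolynomial.X i) = 1 := mkDerivation_X ..

@[simp] theorem sqDer_X (i : σ) : sqDer σ (MvPolynomial.X i) = MvPolynomial.X i ^ 2 :=
  mkDerivation_X ..

variable [DecidableEq σ]

theorem raising_sqfree (I : Finset σ) : raising σ (sqfree I) = ∑ i ∈ I, sqfree (I.erase i) := by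
  induction I using Finset.induction_on with
  | empty => simp [sqfree]
  | insert a I ha ih =>
    have h : ∀ i ∈ I, sqfree ((insert a I).erase i) = MvPolynomial.X a * sqfree (I.erase i) := by
      intro i hi
      rw [erase_insert_of_ne (by rintro rfl; exact ha hi)]
      exact prod_insert fun h => ha (mem_of_mem_erase h)
    rw [sum_insert ha, erase_insert ha, sum_congr rfl h, ← mul_sum, ← ih]
    simp only [sqfree, prod_insert ha, Derivation.leibniz, raising_X, smul_eq_mul]
    ring

theorem sqDer_sqfree (I : Finset σ) : sqDer σ (sqfree I) = (∑ i ∈ I, MvPolynomial.X i) * sqfree I := by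
  induction I using Finset.induction_on with
  | empty => simp [sqfree]
  | insert a I ha ih =>
    simp only [sqfree] at ih
    simp only [sqfree, prod_insert ha, sum_insert ha, Derivation.leibniz, ih, smul_eq_mul, sqDer_X]
    ring

/-- The square terms produced by multiplication with `X_i`, `i ∈ I`, are exactly what `sqDer`
removes, so the lowering operator preserves squarefree polynomials. -/
theorem lowering_sqfree (I : Finset σ) : lowering σ (sqfree I) = ∑ i ∈ Iᶜ, sqfree (insert i I) := by
  rw [lowering_apply, sqDer_sqfree, ← sub_mul, ← sum_add_sum_compl I, add_sub_cancel_left, sum_mul]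
  exact sum_congr rfl fun i hi => (prod_insert (mem_compl.1 hi)).symm

/-- A monomial of degree `l` is a derivative of the `#S - l` monomials obtained by adjoining one
more variable. -/
theorem raising_esymmOn (S : Finset σ) (l : ℕ) :
    raising σ (esymmOn S (l + 1)) = ((#S : MvPolynomial σ ℂ) - l) * esymmOn S l := by
  induction S using Finset.induction_on generalizing l with
  | empty => cases l <;> simp [esymmOn_empty_succ]
  | insert a S ha ih =>
    rw [esymmOn_insert ha, card_insert_of_notMem ha]
    simp only [map_add, Derivation.leibniz, ih, raising_X, smul_eq_mul, mul_one]
    cases l with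
    | zero => simp
    | succ l =>
      rw [ih, esymmOn_insert ha]
      push_cast
      ring

theorem sum_X_mul_esymmOn_sub (S : Finset σ) (l : ℕ) :
    (∑ i ∈ S, MvPolynomial.X i) * esymmOn S l - sqDer σ (esymmOn S l) =
      ((l : MvPolynomial σ ℂ) + 1) * esymmOn S (l + 1) := by
  induction S using Finset.induction_on generalizing l with
  | empty => cases l <;> simp [esymmOn_empty_succ]
  | insert a S ha ih =>
    rw [sum_insert ha]
    cases l with
    | zero =>
      have := ih 0
      simp only [esymmOn_zero, mul_one, Derivation.map_one_eq_zero, sub_zero] at this ⊢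
      rw [esymmOn_insert ha, this]
      simp [add_comm]
    | succ l =>
      have h1 := ih (l + 1)
      have h2 := ih l
      simp only [esymmOn_insert ha, map_add, Derivation.leibniz, sqDer_X, smul_eq_mul] at h1 h2 ⊢
      push_cast at h1 ⊢
      linear_combination h1 + MvPolynomial.X a * h2

end Ladder

/-! ### Products of differences over admissible pairings -/

section Pairings

variable {n : ℕ}

/-- The product of the differences `X_i - X_j`, `(i, j) ∈ P`. -/
def diffPoly (P : Finset (Fin n × Fin n)) : MvPolynomial (Fin n) ℂ :=
  ∏ p ∈ P, (MvPolynomial.X p.1 - MvPolynomial.X p.2)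

/-- The polynomial of which `basisOp` is the operator version. -/
def basisPoly (k : ℕ) (P : Finset (Fin n × Fin n)) : MvPolynomial (Fin n) ℂ :=
  diffPoly P * esymmOn (paired P)ᶜ (k - #P)

theorem mem_paired {P : Finset (Fin n × Fin n)} {m : Fin n} :
    m ∈ paired P ↔ ∃ q ∈ P, m = q.1 ∨ m = q.2 := by
  simp only [paired, mem_union, mem_image]
  grind

theorem IsAdmissible.sum_paired {P : Finset (Fin n × Fin n)} (hP : IsAdmissible P) {M : Type*}
    [AddCommMonoid M] (f : Fin n → M) : ∑ i ∈ paired P, f i = ∑ p ∈ P, (f p.1 + f p.2) := by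
  rw [paired, sum_union, sum_image, sum_image, sum_add_distrib]
  · intro p hp q hq h
    by_contra hne
    exact (hP.disjoint p hp q hq hne).2.2.2 h
  · intro p hp q hq h
    by_contra hne
    exact (hP.disjoint p hp q hq hne).1 h
  · rw [disjoint_left]
    intro m hm hm'
    obtain ⟨p, hp, rfl⟩ := mem_image.1 hm
    obtain ⟨q, hq, h⟩ := mem_image.1 hm'
    by_cases hpq : p = q
    · subst hpq
      exact (hP.lt p hp).ne h.symm
    · exact (hP.disjoint p hp q hq hpq).2.1 h.symm

theorem IsAdmissible.card_paired {P : Finset (Fin n × Fin n)} (hP : IsAdmissible P) :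
    #(paired P) = 2 * #P := by
  have := hP.sum_paired fun _ => 1
  simpa [mul_comm] using this

theorem IsAdmissible.card_compl_paired {P : Finset (Fin n × Fin n)} (hP : IsAdmissible P) :
    #(paired P)ᶜ + 2 * #P = n := by
  rw [← hP.card_paired, card_compl_add_card, Fintype.card_fin]

theorem raising_diffPoly (P : Finset (Fin n × Fin n)) : raising (Fin n) (diffPoly P) = 0 := by
  induction P using Finset.induction_on with
  | empty => simp [diffPoly]
  | insert a P ha ih =>
    simp only [diffPoly] at ih
    simp [diffPoly, prod_insert ha, Derivation.leibniz, ih]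

/-- Factor by factor this is `x² - y² = (x + y)(x - y)`; it makes the differences singlets for the
lowering operator too. -/
theorem sqDer_diffPoly (P : Finset (Fin n × Fin n)) : sqDer (Fin n) (diffPoly P) =
    (∑ p ∈ P, (MvPolynomial.X p.1 + MvPolynomial.X p.2)) * diffPoly P := by
  induction P using Finset.induction_on with
  | empty => simp [diffPoly]
  | insert a P ha ih =>
    simp only [diffPoly] at ih
    simp only [diffPoly, prod_insert ha, sum_insert ha, Derivation.leibniz, ih, smul_eq_mul,
      map_sub, sqDer_X]
    ring

/-- Only the symmetric factor is differentiated; it lives on `n - 2 #P` unpaired variables, which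
explains the constant. -/
theorem raising_basisPoly {P : Finset (Fin n × Fin n)} (hP : IsAdmissible P) {k : ℕ}
    (hk : #P ≤ k) :
    raising (Fin n) (basisPoly (k + 1) P) = ((n : ℂ) - #P - k) • basisPoly k P := by
  obtain ⟨l, rfl⟩ := Nat.exists_eq_add_of_le hk
  have h := congrArg (Nat.cast : ℕ → MvPolynomial (Fin n) ℂ) hP.card_compl_paired
  rw [basisPoly, basisPoly, show #P + l + 1 - #P = l + 1 by omega, Nat.add_sub_cancel_left]
  simp only [Derivation.leibniz, raising_diffPoly, raising_esymmOn, smul_eq_mul, mul_zero,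
    add_zero, MvPolynomial.smul_eq_C_mul]
  push_cast at h
  simp only [map_sub, map_natCast]
  push_cast
  linear_combination (diffPoly P * esymmOn (paired P)ᶜ l) * h

/-- The sum of the paired variables cancels against `sqDer` of the differences, so only the unpaired
variables lower. -/
theorem lowering_basisPoly {P : Finset (Fin n × Fin n)} (hP : IsAdmissible P) {k : ℕ}
    (hk : #P ≤ k) :
    lowering (Fin n) (basisPoly k P) = ((k : ℂ) + 1 - #P) • basisPoly (k + 1) P := by
  obtain ⟨l, rfl⟩ := Nat.exists_eq_add_of_le hk
  rw [basisPoly, basisPoly, show #P + l + 1 - #P = l + 1 by omega, Nat.add_sub_cancel_left,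
    lowering_apply, ← sum_add_sum_compl (paired P), hP.sum_paired]
  have h := sum_X_mul_esymmOn_sub (paired P)ᶜ l
  simp only [Derivation.leibniz, sqDer_diffPoly, smul_eq_mul, MvPolynomial.smul_eq_C_mul, map_sub,
    map_add, map_natCast, map_one]
  push_cast
  linear_combination diffPoly P * h

theorem basisPoly_card (P : Finset (Fin n × Fin n)) : basisPoly #P P = diffPoly P := by
  simp [basisPoly]

end Pairings

end Fock

namespace Fock

open MvPolynomial Finset

/-! ### Linear independence of the noncrossing basis -/

section Independence

variable {n : ℕ}

/-- An admissible pairing is determined by its left end points. -/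
theorem IsAdmissible.eq_of_image_fst {P P' : Finset (Fin n × Fin n)} (hP : IsAdmissible P)
    (hP' : IsAdmissible P') (h : P.image Prod.fst = P'.image Prod.fst) : P = P' := by
  have key : ∀ m : ℕ, ∀ i j j' : Fin n, n - i.val = m → (i, j) ∈ P → (i, j') ∈ P' → j = j' := by
    intro m
    induction m using Nat.strong_induction_on with
    | _ m ih =>
      intro i j j' hm hj hj'
      by_contra hne
      -- As in matching parentheses, partners are determined from the innermost, right to left. If
      -- `j < j'`, then `j` is paired by `R'` inside `(i, j')`: as a left end it would be a left end
      -- for `R` too, and as a right end its partner, lying right of `i`, would by induction be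
      -- paired with `j` in `R` as well; either way `R` uses `j` twice.
      have aux : ∀ (R R' : Finset (Fin n × Fin n)), IsAdmissible R → IsAdmissible R' →
          R.image Prod.fst = R'.image Prod.fst →
          (∀ a b b' : Fin n, i < a → (a, b) ∈ R → (a, b') ∈ R' → b = b') →
          ∀ j j', (i, j) ∈ R → (i, j') ∈ R' → ¬ j < j' := by
        intro R R' hR hR' hRR' hi j j' hj hj' hlt
        obtain ⟨q, hq, hjq, hiq, -⟩ := hR'.no_blank _ hj' j (hR.lt _ hj) hlt
        obtain ⟨r, hr, hrq⟩ := mem_image.1 (hRR' ▸ mem_image_of_mem Prod.fst hq :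
          q.1 ∈ R.image Prod.fst)
        have hne : (i, j) ≠ r := by
          rintro rfl
          exact hiq.ne hrq
        have hd := hR.disjoint _ hj r hr hne
        rcases hjq with hjq | hjq
        · exact hd.2.2.1 (hjq.trans hrq.symm)
        · have : r.2 = q.2 := hi q.1 r.2 q.2 hiq (by rw [← hrq]; exact hr) hq
          exact hd.2.2.2 (hjq.trans this.symm)
      rcases lt_or_gt_of_ne hne with hlt | hlt
      · exact aux P P' hP hP' h (fun a b b' ha hb hb' =>
          ih (n - a.val) (by have := a.2; have : i.val < a.val := ha; omega) a b b' rfl hb hb')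
          j j' hj hj' hlt
      · exact aux P' P hP' hP h.symm (fun a b b' ha hb hb' =>
          (ih (n - a.val) (by have := a.2; have : i.val < a.val := ha; omega) a b' b rfl hb'
            hb).symm) j' j hj' hj hlt
  have sub : ∀ R R' : Finset (Fin n × Fin n), R.image Prod.fst = R'.image Prod.fst →
      (∀ i j j', (i, j) ∈ R → (i, j') ∈ R' → j = j') → R ⊆ R' := by
    rintro R R' hRR' hk ⟨i, j⟩ hr
    obtain ⟨⟨i', j'⟩, hr', rfl⟩ := mem_image.1 (hRR' ▸ mem_image_of_mem Prod.fst hr :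
      i ∈ R'.image Prod.fst)
    rw [hk _ _ _ hr hr']
    exact hr'
  exact (sub P P' h fun i j j' => key _ i j j' rfl).antisymm
    (sub P' P h.symm fun i j j' hj hj' => (key _ i j' j rfl hj' hj).symm)

/-- The exponent of a squarefree monomial. -/
def sqfreeExp {σ : Type*} (I : Finset σ) : σ →₀ ℕ := ∑ i ∈ I, Finsupp.single i 1

theorem sqfreeExp_apply {σ : Type*} [DecidableEq σ] (I : Finset σ) (i : σ) :
    sqfreeExp I i = if i ∈ I then 1 else 0 := by
  simp [sqfreeExp, Finsupp.finsetSum_apply, Finsupp.single_apply]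

theorem sqfreeExp_injective {σ : Type*} : Function.Injective (sqfreeExp (σ := σ)) := by
  classical
  intro I J h
  ext i
  have := DFunLike.congr_fun h i
  simp only [sqfreeExp_apply] at this
  grind

theorem sqfree_eq_monomial {σ : Type*} (I : Finset σ) : sqfree I = monomial (sqfreeExp I) 1 := by
  rw [sqfree, sqfreeExp, monomial_sum_one]
  rfl

theorem coeff_sqfree {σ : Type*} [DecidableEq σ] (I J : Finset σ) :
    coeff (sqfreeExp I) (sqfree J) = if I = J then 1 else 0 := by
  rw [sqfree_eq_monomial, coeff_monomial]
  simp only [sqfreeExp_injective.eq_iff, eq_comm]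

/-- Expansion of a product of differences over the choices of a point in each pair. -/
theorem IsAdmissible.diffPoly_eq {P : Finset (Fin n × Fin n)} (hP : IsAdmissible P) :
    diffPoly P = ∑ R ∈ P.powerset, (-1) ^ #(P \ R) *
      sqfree (R.image Prod.fst ∪ (P \ R).image Prod.snd) := by
  simp only [diffPoly, sub_eq_add_neg, prod_add]
  refine sum_congr rfl fun R hR => ?_
  have hR := mem_powerset.1 hR
  rw [prod_neg, sqfree, prod_union, prod_image, prod_image]
  · ring
  · intro p hp q hq h
    by_contra hne
    exact (hP.disjoint p (sdiff_subset hp) q (sdiff_subset hq) hne).2.2.2 h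
  · intro p hp q hq h
    by_contra hne
    exact (hP.disjoint p (hR hp) q (hR hq) hne).1 h
  · rw [disjoint_left]
    intro m hm hm'
    obtain ⟨p, hp, rfl⟩ := mem_image.1 hm
    obtain ⟨q, hq, h⟩ := mem_image.1 hm'
    by_cases hpq : p = q
    · subst hpq
      exact (mem_sdiff.1 hq).2 hp
    · exact (hP.disjoint p (hR hp) q (sdiff_subset hq) hpq).2.1 h.symm

theorem IsAdmissible.sum_image_fst {P R : Finset (Fin n × Fin n)} (hP : IsAdmissible P)
    (hR : R ⊆ P) : ∑ i ∈ R.image Prod.fst, i.val = ∑ p ∈ R, p.1.val := by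
  rw [sum_image]
  intro p hp q hq h
  by_contra hne
  exact (hP.disjoint p (hR hp) q (hR hq) hne).1 h

/-- If the choice of a point from each pair of `P` gives the left ends of `P'`, then these lie
to the right of those of `P`, and coincide with them only for the choice of all left ends. -/
theorem IsAdmissible.sum_choice {P R : Finset (Fin n × Fin n)} (hP : IsAdmissible P) (hR : R ⊆ P)
    (hne : R ≠ P) : ∑ p ∈ P, p.1.val <
      ∑ i ∈ R.image Prod.fst ∪ (P \ R).image Prod.snd, i.val := by
  rw [sum_union, sum_image, sum_image, ← sum_sdiff hR, add_comm]
  · refine add_lt_add_of_le_of_lt le_rfl (sum_lt_sum_of_nonempty ?_ fun p hp => ?_)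
    · rw [sdiff_nonempty]
      exact fun h => hne (hR.antisymm h)
    · exact hP.lt p (sdiff_subset hp)
  · intro p hp q hq h
    by_contra hne
    exact (hP.disjoint p (sdiff_subset hp) q (sdiff_subset hq) hne).2.2.2 h
  · intro p hp q hq h
    by_contra hne
    exact (hP.disjoint p (hR hp) q (hR hq) hne).1 h
  · rw [disjoint_left]
    intro m hm hm'
    obtain ⟨p, hp, rfl⟩ := mem_image.1 hm
    obtain ⟨q, hq, h⟩ := mem_image.1 hm'
    by_cases hpq : p = q
    · subst hpq
      exact (mem_sdiff.1 hq).2 hp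
    · exact (hP.disjoint p (hR hp) q (sdiff_subset hq) hpq).2.1 h.symm

/-- Triangularity: every monomial of `diffPoly P` other than that of all left ends has a strictly
larger index sum, and the left ends determine the pairing. -/
theorem IsAdmissible.coeff_diffPoly {P P' : Finset (Fin n × Fin n)} (hP : IsAdmissible P)
    (hP' : IsAdmissible P') (hle : ∑ p ∈ P', p.1.val ≤ ∑ p ∈ P, p.1.val) :
    coeff (sqfreeExp (P'.image Prod.fst)) (diffPoly P) = if P' = P then 1 else 0 := by
  rw [hP.diffPoly_eq, coeff_sum, sum_eq_single P]
  · simp only [sdiff_self, card_empty, pow_zero, one_mul, image_empty, union_empty, coeff_sqfree,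
      bot_eq_empty]
    refine if_congr ⟨fun h => hP'.eq_of_image_fst hP h, fun h => h ▸ rfl⟩ rfl rfl
  · intro R hR hne
    have hR := mem_powerset.1 hR
    have h1 : ((-1) ^ #(P \ R) : MvPolynomial (Fin n) ℂ) = MvPolynomial.C ((-1) ^ #(P \ R)) := by simp
    rw [h1, coeff_C_mul, coeff_sqfree, if_neg, mul_zero]
    intro h
    have := hP.sum_choice hR hne
    rw [← h, hP'.sum_image_fst subset_rfl] at this
    omega
  · simp

/-- Products of differences over distinct admissible pairings are linearly independent. -/
theorem linearIndependent_diffPoly :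
    LinearIndependent ℂ fun P : {P : Finset (Fin n × Fin n) // IsAdmissible P} =>
      diffPoly P.1 := by
  rw [linearIndependent_iff']
  intro s g hg
  by_contra! hcon
  have hne : (s.filter fun P => g P ≠ 0).Nonempty := by
    obtain ⟨P, hP, h⟩ := hcon
    exact ⟨P, mem_filter.2 ⟨hP, h⟩⟩
  -- With the smallest sum of left ends among the pairings that occur, no other one contributes to
  -- the leading monomial of `P'`.
  obtain ⟨P', hP', hmin⟩ := exists_min_image _ (fun P => ∑ p ∈ P.1, p.1.val) hne
  have h := congrArg (coeff (sqfreeExp (P'.1.image Prod.fst))) hg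
  rw [coeff_sum, sum_eq_single P'] at h
  · rw [coeff_smul, P'.2.coeff_diffPoly P'.2 le_rfl, if_pos rfl] at h
    exact (mem_filter.1 hP').2 (by simpa using h)
  · intro P hP hPP'
    by_cases hgP : g P = 0
    · rw [hgP, zero_smul, coeff_zero]
    · rw [coeff_smul, P.2.coeff_diffPoly P'.2 (hmin P (mem_filter.2 ⟨hP, hgP⟩)), if_neg, smul_zero]
      exact fun h => hPP' (Subtype.ext h.symm)
  · intro h'
    exact absurd (mem_filter.1 hP').1 h'

/-- If a combination of the `basisPoly` is annihilated by the raising operator, then only those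
with the maximal number of pairs occur. -/
theorem eq_zero_of_raising_eq_zero (k : ℕ) (s : Finset (Finset (Fin n × Fin n)))
    (g : Finset (Fin n × Fin n) → ℂ) (hs : ∀ P ∈ s, IsAdmissible P ∧ #P ≤ k ∧ k + #P ≤ n) :
    (raising (Fin n) (∑ P ∈ s, g P • basisPoly k P) = 0 → ∀ P ∈ s, #P < k → g P = 0) ∧
    (∑ P ∈ s, g P • basisPoly k P = 0 → ∀ P ∈ s, g P = 0) := by
  classical
  -- The two assertions are proved together: independence in degree `k` gives the first one in
  -- degree `k + 1`, after which only pure products of differences remain and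
  -- `linearIndependent_diffPoly` gives the second.
  induction k generalizing s g with
  | zero =>
    refine ⟨fun _ P _ h => absurd h (by omega), fun h P hP => ?_⟩
    have hP0 : ∀ P ∈ s, P = ∅ := fun P hP => by simpa using (hs P hP).2.1
    have hs' : s = {∅} := by
      refine Finset.eq_singleton_iff_unique_mem.2 ⟨hP0 P hP ▸ hP, hP0⟩
    rw [hs', sum_singleton] at h
    rw [hP0 P hP]
    simpa [basisPoly, diffPoly] using h
  | succ k ih =>
    have first : raising (Fin n) (∑ P ∈ s, g P • basisPoly (k + 1) P) = 0 →
        ∀ P ∈ s, #P < k + 1 → g P = 0 := by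
      intro h P hP hPk
      have hsub : ∑ P ∈ s with #P < k + 1, (g P * ((n : ℂ) - #P - k)) • basisPoly k P = 0 := by
        rw [← h, map_sum, ← sum_filter_add_sum_filter_not s fun P => #P < k + 1]
        rw [sum_eq_zero (s := s.filter fun P => ¬ #P < k + 1), add_zero]
        · refine sum_congr rfl fun P hP => ?_
          have := (mem_filter.1 hP)
          rw [Derivation.map_smul, raising_basisPoly (hs P this.1).1 (by omega), smul_smul]
        · intro P hP
          have hP := mem_filter.1 hP
          have : #P = k + 1 := by have := (hs P hP.1).2.1; omega
          rw [Derivation.map_smul, ← this, basisPoly_card, raising_diffPoly, smul_zero]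
      have := (ih _ _ (fun P hP => by
        have hP := mem_filter.1 hP
        have := hs P hP.1
        exact ⟨this.1, by omega, by omega⟩)).2 hsub P (mem_filter.2 ⟨hP, hPk⟩)
      -- The factor from `raising_basisPoly` vanishes only if `n = #P + k`, contrary to `k + 1 + #P
      -- ≤ n`.
      refine (mul_eq_zero.1 this).resolve_right fun h0 => ?_
      have h1 : (n : ℂ) = ((#P + k : ℕ) : ℂ) := by
        push_cast
        linear_combination h0
      have h2 : n = #P + k := by exact_mod_cast h1
      have := hs P hP
      omega
    refine ⟨first, fun h P hP => ?_⟩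
    have hlow := first (by rw [h, map_zero])
    by_cases hPk : #P < k + 1
    · exact hlow P hP hPk
    · have h2 : ∑ P ∈ s, g P • diffPoly P = 0 := by
        rw [← h]
        refine sum_congr rfl fun P hP => ?_
        by_cases hPk : #P < k + 1
        · rw [hlow P hP hPk, zero_smul, zero_smul]
        · have : #P = k + 1 := by have := (hs P hP).2.1; omega
          rw [← this, basisPoly_card]
      have h3 := linearIndependent_iff'.1 (linearIndependent_diffPoly (n := n))
        (s.subtype IsAdmissible) (fun P => g P.1) (by
          rw [← h2]
          refine sum_subtype_of_mem (fun P => g P • diffPoly P) fun P hP => (hs P hP).1)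
      exact h3 ⟨P, (hs P hP).1⟩ (mem_subtype.2 hP)

end Independence

end Fock

namespace Fock

open MvPolynomial Finset

/-! ### The noncrossing basis spans -/

section Spanning

variable {n : ℕ}

/-- Interior points of a pair of `P` are paired, so neither new end lies inside an old pair; the old
pairs meeting the interval `(b, b')` are therefore contained in it. -/
theorem IsAdmissible.insert_pair {P : Finset (Fin n × Fin n)} (hP : IsAdmissible P) {b b' : Fin n}
    (hbb' : b < b') (hb : b ∉ paired P) (hb' : b' ∉ paired P)
    (h : ∀ m, b < m → m < b' → m ∈ paired P) : IsAdmissible (insert (b, b') P) := by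
  have hcov : ∀ q ∈ P, ∀ m, q.1 < m → m < q.2 → m ∈ paired P := by
    intro q hq m h1 h2
    obtain ⟨r, hr, hm, -⟩ := hP.no_blank q hq m h1 h2
    exact mem_paired.2 ⟨r, hr, hm⟩
  have hnb : ∀ q ∈ P, b ≠ q.1 ∧ b ≠ q.2 := fun q hq =>
    ⟨fun h => hb (mem_paired.2 ⟨q, hq, .inl h⟩), fun h => hb (mem_paired.2 ⟨q, hq, .inr h⟩)⟩
  have hnb' : ∀ q ∈ P, b' ≠ q.1 ∧ b' ≠ q.2 := fun q hq =>
    ⟨fun h => hb' (mem_paired.2 ⟨q, hq, .inl h⟩), fun h => hb' (mem_paired.2 ⟨q, hq, .inr h⟩)⟩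
  refine ⟨?_, ?_, ?_, ?_⟩
  · intro p hp
    rcases mem_insert.1 hp with rfl | hp
    · exact hbb'
    · exact hP.lt p hp
  · intro p hp q hq hne
    rcases mem_insert.1 hp with rfl | hp <;> rcases mem_insert.1 hq with rfl | hq
    · exact absurd rfl hne
    · exact ⟨(hnb q hq).1, (hnb q hq).2, (hnb' q hq).1, (hnb' q hq).2⟩
    · exact ⟨(hnb p hp).1.symm, (hnb' p hp).1.symm, (hnb p hp).2.symm, (hnb' p hp).2.symm⟩
    · exact hP.disjoint p hp q hq hne
  · intro p hp q hq
    rcases mem_insert.1 hp with rfl | hp <;> rcases mem_insert.1 hq with rfl | hq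
    · exact fun h => lt_irrefl _ h.1
    · exact fun h => hb' (hcov q hq _ h.2.1 h.2.2)
    · exact fun h => hb (hcov p hp _ h.1 h.2.1)
    · exact hP.noncrossing p hp q hq
  · intro p hp m h1 h2
    rcases mem_insert.1 hp with rfl | hp
    · obtain ⟨q, hq, hm⟩ := mem_paired.1 (h m h1 h2)
      have hlt := hP.lt q hq
      refine ⟨q, mem_insert_of_mem hq, hm, ?_, ?_⟩
      · by_contra hcon
        refine hb (hcov q hq b (lt_of_le_of_ne (not_lt.1 hcon) (hnb q hq).1.symm) ?_)
        rcases hm with rfl | rfl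
        · exact absurd h1 hcon
        · exact h1
      · by_contra hcon
        refine hb' (hcov q hq b' ?_ (lt_of_le_of_ne (not_lt.1 hcon) (hnb' q hq).2))
        rcases hm with rfl | rfl
        · exact h2
        · exact absurd h2 hcon
    · obtain ⟨q, hq, hm⟩ := hP.no_blank p hp m h1 h2
      exact ⟨q, mem_insert_of_mem hq, hm⟩

theorem paired_insert (b b' : Fin n) (P : Finset (Fin n × Fin n)) :
    paired (insert (b, b') P) = insert b (insert b' (paired P)) := by
  simp only [paired, image_insert]
  grind

/-- The points in the initial segment of length `m`. -/
def initSeg (n m : ℕ) : Finset (Fin n) := univ.filter fun i => i.val < m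

/-- The span of the basis polynomials of degree `k` on an initial segment. -/
def segSpan (n m k : ℕ) : Submodule ℂ (MvPolynomial (Fin n) ℂ) :=
  Submodule.span ℂ {p | ∃ (P : Finset (Fin n × Fin n)) (l : ℕ), IsAdmissible P ∧
    paired P ⊆ initSeg n m ∧ #P + l = k ∧ p = diffPoly P * esymmOn (initSeg n m \ paired P) l}

theorem natCast_smul_mem_iff {M : Type*} [AddCommGroup M] [Module ℂ M] (V : Submodule ℂ M)
    {c : ℕ} (hc : c ≠ 0) {v : M} : (c : ℂ) • v ∈ V ↔ v ∈ V :=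
  V.smul_mem_iff (Nat.cast_ne_zero.2 hc)

section Step

variable {m : ℕ} (hm : m < n)

theorem initSeg_succ : initSeg n (m + 1) = insert ⟨m, hm⟩ (initSeg n m) := by
  ext i
  simp [initSeg, Fin.ext_iff]
  omega

theorem notMem_initSeg : (⟨m, hm⟩ : Fin n) ∉ initSeg n m := by simp [initSeg]

theorem mem_initSeg_iff (i : Fin n) : i ∈ initSeg n m ↔ i < ⟨m, hm⟩ := by
  simp [initSeg, Fin.lt_def]

/-- Joining an unpaired `b` to the new site is admissible only if `b` is the rightmost unpaired
point. The other cases are uncrossed by induction from the right. -/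
theorem new_pair_mem {P : Finset (Fin n × Fin n)} (hP : IsAdmissible P)
    (hPm : paired P ⊆ initSeg n m) (l : ℕ) (b : Fin n) (hb : b ∈ initSeg n m \ paired P) :
    diffPoly P * ((MvPolynomial.X b - MvPolynomial.X ⟨m, hm⟩) *
      esymmOn ((initSeg n m \ paired P).erase b) l) ∈ segSpan n (m + 1) (#P + 1 + l) := by
  set a : Fin n := ⟨m, hm⟩ with ha
  set S := initSeg n m \ paired P with hS
  have haI : a ∉ initSeg n m := notMem_initSeg hm
  have haP : a ∉ paired P := fun h => haI (hPm h)
  have haS : a ∉ S := fun h => haI (mem_sdiff.1 h).1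
  have hadd : ∀ c c' : Fin n, c ∈ S → c' ∈ insert a S → c < c' →
      (∀ d, c < d → d < c' → d ∈ paired P) → ∀ R, R = (insert a S \ {c, c'}) →
      diffPoly P * ((MvPolynomial.X c - MvPolynomial.X c') * esymmOn R l) ∈
        segSpan n (m + 1) (#P + 1 + l) := by
    intro c c' hc hc' hlt hbet R hR
    have hcP : c ∉ paired P := (mem_sdiff.1 hc).2
    have hc'P : c' ∉ paired P := by
      rcases mem_insert.1 hc' with rfl | h
      · exact haP
      · exact (mem_sdiff.1 h).2
    have hnot : (c, c') ∉ P := fun h => hcP (mem_paired.2 ⟨_, h, .inl rfl⟩)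
    refine Submodule.subset_span ⟨insert (c, c') P, l, hP.insert_pair hlt hcP hc'P hbet, ?_, ?_, ?_⟩
    · rw [paired_insert, initSeg_succ hm]
      grind
    · rw [card_insert_of_notMem hnot]
    · rw [paired_insert, initSeg_succ hm, diffPoly, diffPoly, prod_insert hnot]
      have : insert a (initSeg n m) \ insert c (insert c' (paired P)) = R := by
        rw [hR, hS]
        grind
      rw [this]
      ring
  have key : ∀ d : ℕ, ∀ b : Fin n, n - b.val = d → b ∈ S →
      diffPoly P * ((MvPolynomial.X b - MvPolynomial.X a) * esymmOn (S.erase b) l) ∈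
        segSpan n (m + 1) (#P + 1 + l) := by
    intro d
    induction d using Nat.strong_induction_on with
    | _ d ih =>
      intro b hd hb
      have hba : b < a := (mem_initSeg_iff hm b).1 (mem_sdiff.1 hb).1
      by_cases hne : (S.filter fun c => b < c).Nonempty
      · obtain ⟨b', hb', hmin⟩ := exists_min_image _ id hne
        obtain ⟨hb'S, hbb'⟩ := mem_filter.1 hb'
        have hb'a : b' < a := (mem_initSeg_iff hm b').1 (mem_sdiff.1 hb'S).1
        have h1 := hadd b b' hb (mem_insert_of_mem hb'S) hbb' (fun c hc hc' => by
          by_contra hcon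
          have hcS : c ∈ S :=
            mem_sdiff.2 ⟨(mem_initSeg_iff hm c).2 (hc'.trans hb'a), hcon⟩
          have := hmin c (mem_filter.2 ⟨hcS, hc⟩)
          exact absurd hc' (not_lt.2 this)) _ rfl
        have h2 := ih (n - b'.val) (by have := b'.2; have : b.val < b'.val := hbb'; omega) b' rfl
          hb'S
        set R := (S.erase b).erase b' with hR
        have hb'e : b' ∈ S.erase b := mem_erase.2 ⟨hbb'.ne', hb'S⟩
        have e3 : S.erase b = insert b' R := (insert_erase hb'e).symm
        have e2 : S.erase b' = insert b R := by
          rw [hR, erase_right_comm, insert_erase (mem_erase.2 ⟨hbb'.ne, hb⟩)]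
        have haR : a ∉ R := fun h => haS (mem_of_mem_erase (mem_of_mem_erase h))
        have hbR : b ∉ R := fun h => notMem_erase _ _ (mem_of_mem_erase h)
        have hb'R : b' ∉ R := notMem_erase _ _
        have e1 : insert a S \ {b, b'} = insert a R := by
          ext i
          simp only [hR, mem_erase, mem_sdiff, mem_insert, mem_singleton]
          have h1 := hba.ne'
          have h2 := hb'a.ne'
          grind
        rw [e1] at h1
        rw [e2] at h2
        rw [e3]
        -- With `b'` the next unpaired point and `R` the remaining ones, this is the identity `(x_b
        -- - x_a) e_l(R ∪ b') = (x_b - x_b') e_l(R ∪ a) + (x_b' - x_a) e_l(R ∪ b)`.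
        convert add_mem h1 h2 using 1
        cases l with
        | zero => simp; ring
        | succ l =>
          rw [esymmOn_insert haR, esymmOn_insert hbR, esymmOn_insert hb'R]
          ring
      · rw [not_nonempty_iff_eq_empty, filter_eq_empty_iff] at hne
        refine hadd b a hb (mem_insert_self _ _) hba (fun c hc hc' => ?_) _ ?_
        · by_contra hcon
          exact hne (x := c) (mem_sdiff.2 ⟨(mem_initSeg_iff hm c).2 hc', hcon⟩) hc
        · clear_value S
          ext i
          simp only [mem_erase, mem_sdiff, mem_insert, mem_singleton]
          grind
  exact key _ b rfl hb

/-- The Clebsch–Gordan step of tensoring with one more `ℂ²`: the new site either joins the unpaired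
points or gets paired with one of them. -/
theorem step_mem {P : Finset (Fin n × Fin n)} (hP : IsAdmissible P)
    (hPm : paired P ⊆ initSeg n m) (l : ℕ) :
    diffPoly P * (MvPolynomial.X ⟨m, hm⟩ * esymmOn (initSeg n m \ paired P) l) ∈
        segSpan n (m + 1) (#P + l + 1) ∧
      diffPoly P * esymmOn (initSeg n m \ paired P) l ∈ segSpan n (m + 1) (#P + l) := by
  set a : Fin n := ⟨m, hm⟩ with ha
  set S := initSeg n m \ paired P with hS
  have haI : a ∉ initSeg n m := notMem_initSeg hm
  have haS : a ∉ S := fun h => haI (mem_sdiff.1 h).1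
  have haP : a ∉ paired P := fun h => haI (hPm h)
  have hbasic : ∀ l, diffPoly P * esymmOn (insert a S) l ∈ segSpan n (m + 1) (#P + l) := by
    intro l
    refine Submodule.subset_span ⟨P, l, hP, hPm.trans ?_, rfl, ?_⟩
    · rw [initSeg_succ hm]
      exact subset_insert _ _
    · rw [initSeg_succ hm]
      congr 2
      grind
  have hX : ∀ l, diffPoly P * (MvPolynomial.X a * esymmOn S l) ∈
      segSpan n (m + 1) (#P + l + 1) := by
    intro l
    have h1 : _ ∈ segSpan n (m + 1) (#P + l + 1) :=
      Submodule.smul_mem _ ((l : ℂ) + 1) (hbasic (l + 1))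
    have h2 := Submodule.sum_mem (t := S) (segSpan n (m + 1) (#P + 1 + l)) fun b hb =>
      new_pair_mem hm hP hPm l b hb
    rw [show #P + 1 + l = #P + l + 1 by omega] at h2
    have h3 := sub_mem h1 h2
    -- Averaging over the possible partners gives `(#S + 1) x_a e_l(S) = (l + 1) e_{l+1}(S ∪ a) -
    -- ∑_{b ∈ S} (x_b - x_a) e_l(S \ b)`.
    rw [← natCast_smul_mem_iff _ (Nat.succ_ne_zero #S)]
    convert h3 using 1
    rw [← mul_sum]
    simp only [sub_mul, sum_sub_distrib, ← hS, ← mul_sum]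
    rw [sum_X_mul_esymmOn_erase, sum_esymmOn_erase, esymmOn_insert haS]
    simp only [MvPolynomial.smul_eq_C_mul, map_add, map_natCast, map_one]
    push_cast
    ring
  refine ⟨hX l, ?_⟩
  cases l with
  | zero => simpa using hbasic 0
  | succ l =>
    have := sub_mem (hbasic (l + 1)) (hX l)
    rw [esymmOn_insert haS] at this
    convert this using 1
    ring

end Step

theorem sqfree_mem_segSpan (m : ℕ) (hm : m ≤ n) (I : Finset (Fin n)) (hI : I ⊆ initSeg n m) :
    sqfree I ∈ segSpan n m #I := by
  induction m generalizing I with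
  | zero =>
    have : I = ∅ := by
      rw [← subset_empty]
      simpa [initSeg] using hI
    subst this
    refine Submodule.subset_span ⟨∅, 0, ⟨?_, ?_, ?_, ?_⟩, ?_, rfl, ?_⟩ <;>
      simp [paired, sqfree, diffPoly]
  | succ m ih =>
    have key : ∀ k, ∀ p ∈ segSpan n m k, p ∈ segSpan n (m + 1) k ∧
        MvPolynomial.X ⟨m, hm⟩ * p ∈ segSpan n (m + 1) (k + 1) := by
      intro k p hp
      induction hp using Submodule.span_induction with
      | mem p hp =>
        obtain ⟨P, l, hP, hPm, rfl, rfl⟩ := hp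
        have := step_mem hm hP hPm l
        rw [mul_left_comm]
        exact ⟨this.2, this.1⟩
      | zero => simp
      | add p q _ _ hp hq =>
        rw [mul_add]
        exact ⟨add_mem hp.1 hq.1, add_mem hp.2 hq.2⟩
      | smul c p _ hp =>
        rw [mul_smul_comm]
        exact ⟨Submodule.smul_mem _ _ hp.1, Submodule.smul_mem _ _ hp.2⟩
    rw [initSeg_succ hm] at hI
    by_cases ha : (⟨m, hm⟩ : Fin n) ∈ I
    · have hI' : I.erase ⟨m, hm⟩ ⊆ initSeg n m := by grind
      have := (key _ _ (ih (by omega) _ hI')).2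
      rw [sqfree, mul_prod_erase _ _ ha, card_erase_add_one ha] at this
      exact this
    · exact (key _ _ (ih (by omega) I ((subset_insert_iff_of_notMem ha).1 hI))).1

/-- The span of the squarefree monomials of degree `k`. -/
def sqfreeSpan (n k : ℕ) : Submodule ℂ (MvPolynomial (Fin n) ℂ) :=
  Submodule.span ℂ {p | ∃ I : Finset (Fin n), #I = k ∧ p = sqfree I}

/-- The span of the products of differences over admissible pairings with `k` pairs. -/
def highestSpan (n k : ℕ) : Submodule ℂ (MvPolynomial (Fin n) ℂ) :=
  Submodule.span ℂ {p | ∃ P : Finset (Fin n × Fin n), IsAdmissible P ∧ #P = k ∧ p = diffPoly P}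

/-- The expanded differences choose one point from each pair, and the symmetric factor uses only
unpaired points, so no variable is repeated. -/
theorem IsAdmissible.basisPoly_mem {P : Finset (Fin n × Fin n)} (hP : IsAdmissible P) {k : ℕ}
    (hk : #P ≤ k) : basisPoly k P ∈ sqfreeSpan n k := by
  rw [basisPoly, hP.diffPoly_eq, sum_mul]
  refine sum_mem fun R hR => ?_
  have hR := mem_powerset.1 hR
  rw [esymmOn, mul_sum]
  refine sum_mem fun J hJ => ?_
  have hJ := mem_powersetCard.1 hJ
  set A := R.image Prod.fst ∪ (P \ R).image Prod.snd with hA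
  have hAP : A ⊆ paired P :=
    union_subset_union (image_subset_image hR) (image_subset_image sdiff_subset)
  have hcard : #A = #P := by
    rw [hA, card_union_of_disjoint, card_image_of_injOn, card_image_of_injOn, add_comm,
      card_sdiff_add_card_eq_card hR]
    · intro p hp q hq h
      by_contra hne
      exact (hP.disjoint p (sdiff_subset hp) q (sdiff_subset hq) hne).2.2.2 h
    · intro p hp q hq h
      by_contra hne
      exact (hP.disjoint p (hR hp) q (hR hq) hne).1 h
    · rw [disjoint_left]
      intro m hm hm'
      obtain ⟨p, hp, rfl⟩ := mem_image.1 hm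
      obtain ⟨q, hq, h⟩ := mem_image.1 hm'
      by_cases hpq : p = q
      · subst hpq
        exact (mem_sdiff.1 hq).2 hp
      · exact (hP.disjoint p (hR hp) q (sdiff_subset hq) hpq).2.1 h.symm
  have hdisj : Disjoint A J := by
    rw [disjoint_left]
    exact fun i hi hi' => mem_compl.1 (hJ.1 hi') (hAP hi)
  have h1 : ((-1) ^ #(P \ R) : MvPolynomial (Fin n) ℂ) = MvPolynomial.C ((-1) ^ #(P \ R)) := by
    simp
  have h2 : sqfree A * sqfree J = sqfree (A ∪ J) := (prod_union hdisj).symm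
  rw [mul_assoc, h2, h1, ← MvPolynomial.smul_eq_C_mul]
  refine Submodule.smul_mem _ _ (Submodule.subset_span ⟨A ∪ J, ?_, rfl⟩)
  rw [card_union_of_disjoint hdisj, hcard, hJ.2]
  omega

theorem initSeg_self : initSeg n n = univ := by
  simp [initSeg]

theorem span_basisPoly (n k : ℕ) :
    Submodule.span ℂ (Set.range fun P : BasisIndex n k => basisPoly k P.1) = sqfreeSpan n k := by
  refine le_antisymm (Submodule.span_le.2 ?_) (Submodule.span_le.2 ?_)
  · rintro _ ⟨P, rfl⟩
    exact P.2.1.basisPoly_mem P.2.2.1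
  · rintro _ ⟨I, rfl, rfl⟩
    have h := sqfree_mem_segSpan n le_rfl I (by rw [initSeg_self]; exact subset_univ _)
    refine Submodule.span_le.2 ?_ h
    rintro _ ⟨P, l, hP, -, hl, rfl⟩
    rw [initSeg_self, ← compl_eq_univ_sdiff, ← hl]
    -- The generators of `segSpan` carry no upper bound on `l`; those beyond the range of
    -- `BasisIndex` are zero, since only `n - 2 #P` variables are available.
    by_cases hn : #P + l + #P ≤ n
    · refine Submodule.subset_span ⟨⟨P, hP, by omega, by omega⟩, ?_⟩
      simp [basisPoly]
    · rw [esymmOn_eq_zero, mul_zero]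
      · exact zero_mem _
      · have := hP.card_compl_paired
        omega

theorem linearIndependent_basisPoly (n k : ℕ) :
    LinearIndependent ℂ fun P : BasisIndex n k => basisPoly k P.1 := by
  classical
  rw [linearIndependent_iff']
  intro s g hg P hP
  have h := (eq_zero_of_raising_eq_zero k (s.map (Function.Embedding.subtype _))
    (fun P => if h : _ then g ⟨P, h⟩ else 0) (fun P hP => by
      obtain ⟨Q, -, rfl⟩ := mem_map.1 hP
      exact Q.2)).2 (by
      rw [sum_map, ← hg]
      refine sum_congr rfl fun Q _ => ?_
      exact congrArg (· • basisPoly k Q.1) (dif_pos Q.2)) P.1 (mem_map_of_mem _ hP)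
  simpa only [dif_pos P.2] using h

/-- The algebraic core of the classification of primaries: expanded in the noncrossing basis, a
vector in the kernel has no component with fewer than `k` pairs. -/
theorem mem_highestSpan_iff {n k : ℕ} {p : MvPolynomial (Fin n) ℂ} (hp : p ∈ sqfreeSpan n k) :
    raising (Fin n) p = 0 ↔ p ∈ highestSpan n k := by
  classical
  constructor
  · intro h
    rw [← span_basisPoly, Finsupp.mem_span_range_iff_exists_finsupp] at hp
    obtain ⟨c, rfl⟩ := hp
    have hc := (eq_zero_of_raising_eq_zero k (c.support.map (Function.Embedding.subtype _))
      (fun P => if h : _ then c ⟨P, h⟩ else 0) (fun P hP => by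
        obtain ⟨Q, -, rfl⟩ := mem_map.1 hP
        exact Q.2)).1 (by
        rw [sum_map, ← h, Finsupp.sum]
        congr 1
        refine sum_congr rfl fun Q _ => ?_
        exact congrArg (· • basisPoly k Q.1) (dif_pos Q.2))
    refine sum_mem fun P hP => Submodule.smul_mem _ _ ?_
    have h1 := hc P.1 (mem_map_of_mem _ hP)
    simp only [dif_pos P.2] at h1
    have h2 : #P.1 = k := by
      by_contra hne
      exact (Finsupp.mem_support_iff.1 hP) (h1 (lt_of_le_of_ne P.2.2.1 hne))
    refine Submodule.subset_span ⟨P.1, P.2.1, h2, ?_⟩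
    simp only [← h2, basisPoly_card]
  · intro h
    have hle : highestSpan n k ≤ LinearMap.ker (raising (Fin n)).toLinearMap := by
      refine Submodule.span_le.2 ?_
      rintro _ ⟨P, -, -, rfl⟩
      exact raising_diffPoly P
    exact hle h

end Spanning

end Fock

/-! ### Modes of fields -/

namespace ChiralField

variable {V : Type*} [AddCommGroup V] [Module ℂ V]

@[simp]
theorem ncoeff_deriv (A : VertexOperator ℂ V) (n : ℤ) :
    (deriv A)[[n]] = (-(n : ℂ)) • A[[n - 1]] := by
  simp [deriv]

theorem ncoeff_idField (n : ℤ) :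
    (idField : VertexOperator ℂ V)[[n]] = if n = -1 then 1 else 0 := by
  simp [idField]

theorem ncoeff_nop_eq_sum (N : ℕ) (ε : ℂ) {A B : VertexOperator ℂ V} {n : ℤ} {v : V}
    (hA : ∀ r : ℕ, N ≤ r → (A[[(r : ℤ)]]) v = 0) (hB : ∀ r : ℕ, N ≤ r → (B[[n + r]]) v = 0) :
    ((nop ε A B)[[n]]) v = ∑ r ∈ Finset.range N, nopTerm ε A B n v r := by
  rw [ncoeff_nop]
  refine finsum_eq_sum_of_support_subset _ fun r hr => ?_
  by_contra h
  have h : N ≤ r := by simpa using h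
  exact hr (by simp [nopTerm, hA r h, hB r h])

theorem map_ncoeff_nop {W : Type*} [AddCommGroup W] [Module ℂ W] (T : V →ₗ[ℂ] W) (ε : ℂ)
    (A B : VertexOperator ℂ V) (n : ℤ) (v : V) :
    T (((nop ε A B)[[n]]) v) = ∑ᶠ r : ℕ, T (nopTerm ε A B n v r) := by
  rw [ncoeff_nop]
  exact T.toAddMonoidHom.map_finsum (nopTerm_finite ε A B n v)

/-- The fields all of whose modes commute with a given endomorphism. -/
def centralizer (T : Module.End ℂ V) : Submodule ℂ (VertexOperator ℂ V) where
  carrier := {A | ∀ n v, T ((A[[n]]) v) = (A[[n]]) (T v)}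
  add_mem' hA hB n v := by simp [hA n v, hB n v]
  zero_mem' n v := by simp
  smul_mem' c A hA n v := by simp [hA n v]

/-- This lets any composite built from one site commute with everything living at the other sites.
-/
theorem nop_mem_centralizer {T : Module.End ℂ V} {A B : VertexOperator ℂ V}
    (hA : A ∈ centralizer T) (hB : B ∈ centralizer T) (ε : ℂ) : nop ε A B ∈ centralizer T := by
  intro n v
  rw [map_ncoeff_nop, ncoeff_nop]
  refine finsum_congr fun r => ?_
  simp only [nopTerm, map_add, map_smul]
  rw [hA, hB, hB, hA]

theorem deriv_mem_centralizer {T : Module.End ℂ V} {A : VertexOperator ℂ V}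
    (hA : A ∈ centralizer T) : deriv A ∈ centralizer T := by
  intro n v
  simp [hA _ v]

/-- The fields whose nonnegative modes annihilate a given vector. -/
def vacuumFields (Ω : V) : Submodule ℂ (VertexOperator ℂ V) where
  carrier := {A | ∀ r : ℕ, (A[[(r : ℤ)]]) Ω = 0}
  add_mem' hA hB n := by simp [hA n, hB n]
  zero_mem' n := by simp
  smul_mem' c A hA n := by simp [hA n]

section Vacuum

variable {Ω : V} {A B : VertexOperator ℂ V}

theorem apply_vacuum (hA : A ∈ vacuumFields Ω) {n : ℤ} (hn : 0 ≤ n) : (A[[n]]) Ω = 0 := by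
  obtain ⟨r, rfl⟩ := Int.eq_ofNat_of_zero_le hn
  exact hA r

theorem idField_mem_vacuumFields : idField ∈ vacuumFields Ω := by
  intro r
  rw [ncoeff_idField, if_neg (by omega)]
  rfl

theorem nop_mem_vacuumFields (hA : A ∈ vacuumFields Ω) (hB : B ∈ vacuumFields Ω) (ε : ℂ) :
    nop ε A B ∈ vacuumFields Ω := by
  intro n
  rw [ncoeff_nop_eq_sum 0 ε (fun r _ => hA r) fun r _ => apply_vacuum hB (by omega)]
  rfl

/-- All contraction terms die on the vacuum and only `r = 0` survives. Nested products of fields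
thus turn into iterated modes acting on states. -/
theorem nop_neg_one_vacuum (hA : A ∈ vacuumFields Ω) (hB : B ∈ vacuumFields Ω) (ε : ℂ) :
    ((nop ε A B)[[-1]]) Ω = (A[[-1]]) ((B[[-1]]) Ω) := by
  rw [ncoeff_nop_eq_sum 1 ε (fun r _ => hA r) fun r _ => apply_vacuum hB (by omega)]
  have := hA 0
  simp only [Nat.cast_zero] at this
  simp [nopTerm, this]

theorem nop_neg_two_vacuum (hA : A ∈ vacuumFields Ω) (hB : B ∈ vacuumFields Ω) (ε : ℂ) :
    ((nop ε A B)[[-2]]) Ω = (A[[-1]]) ((B[[-2]]) Ω) + (A[[-2]]) ((B[[-1]]) Ω) := by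
  rw [ncoeff_nop_eq_sum 2 ε (fun r _ => hA r) fun r _ => apply_vacuum hB (by omega)]
  have h0 := hA 0
  have h1 := hA 1
  simp only [Nat.cast_zero, Nat.cast_one] at h0 h1
  simp [nopTerm, Finset.sum_range_succ, h0, h1]

end Vacuum

end ChiralField

open ChiralField

namespace Fock

variable {n : ℕ}

/-! ### Modes of the free fields -/

theorem ncoeff_freeField_natCast (cre ann : ℕ → Module.End ℂ (Fock n)) (h) (r : ℕ) :
    (freeField cre ann h)[[(r : ℤ)]] = ann r := by
  rw [freeField, ncoeff_ofModes]

theorem ncoeff_freeField_neg (cre ann : ℕ → Module.End ℂ (Fock n)) (h) (r : ℕ) :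
    (freeField cre ann h)[[-1 - (r : ℤ)]] = cre r := by
  rw [freeField, ncoeff_ofModes, show -1 - (r : ℤ) = Int.negSucc r by omega]

theorem ncoeff_freeField (cre ann : ℕ → Module.End ℂ (Fock n)) (h) (m : ℤ) :
    (freeField cre ann h)[[m]] = if 0 ≤ m then ann m.toNat else cre (-1 - m).toNat := by
  split_ifs with hm
  · obtain ⟨r, rfl⟩ := Int.eq_ofNat_of_zero_le hm
    exact ncoeff_freeField_natCast cre ann h r
  · obtain ⟨r, rfl⟩ : ∃ r : ℕ, m = -1 - (r : ℤ) := ⟨(-1 - m).toNat, by omega⟩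
    rw [ncoeff_freeField_neg]
    congr 1
    omega

theorem freeField_mem_vacuumFields {cre ann : ℕ → Module.End ℂ (Fock n)} {h} {v : Fock n}
    (hv : ∀ r, ann r v = 0) : freeField cre ann h ∈ vacuumFields v := fun r => by
  rw [ncoeff_freeField_natCast, hv]

theorem freeField_mem_centralizer {cre ann : ℕ → Module.End ℂ (Fock n)} {h}
    {T : Module.End ℂ (Fock n)} (hc : ∀ r v, T (cre r v) = cre r (T v))
    (ha : ∀ r v, T (ann r v) = ann r (T v)) : freeField cre ann h ∈ centralizer T := by
  intro m v
  rw [ncoeff_freeField]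
  split_ifs
  · exact ha _ v
  · exact hc _ v

/-! ### States without ghosts -/

/-- The polynomial ring in the bosonic creation modes. -/
abbrev BosonPoly (n : ℕ) : Type := MvPolynomial (BosonMode n) ℂ

/-- The states without ghosts. -/
def ghostFree (n : ℕ) : BosonPoly n →ₗ[ℂ] Fock n :=
  (TensorProduct.mk ℂ (BosonPoly n) (ExteriorAlgebra ℂ (GhostMode n →₀ ℂ))).flip 1

theorem ghostFree_apply (p : BosonPoly n) : ghostFree n p = p ⊗ₜ[ℂ] 1 := rfl

theorem vac_eq : (vac : Fock n) = ghostFree n 1 := rfl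

@[simp]
theorem bosonCre_ghostFree (m : BosonMode n) (p : BosonPoly n) :
    bosonCre m (ghostFree n p) = ghostFree n (MvPolynomial.X m * p) := by
  simp [bosonCre, ghostFree_apply]

@[simp]
theorem bosonAnn_ghostFree (m : BosonMode n) (p : BosonPoly n) :
    bosonAnn m (ghostFree n p) = ghostFree n (MvPolynomial.pderiv m p) := by
  simp [bosonAnn, ghostFree_apply]

@[simp]
theorem ghostAnn_ghostFree (g : GhostMode n) (p : BosonPoly n) :
    ghostAnn g (ghostFree n p) = 0 := by
  simp [ghostAnn, ghostFree_apply, CliffordAlgebra.contractLeft_one]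

/-- Multiplication by a polynomial in the bosonic creation modes. -/
def mulBoson (g : BosonPoly n) : Module.End ℂ (Fock n) :=
  LinearMap.rTensor _ (LinearMap.mulLeft ℂ g)

@[simp]
theorem mulBoson_ghostFree (g p : BosonPoly n) :
    mulBoson g (ghostFree n p) = ghostFree n (g * p) := by
  simp [mulBoson, ghostFree_apply]

theorem rTensor_comm {f g : Module.End ℂ (BosonPoly n)} (h : ∀ p, f (g p) = g (f p))
    (v : Fock n) : LinearMap.rTensor (ExteriorAlgebra ℂ (GhostMode n →₀ ℂ)) f
      (LinearMap.rTensor _ g v) = LinearMap.rTensor _ g (LinearMap.rTensor _ f v) := by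
  rw [← LinearMap.rTensor_comp_apply, ← LinearMap.rTensor_comp_apply]
  congr 2
  exact LinearMap.ext h

theorem mulBoson_bosonCre (g : BosonPoly n) (m : BosonMode n) (v : Fock n) :
    mulBoson g (bosonCre m v) = bosonCre m (mulBoson g v) :=
  rTensor_comm (fun p => by simp [mul_left_comm]) v

theorem mulBoson_bosonAnn {g : BosonPoly n} {m : BosonMode n} (hg : MvPolynomial.pderiv m g = 0)
    (v : Fock n) : mulBoson g (bosonAnn m v) = bosonAnn m (mulBoson g v) :=
  rTensor_comm (fun p => by simp [Derivation.leibniz, hg]) v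

theorem bosonCre_comm (m m' : BosonMode n) (v : Fock n) :
    bosonCre m (bosonCre m' v) = bosonCre m' (bosonCre m v) :=
  rTensor_comm (fun p => by simp [mul_left_comm]) v

theorem pderiv_comm (m m' : BosonMode n) (p : BosonPoly n) :
    (MvPolynomial.pderiv m : Derivation ℂ (BosonPoly n) (BosonPoly n)).toLinearMap
        ((MvPolynomial.pderiv m' : Derivation ℂ (BosonPoly n) (BosonPoly n)).toLinearMap p) =
      (MvPolynomial.pderiv m' : Derivation ℂ (BosonPoly n) (BosonPoly n)).toLinearMap
        ((MvPolynomial.pderiv m : Derivation ℂ (BosonPoly n) (BosonPoly n)).toLinearMap p) := by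
  classical
  let D : Derivation ℂ (BosonPoly n) (BosonPoly n) := MvPolynomial.pderiv m
  let D' : Derivation ℂ (BosonPoly n) (BosonPoly n) := MvPolynomial.pderiv m'
  have h : ⁅D, D'⁆ = 0 := by
    refine MvPolynomial.derivation_ext fun k => ?_
    rw [Derivation.commutator_apply]
    simp only [D, D', MvPolynomial.pderiv_X, Pi.single_apply]
    split_ifs <;> simp
  exact sub_eq_zero.1 ((Derivation.commutator_apply (D1 := D) (D2 := D') p).symm.trans (DFunLike.congr_fun h p))

theorem bosonAnn_comm (m m' : BosonMode n) (v : Fock n) :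
    bosonAnn m (bosonAnn m' v) = bosonAnn m' (bosonAnn m v) :=
  rTensor_comm (pderiv_comm m m') v

theorem bosonAnn_bosonCre {m m' : BosonMode n} (h : m' ≠ m) (v : Fock n) :
    bosonAnn m (bosonCre m' v) = bosonCre m' (bosonAnn m v) :=
  rTensor_comm (fun p => by
    simp [Derivation.leibniz, MvPolynomial.pderiv_X_of_ne h]) v

theorem X_mem_vacuumFields (i : Fin n) : X i ∈ vacuumFields (vac : Fock n) :=
  freeField_mem_vacuumFields fun r => by simp [vac_eq]

theorem Y_mem_vacuumFields (i : Fin n) : Y i ∈ vacuumFields (vac : Fock n) :=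
  freeField_mem_vacuumFields fun r => by simp [vac_eq]

theorem ncoeff_X (i : Fin n) (m : ℤ) :
    (X i)[[m]] = if 0 ≤ m then bosonAnn (.y i m.toNat) else bosonCre (.x i (-1 - m).toNat) :=
  ncoeff_freeField _ _ _ m

theorem ncoeff_Y (i : Fin n) (m : ℤ) :
    (Y i)[[m]] = if 0 ≤ m then -bosonAnn (.x i m.toNat) else bosonCre (.y i (-1 - m).toNat) :=
  ncoeff_freeField _ _ _ m

theorem ncoeff_H (a : Fin (n - 1)) (m : ℤ) :
    (H a)[[m]] = if 0 ≤ m then hAnn a m.toNat else bosonCre (.h a (-1 - m).toNat) :=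
  ncoeff_freeField _ _ _ m

/-! ### Independence of different sites -/

/-- The endomorphism `T` commutes with the modes of the `i`-th symplectic boson. -/
structure CommutesWithSite (i : Fin n) (T : Module.End ℂ (Fock n)) : Prop where
  cre_x : ∀ r v, T (bosonCre (.x i r) v) = bosonCre (.x i r) (T v)
  cre_y : ∀ r v, T (bosonCre (.y i r) v) = bosonCre (.y i r) (T v)
  ann_x : ∀ r v, T (bosonAnn (.x i r) v) = bosonAnn (.x i r) (T v)
  ann_y : ∀ r v, T (bosonAnn (.y i r) v) = bosonAnn (.y i r) (T v)

theorem CommutesWithSite.X_mem {i : Fin n} {T : Module.End ℂ (Fock n)}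
    (hT : CommutesWithSite i T) : X i ∈ centralizer T :=
  freeField_mem_centralizer hT.cre_x hT.ann_y

theorem CommutesWithSite.Y_mem {i : Fin n} {T : Module.End ℂ (Fock n)}
    (hT : CommutesWithSite i T) : Y i ∈ centralizer T :=
  freeField_mem_centralizer hT.cre_y fun r v => by simp [hT.ann_x]

theorem CommutesWithSite.gaugeA_mem {i : Fin n} {T : Module.End ℂ (Fock n)}
    (hT : CommutesWithSite i T) : gaugeA i ∈ centralizer T :=
  neg_mem (nop_mem_centralizer hT.X_mem hT.Y_mem 1)

theorem covD_apply (i : Fin n) (A : VertexOperator ℂ (Fock n)) : covD i A =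
    nop 1 (gaugeA i) A + nop 1 (X i) (nop 1 (Y i) A) + nop 1 (gaugeA i) A := rfl

theorem CommutesWithSite.opT_mem {i : Fin n} {T : Module.End ℂ (Fock n)}
    (hT : CommutesWithSite i T) : opT i ∈ centralizer T := by
  have h := hT.gaugeA_mem
  exact Submodule.smul_mem _ _ (add_mem (add_mem (nop_mem_centralizer h h 1)
    (nop_mem_centralizer hT.X_mem (nop_mem_centralizer hT.Y_mem h 1) 1))
    (nop_mem_centralizer h h 1))

theorem commutesWithSite_mulBoson {i : Fin n} {g : BosonPoly n}
    (hx : ∀ r, MvPolynomial.pderiv (.x i r) g = 0) (hy : ∀ r, MvPolynomial.pderiv (.y i r) g = 0) :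
    CommutesWithSite i (mulBoson g) where
  cre_x _ := mulBoson_bosonCre _ _
  cre_y _ := mulBoson_bosonCre _ _
  ann_x r := mulBoson_bosonAnn (hx r)
  ann_y r := mulBoson_bosonAnn (hy r)

theorem commutesWithSite_bosonCre {i : Fin n} {m : BosonMode n} (hx : ∀ r, m ≠ .x i r)
    (hy : ∀ r, m ≠ .y i r) : CommutesWithSite i (bosonCre m) where
  cre_x _ := bosonCre_comm m _
  cre_y _ := bosonCre_comm m _
  ann_x r v := (bosonAnn_bosonCre (hx r) v).symm
  ann_y r v := (bosonAnn_bosonCre (hy r) v).symm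

theorem commutesWithSite_bosonAnn {i : Fin n} {m : BosonMode n} (hx : ∀ r, m ≠ .x i r)
    (hy : ∀ r, m ≠ .y i r) : CommutesWithSite i (bosonAnn m) where
  cre_x r := bosonAnn_bosonCre (hx r).symm
  cre_y r := bosonAnn_bosonCre (hy r).symm
  ann_x _ := bosonAnn_comm m _
  ann_y _ := bosonAnn_comm m _

/-! ### Polynomials in the commuting operators `D_i` -/

/-- The effect of `D_i` on states. -/
def stateD (i : Fin n) : Module.End ℂ (Fock n) :=
  (gaugeA i)[[-1]] + (X i)[[-1]] * (Y i)[[-1]] + (gaugeA i)[[-1]]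

theorem stateD_apply (i : Fin n) (v : Fock n) : stateD i v =
    ((gaugeA i)[[-1]]) v + ((X i)[[-1]]) (((Y i)[[-1]]) v) + ((gaugeA i)[[-1]]) v := rfl

theorem CommutesWithSite.stateD_apply {i : Fin n} {T : Module.End ℂ (Fock n)}
    (hT : CommutesWithSite i T) (v : Fock n) : T (stateD i v) = stateD i (T v) := by
  simp only [Fock.stateD_apply, map_add, hT.gaugeA_mem _ _, hT.X_mem _ _, hT.Y_mem _ _]

/-- The principle is used from the other end: the modes at site `i` commute with site `j`, hence
with `stateD j`. -/
theorem commutesWithSite_stateD {i j : Fin n} (h : j ≠ i) : CommutesWithSite i (stateD j) where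
  cre_x r v := ((commutesWithSite_bosonCre (by simp [h.symm]) (by simp)).stateD_apply v).symm
  cre_y r v := ((commutesWithSite_bosonCre (by simp) (by simp [h.symm])).stateD_apply v).symm
  ann_x r v := ((commutesWithSite_bosonAnn (by simp [h.symm]) (by simp)).stateD_apply v).symm
  ann_y r v := ((commutesWithSite_bosonAnn (by simp) (by simp [h.symm])).stateD_apply v).symm

theorem stateD_comm (i j : Fin n) : stateD i * stateD j = stateD j * stateD i := by
  by_cases h : i = j
  · rw [h]
  · exact LinearMap.ext (commutesWithSite_stateD h).stateD_apply

theorem adjoin_stateD_comm (a : Module.End ℂ (Fock n)) (ha : a ∈ Set.range (stateD (n := n)))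
    (b : Module.End ℂ (Fock n)) (hb : b ∈ Set.range (stateD (n := n))) : a * b = b * a := by
  obtain ⟨i, rfl⟩ := ha
  obtain ⟨j, rfl⟩ := hb
  exact stateD_comm i j

open scoped IsMulCommutative in
/-- Polynomials in the commuting operators `D_i`, acting on states. -/
def polyD (n : ℕ) : MvPolynomial (Fin n) ℂ →ₐ[ℂ] Module.End ℂ (Fock n) :=
  haveI := Algebra.isMulCommutative_adjoin ℂ (adjoin_stateD_comm (n := n))
  (Algebra.adjoin ℂ (Set.range (stateD (n := n)))).val.comp
    (MvPolynomial.aeval (S₁ := Algebra.adjoin ℂ (Set.range (stateD (n := n))))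
      fun i : Fin n => ⟨stateD i, Algebra.subset_adjoin ⟨i, rfl⟩⟩)

@[simp]
theorem polyD_X (i : Fin n) : polyD n (MvPolynomial.X i) = stateD i := by
  simp [polyD]

theorem state_apply (A : VertexOperator ℂ (Fock n)) : state A = (A[[-1]]) vac := rfl

theorem gaugeA_mem_vacuumFields (i : Fin n) : gaugeA i ∈ vacuumFields (vac : Fock n) :=
  neg_mem (nop_mem_vacuumFields (X_mem_vacuumFields i) (Y_mem_vacuumFields i) 1)

theorem covD_mem_vacuumFields (i : Fin n) {A : VertexOperator ℂ (Fock n)}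
    (hA : A ∈ vacuumFields (vac : Fock n)) : covD i A ∈ vacuumFields (vac : Fock n) :=
  add_mem (add_mem (nop_mem_vacuumFields (gaugeA_mem_vacuumFields i) hA 1)
    (nop_mem_vacuumFields (X_mem_vacuumFields i)
      (nop_mem_vacuumFields (Y_mem_vacuumFields i) hA 1) 1))
    (nop_mem_vacuumFields (gaugeA_mem_vacuumFields i) hA 1)

theorem state_covD (i : Fin n) {A : VertexOperator ℂ (Fock n)}
    (hA : A ∈ vacuumFields (vac : Fock n)) : state (covD i A) = stateD i (state A) := by
  have hY := nop_mem_vacuumFields (Y_mem_vacuumFields i) hA 1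
  rw [covD_apply, map_add, map_add, stateD_apply]
  simp only [state_apply]
  rw [nop_neg_one_vacuum (gaugeA_mem_vacuumFields i) hA,
    nop_neg_one_vacuum (X_mem_vacuumFields i) hY, nop_neg_one_vacuum (Y_mem_vacuumFields i) hA]

/-- An endomorphism of the space of fields that acts on states as a polynomial in the `D_i`. -/
def ActsAs (F : Module.End ℂ (VertexOperator ℂ (Fock n))) (p : MvPolynomial (Fin n) ℂ) : Prop :=
  ∀ A ∈ vacuumFields (vac : Fock n), F A ∈ vacuumFields (vac : Fock n) ∧
    state (F A) = polyD n p (state A)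

theorem ActsAs.mul {F G : Module.End ℂ (VertexOperator ℂ (Fock n))} {p q : MvPolynomial (Fin n) ℂ}
    (hF : ActsAs F p) (hG : ActsAs G q) : ActsAs (F * G) (p * q) := fun A hA => by
  obtain ⟨h1, h2⟩ := hG A hA
  obtain ⟨h3, h4⟩ := hF _ h1
  exact ⟨h3, by rw [Module.End.mul_apply, h4, h2, map_mul, Module.End.mul_apply]⟩

theorem actsAs_covD (i : Fin n) : ActsAs (covD i) (MvPolynomial.X i) := fun A hA =>
  ⟨covD_mem_vacuumFields i hA, by rw [polyD_X, state_covD i hA]⟩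

theorem ActsAs.sub {F G : Module.End ℂ (VertexOperator ℂ (Fock n))} {p q : MvPolynomial (Fin n) ℂ}
    (hF : ActsAs F p) (hG : ActsAs G q) : ActsAs (F - G) (p - q) := fun A hA =>
  ⟨sub_mem (hF A hA).1 (hG A hA).1, by
    rw [LinearMap.sub_apply, map_sub, (hF A hA).2, (hG A hA).2, map_sub, LinearMap.sub_apply]⟩

theorem actsAs_sum {ι : Type*} (s : Finset ι)
    {F : ι → Module.End ℂ (VertexOperator ℂ (Fock n))} {p : ι → MvPolynomial (Fin n) ℂ}
    (h : ∀ i ∈ s, ActsAs (F i) (p i)) : ActsAs (∑ i ∈ s, F i) (∑ i ∈ s, p i) := fun A hA => by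
  refine ⟨?_, ?_⟩
  · rw [LinearMap.sum_apply]
    exact sum_mem fun i hi => (h i hi A hA).1
  · rw [LinearMap.sum_apply, map_sum, map_sum, LinearMap.sum_apply]
    exact Finset.sum_congr rfl fun i hi => (h i hi A hA).2

/-- The product on the right lies in a commutative ring; this is why the enumerations chosen in
`covSet` and `diffProd` have no effect on states. -/
theorem actsAs_list_prod {ι : Type*} (l : List ι)
    {F : ι → Module.End ℂ (VertexOperator ℂ (Fock n))} {p : ι → MvPolynomial (Fin n) ℂ}
    (h : ∀ i, ActsAs (F i) (p i)) : ActsAs (l.map F).prod (l.map p).prod := by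
  induction l with
  | nil => exact fun A hA => ⟨hA, by simp⟩
  | cons a l ih =>
    rw [List.map_cons, List.map_cons, List.prod_cons, List.prod_cons]
    exact (h a).mul ih

theorem actsAs_covSet (I : Finset (Fin n)) : ActsAs (covSet I) (sqfree I) := by
  rw [sqfree, ← Finset.prod_map_toList]
  exact actsAs_list_prod _ actsAs_covD

theorem actsAs_sigma (K : Finset (Fin n)) (l : ℕ) : ActsAs (sigma K l) (esymmOn Kᶜ l) :=
  actsAs_sum _ fun J _ => actsAs_covSet J

theorem actsAs_diffProd (P : Finset (Fin n × Fin n)) : ActsAs (diffProd P) (diffPoly P) := by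
  rw [diffPoly, ← Finset.prod_map_toList]
  exact actsAs_list_prod _ fun p => (actsAs_covD p.1).sub (actsAs_covD p.2)

theorem state_basisOp {O : VertexOperator ℂ (Fock n)} (hO : O ∈ vacuumFields (vac : Fock n))
    (k : ℕ) (P : Finset (Fin n × Fin n)) :
    state (basisOp O k P) = polyD n (basisPoly k P) (state O) :=
  (((actsAs_diffProd P).mul (actsAs_sigma _ _)) O hO).2

/-- The state obtained by applying a polynomial in the `D_i` to the operator `O`. -/
def levelMap (O : VertexOperator ℂ (Fock n)) : MvPolynomial (Fin n) ℂ →ₗ[ℂ] Fock n :=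
  (LinearMap.applyₗ (state O)).comp (polyD n).toLinearMap

theorem levelMap_apply (O : VertexOperator ℂ (Fock n)) (p : MvPolynomial (Fin n) ℂ) :
    levelMap O p = polyD n p (state O) := rfl

theorem map_sqfreeSpan {O : VertexOperator ℂ (Fock n)} (hO : O ∈ vacuumFields (vac : Fock n))
    (k : ℕ) : (sqfreeSpan n k).map (levelMap O) = levelSpan O k := by
  rw [sqfreeSpan, Submodule.map_span, levelSpan]
  congr 1
  ext v
  simp only [Set.mem_image, Set.mem_ofPred_eq]
  constructor
  · rintro ⟨_, ⟨I, hI, rfl⟩, rfl⟩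
    exact ⟨I, hI, ((actsAs_covSet I) O hO).2.symm⟩
  · rintro ⟨I, hI, rfl⟩
    exact ⟨_, ⟨I, hI, rfl⟩, ((actsAs_covSet I) O hO).2.symm⟩

theorem map_highestSpan {O : VertexOperator ℂ (Fock n)} (hO : O ∈ vacuumFields (vac : Fock n))
    (k : ℕ) : (highestSpan n k).map (levelMap O) = primarySpan O k := by
  rw [highestSpan, Submodule.map_span, primarySpan]
  congr 1
  ext v
  simp only [Set.mem_image, Set.mem_ofPred_eq]
  constructor
  · rintro ⟨_, ⟨P, hP, hk, rfl⟩, rfl⟩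
    exact ⟨P, hP, hk, ((actsAs_diffProd P) O hO).2.symm⟩
  · rintro ⟨P, hP, hk, rfl⟩
    exact ⟨_, ⟨P, hP, hk, rfl⟩, ((actsAs_diffProd P) O hO).2.symm⟩

/-! ### One site -/

/-- The creation modes of `X_i` (`true`) or `Y_i` (`false`). -/
def letter : Bool → Fin n → ℕ → BosonMode n
  | true => .x
  | false => .y

/-- The sign by which `𝒜_i` acts on `X_i` (`true`) or `Y_i` (`false`). -/
def sgn : Bool → ℂ
  | true => 1
  | false => -1

/-- The state `X_i` or `Y_i`. -/
def site0 (σ : Bool) (i : Fin n) : BosonPoly n := MvPolynomial.X (letter σ i 0)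

/-- The state `D_i X_i` or `D_i Y_i`. -/
def site1 (σ : Bool) (i : Fin n) : BosonPoly n :=
  (2 * sgn σ) • MvPolynomial.X (letter σ i 1) -
    MvPolynomial.X (.x i 0) * MvPolynomial.X (.y i 0) * MvPolynomial.X (letter σ i 0)

/-- Polynomials that do not involve the modes of index at least `N` of the `i`-th boson. -/
def IsLow (N : ℕ) (i : Fin n) (p : BosonPoly n) : Prop :=
  ∀ r, N ≤ r → MvPolynomial.pderiv (.x i r) p = 0 ∧ MvPolynomial.pderiv (.y i r) p = 0

theorem isLow_site0 (σ : Bool) (i : Fin n) : IsLow 1 i (site0 σ i) := by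
  classical
  intro r hr
  cases σ <;>
    simp [site0, letter, MvPolynomial.pderiv_X, show ¬ 0 = r by omega]

theorem isLow_site1 (σ : Bool) (i : Fin n) : IsLow 2 i (site1 σ i) := by
  classical
  intro r hr
  cases σ <;>
    simp [site1, letter, sgn, MvPolynomial.pderiv_X, Derivation.leibniz,
      show ¬ 0 = r by omega, show ¬ 1 = r by omega]

theorem IsLow.mono {N M : ℕ} (h : N ≤ M) {i : Fin n} {p : BosonPoly n} (hp : IsLow N i p) :
    IsLow M i p := fun r hr => hp r (h.trans hr)

theorem IsLow.X_apply {N : ℕ} {i : Fin n} {p : BosonPoly n} (hp : IsLow N i p) {m : ℤ}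
    (hm : N ≤ m) : ((X i)[[m]]) (ghostFree n p) = 0 := by
  rw [ncoeff_X, if_pos (by omega), bosonAnn_ghostFree, (hp m.toNat (by omega)).2, map_zero]

theorem IsLow.Y_apply {N : ℕ} {i : Fin n} {p : BosonPoly n} (hp : IsLow N i p) {m : ℤ}
    (hm : N ≤ m) : ((Y i)[[m]]) (ghostFree n p) = 0 := by
  rw [ncoeff_Y, if_pos (by omega), LinearMap.neg_apply, bosonAnn_ghostFree,
    (hp m.toNat (by omega)).1, map_zero, neg_zero]

theorem IsLow.current_apply {N : ℕ} {i : Fin n} {p : BosonPoly n} (hp : IsLow N i p) {m : ℤ}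
    (M : ℕ) (hM : N ≤ M) (hm : N ≤ m + M) : ((nop 1 (X i) (Y i))[[m]]) (ghostFree n p) =
      ∑ r ∈ Finset.range M, nopTerm 1 (X i) (Y i) m (ghostFree n p) r :=
  ncoeff_nop_eq_sum M 1 (fun r hr => hp.X_apply (by omega)) fun r hr => hp.Y_apply (by omega)

/-- The composites `Y_i X_i` of low modes annihilate a state with one letter at site `i`. -/
theorem site_Y_X (σ : Bool) (i : Fin n) {p : BosonPoly n} (hp : p = site0 σ i ∨ p = site1 σ i) :
    (∀ m : ℤ, 1 ≤ m → ((Y i)[[m]]) (((X i)[[0]]) (ghostFree n p)) = 0) ∧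
      ∀ m : ℤ, 0 ≤ m → ((Y i)[[m]]) (((X i)[[1]]) (ghostFree n p)) = 0 := by
  classical
  constructor <;> intro m hm <;> obtain ⟨r, rfl⟩ := Int.eq_ofNat_of_zero_le (by omega : 0 ≤ m)
  · have h0 : ¬ 0 = r := by omega
    rcases hp with rfl | rfl <;> cases σ <;>
      simp [ncoeff_X, ncoeff_Y, site0, site1, letter, sgn, MvPolynomial.pderiv_X,
        Derivation.leibniz, h0]
  · rcases hp with rfl | rfl <;> cases σ <;>
      simp [ncoeff_X, ncoeff_Y, site0, site1, letter, sgn, MvPolynomial.pderiv_X,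
        Derivation.leibniz]

theorem isLow_site (σ : Bool) (i : Fin n) {p : BosonPoly n} (hp : p = site0 σ i ∨ p = site1 σ i) :
    IsLow 2 i p := by
  rcases hp with rfl | rfl
  · exact (isLow_site0 σ i).mono (by omega)
  · exact isLow_site1 σ i

/-- A letter and its covariant derivative carry the same charge. This equality is what makes the
`O_I` closed. -/
theorem site_current_zero (σ : Bool) (i : Fin n) {p : BosonPoly n}
    (hp : p = site0 σ i ∨ p = site1 σ i) :
    ((nop 1 (X i) (Y i))[[0]]) (ghostFree n p) = (-sgn σ) • ghostFree n p := by
  classical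
  rw [(isLow_site σ i hp).current_apply 2 le_rfl (by omega)]
  rcases hp with rfl | rfl <;> cases σ
  all_goals
    simp only [Finset.sum_range_succ, Finset.sum_range_zero, nopTerm, ncoeff_X, ncoeff_Y, site0,
      site1, letter, sgn]
    norm_num
    simp only [← map_add, ← map_neg, ← map_sub, ← map_smul]
    refine congrArg _ ?_
    simp
  all_goals
    generalize (MvPolynomial.X (BosonMode.x i 0) : BosonPoly n) = x0
    generalize (MvPolynomial.X (BosonMode.x i 1) : BosonPoly n) = x1
    generalize (MvPolynomial.X (BosonMode.y i 0) : BosonPoly n) = y0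
    generalize (MvPolynomial.X (BosonMode.y i 1) : BosonPoly n) = y1
    algebra

theorem site_current_pos (σ : Bool) (i : Fin n) {p : BosonPoly n}
    (hp : p = site0 σ i ∨ p = site1 σ i) {m : ℤ} (hm : 1 ≤ m) :
    ((nop 1 (X i) (Y i))[[m]]) (ghostFree n p) = 0 := by
  classical
  rw [(isLow_site σ i hp).current_apply 2 le_rfl (by omega)]
  by_cases hm2 : 2 ≤ m
  · have h := isLow_site σ i hp
    obtain ⟨h0, h1⟩ := site_Y_X σ i hp
    simp only [Finset.sum_range_succ, Finset.sum_range_zero, nopTerm]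
    rw [h.Y_apply (by omega), h.Y_apply (by omega)]
    simp only [Nat.cast_zero, Nat.cast_one]
    rw [h0 _ (by omega), h1 _ (by omega)]
    simp
  · obtain rfl : m = 1 := by omega
    rcases hp with rfl | rfl <;> cases σ
    all_goals
      simp only [Finset.sum_range_succ, Finset.sum_range_zero, nopTerm, ncoeff_X, ncoeff_Y, site0,
        site1, letter, sgn]
      norm_num
      rw [← map_zero (ghostFree n)]
      simp only [← map_add, ← map_neg, ← map_sub, ← map_smul]
      refine congrArg _ ?_
      simp
    all_goals
      generalize (MvPolynomial.X (BosonMode.x i 0) : BosonPoly n) = x0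
      generalize (MvPolynomial.X (BosonMode.x i 1) : BosonPoly n) = x1
      generalize (MvPolynomial.X (BosonMode.y i 0) : BosonPoly n) = y0
      generalize (MvPolynomial.X (BosonMode.y i 1) : BosonPoly n) = y1
      algebra

/-! ### The stress tensor at one site -/

/-- The stress tensor of the `i`-th symplectic boson. -/
def siteStress (i : Fin n) : VertexOperator ℂ (Fock n) :=
  (1 / 2 : ℂ) • (nop 1 (X i) (deriv (Y i)) - nop 1 (deriv (X i)) (Y i))

theorem siteStress_apply {i : Fin n} {p : BosonPoly n} (hp : IsLow 2 i p) {m : ℤ} (hm : 1 ≤ m) :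
    ((siteStress i)[[m]]) (ghostFree n p) = (1 / 2 : ℂ) •
      (∑ r ∈ Finset.range 3, nopTerm 1 (X i) (deriv (Y i)) m (ghostFree n p) r -
      ∑ r ∈ Finset.range 3, nopTerm 1 (deriv (X i)) (Y i) m (ghostFree n p) r) := by
  rw [← ncoeff_nop_eq_sum 3, ← ncoeff_nop_eq_sum 3]
  · simp [siteStress]
  · intro r hr
    rw [ncoeff_deriv, LinearMap.smul_apply, hp.X_apply (by omega), smul_zero]
  · exact fun r hr => hp.Y_apply (by omega)
  · exact fun r hr => hp.X_apply (by omega)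
  · intro r hr
    rw [ncoeff_deriv, LinearMap.smul_apply, hp.Y_apply (by omega), smul_zero]

theorem siteStress_ge_three (σ : Bool) (i : Fin n) {p : BosonPoly n}
    (hp : p = site0 σ i ∨ p = site1 σ i) {m : ℤ} (hm : 3 ≤ m) :
    ((siteStress i)[[m]]) (ghostFree n p) = 0 := by
  have h := isLow_site σ i hp
  obtain ⟨h0, h1⟩ := site_Y_X σ i hp
  rw [siteStress_apply h (by omega)]
  simp only [Finset.sum_range_succ, Finset.sum_range_zero, nopTerm, ncoeff_deriv,
    LinearMap.smul_apply]
  have e0 : ((1 : ℕ) : ℤ) - 1 = 0 := by norm_num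
  have e1 : ((2 : ℕ) : ℤ) - 1 = 1 := by norm_num
  rw [e0, e1]
  simp only [Nat.cast_zero, Nat.cast_one, map_smul, Nat.cast_ofNat]
  rw [h.Y_apply (by omega), h.Y_apply (by omega), h.Y_apply (by omega), h.Y_apply (by omega),
    h.Y_apply (by omega), h.Y_apply (by omega), h0 _ (by omega), h0 _ (by omega), h1 _ (by omega),
    h1 _ (by omega), h.X_apply (by omega)]
  simp

theorem siteStress_one (σ : Bool) (i : Fin n) :
    ((siteStress i)[[1]]) (ghostFree n (site0 σ i)) = (1 / 2 : ℂ) • ghostFree n (site0 σ i) ∧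
    ((siteStress i)[[1]]) (ghostFree n (site1 σ i)) = (3 / 2 : ℂ) • ghostFree n (site1 σ i) := by
  classical
  rw [siteStress_apply (isLow_site σ i (.inl rfl)) (by omega),
    siteStress_apply (isLow_site σ i (.inr rfl)) (by omega)]
  constructor <;> cases σ
  all_goals
    simp only [Finset.sum_range_succ, Finset.sum_range_zero, nopTerm, ncoeff_deriv,
      LinearMap.smul_apply, ncoeff_X, ncoeff_Y, site0, site1, letter, sgn]
    norm_num
    simp only [← map_add, ← map_neg, ← map_sub, ← map_smul]
    refine congrArg _ ?_
    simp
  all_goals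
    generalize (MvPolynomial.X (BosonMode.x i 0) : BosonPoly n) = x0
    generalize (MvPolynomial.X (BosonMode.x i 1) : BosonPoly n) = x1
    generalize (MvPolynomial.X (BosonMode.y i 0) : BosonPoly n) = y0
    generalize (MvPolynomial.X (BosonMode.y i 1) : BosonPoly n) = y1
    algebra

/-- The one-site raising operator: up to `2 sgn σ`, mode 2 undoes `D_i`. -/
theorem siteStress_two (σ : Bool) (i : Fin n) :
    ((siteStress i)[[2]]) (ghostFree n (site0 σ i)) = 0 ∧
    ((siteStress i)[[2]]) (ghostFree n (site1 σ i)) = (2 * sgn σ) • ghostFree n (site0 σ i) := by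
  classical
  rw [siteStress_apply (isLow_site σ i (.inl rfl)) (by omega),
    siteStress_apply (isLow_site σ i (.inr rfl)) (by omega)]
  constructor <;> cases σ
  all_goals
    simp only [Finset.sum_range_succ, Finset.sum_range_zero, nopTerm, ncoeff_deriv,
      LinearMap.smul_apply, ncoeff_X, ncoeff_Y, site0, site1, letter, sgn]
    norm_num
    try rw [← map_zero (ghostFree n)]
    simp only [← map_add, ← map_neg, ← map_sub, ← map_smul]
    refine congrArg _ ?_
    simp

/-! ### Translations, the gauge current and the null vector at one site -/

/-- The translation operator on the bosonic Fock space. -/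
def translation (n : ℕ) : Derivation ℂ (BosonPoly n) (BosonPoly n) :=
  MvPolynomial.mkDerivation ℂ fun
    | .x i r => ((r : ℂ) + 1) • MvPolynomial.X (.x i (r + 1))
    | .y i r => ((r : ℂ) + 1) • MvPolynomial.X (.y i (r + 1))
    | .h a r => ((r : ℂ) + 1) • MvPolynomial.X (.h a (r + 1))

@[simp]
theorem translation_X_x (i : Fin n) (r : ℕ) : translation n (MvPolynomial.X (.x i r)) =
    ((r : ℂ) + 1) • MvPolynomial.X (.x i (r + 1)) := MvPolynomial.mkDerivation_X ..

@[simp]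
theorem translation_X_y (i : Fin n) (r : ℕ) : translation n (MvPolynomial.X (.y i r)) =
    ((r : ℂ) + 1) • MvPolynomial.X (.y i (r + 1)) := MvPolynomial.mkDerivation_X ..

theorem ncoeff_gaugeA (i : Fin n) (m : ℤ) (v : Fock n) :
    ((gaugeA i)[[m]]) v = -((nop 1 (X i) (Y i))[[m]]) v := by
  simp [gaugeA]

/-- The state `(𝒜_i)₍₋₁₎ X_i` or `(𝒜_i)₍₋₁₎ Y_i`. -/
def siteA (σ : Bool) (i : Fin n) : BosonPoly n :=
  sgn σ • MvPolynomial.X (letter σ i 1) -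
    MvPolynomial.X (.x i 0) * MvPolynomial.X (.y i 0) * MvPolynomial.X (letter σ i 0)

theorem isLow_siteA (σ : Bool) (i : Fin n) : IsLow 2 i (siteA σ i) := by
  classical
  intro r hr
  cases σ <;>
    simp [siteA, letter, sgn, MvPolynomial.pderiv_X, Derivation.leibniz,
      show ¬ 0 = r by omega, show ¬ 1 = r by omega]

theorem gaugeA_site0 (σ : Bool) (i : Fin n) :
    ((gaugeA i)[[-1]]) (ghostFree n (site0 σ i)) = ghostFree n (siteA σ i) := by
  classical
  rw [ncoeff_gaugeA, (isLow_site0 σ i).current_apply 2 (by omega) (by omega)]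
  cases σ
  all_goals
    simp only [Finset.sum_range_succ, Finset.sum_range_zero, nopTerm, ncoeff_X, ncoeff_Y, site0,
      siteA, letter, sgn]
    norm_num
    simp only [← map_add, ← map_neg, ← map_sub]
    refine congrArg _ ?_
    simp
  all_goals
    generalize (MvPolynomial.X (BosonMode.x i 0) : BosonPoly n) = x0
    generalize (MvPolynomial.X (BosonMode.x i 1) : BosonPoly n) = x1
    generalize (MvPolynomial.X (BosonMode.y i 0) : BosonPoly n) = y0
    generalize (MvPolynomial.X (BosonMode.y i 1) : BosonPoly n) = y1
    algebra

theorem gaugeA_neg_two_site0 (σ : Bool) (i : Fin n) :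
    ((gaugeA i)[[-2]]) (ghostFree n (site0 σ i)) = ghostFree n
      (sgn σ • MvPolynomial.X (letter σ i 2) - (MvPolynomial.X (.x i 0) * MvPolynomial.X (.y i 1) +
        MvPolynomial.X (.x i 1) * MvPolynomial.X (.y i 0)) * MvPolynomial.X (letter σ i 0)) := by
  classical
  rw [ncoeff_gaugeA, (isLow_site0 σ i).current_apply 3 (by omega) (by omega)]
  cases σ
  all_goals
    simp only [Finset.sum_range_succ, Finset.sum_range_zero, nopTerm, ncoeff_X, ncoeff_Y, site0,
      letter, sgn]
    norm_num
    simp only [← map_add, ← map_neg, ← map_sub]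
    refine congrArg _ ?_
    simp
  all_goals
    generalize (MvPolynomial.X (BosonMode.x i 0) : BosonPoly n) = x0
    generalize (MvPolynomial.X (BosonMode.x i 1) : BosonPoly n) = x1
    generalize (MvPolynomial.X (BosonMode.x i 2) : BosonPoly n) = x2
    generalize (MvPolynomial.X (BosonMode.y i 0) : BosonPoly n) = y0
    generalize (MvPolynomial.X (BosonMode.y i 1) : BosonPoly n) = y1
    generalize (MvPolynomial.X (BosonMode.y i 2) : BosonPoly n) = y2
    algebra

theorem gaugeA_siteA (σ : Bool) (i : Fin n) :
    ((gaugeA i)[[-1]]) (ghostFree n (siteA σ i)) = ghostFree n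
      (MvPolynomial.X (letter σ i 2) +
        (MvPolynomial.X (.x i 0) * MvPolynomial.X (.y i 1) -
          MvPolynomial.X (.x i 1) * MvPolynomial.X (.y i 0)) * MvPolynomial.X (letter σ i 0) -
        (2 * sgn σ) • (MvPolynomial.X (.x i 0) * MvPolynomial.X (.y i 0) *
          MvPolynomial.X (letter σ i 1)) +
        (MvPolynomial.X (.x i 0) * MvPolynomial.X (.y i 0)) ^ 2 *
          MvPolynomial.X (letter σ i 0)) := by
  classical
  rw [ncoeff_gaugeA, (isLow_siteA σ i).current_apply 3 (by omega) (by omega)]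
  cases σ
  all_goals
    simp only [Finset.sum_range_succ, Finset.sum_range_zero, nopTerm, ncoeff_X, ncoeff_Y, siteA,
      letter, sgn]
    norm_num
    simp only [← map_add, ← map_neg, ← map_sub, ← map_smul]
    refine congrArg _ ?_
    simp
  all_goals
    generalize (MvPolynomial.X (BosonMode.x i 0) : BosonPoly n) = x0
    generalize (MvPolynomial.X (BosonMode.x i 1) : BosonPoly n) = x1
    generalize (MvPolynomial.X (BosonMode.x i 2) : BosonPoly n) = x2
    generalize (MvPolynomial.X (BosonMode.y i 0) : BosonPoly n) = y0
    generalize (MvPolynomial.X (BosonMode.y i 1) : BosonPoly n) = y1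
    generalize (MvPolynomial.X (BosonMode.y i 2) : BosonPoly n) = y2
    algebra

theorem gaugeA_site1 (σ : Bool) (i : Fin n) :
    ((gaugeA i)[[-1]]) (ghostFree n (site1 σ i)) = ghostFree n
      ((2 : ℂ) • MvPolynomial.X (letter σ i 2) -
        (4 * sgn σ) • (MvPolynomial.X (.x i 0) * MvPolynomial.X (.y i 0) *
          MvPolynomial.X (letter σ i 1)) +
        sgn σ • (MvPolynomial.X (letter σ i 0) ^ 2 * MvPolynomial.X (letter (!σ) i 1)) +
        (MvPolynomial.X (.x i 0) * MvPolynomial.X (.y i 0)) ^ 2 *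
          MvPolynomial.X (letter σ i 0)) := by
  classical
  rw [ncoeff_gaugeA, (isLow_site1 σ i).current_apply 3 (by omega) (by omega)]
  cases σ
  all_goals
    simp only [Finset.sum_range_succ, Finset.sum_range_zero, nopTerm, ncoeff_X, ncoeff_Y, site1,
      letter, sgn, Bool.not_true, Bool.not_false]
    norm_num
    simp only [← map_add, ← map_neg, ← map_sub, ← map_smul]
    refine congrArg _ ?_
    simp
  all_goals
    generalize (MvPolynomial.X (BosonMode.x i 0) : BosonPoly n) = x0
    generalize (MvPolynomial.X (BosonMode.x i 1) : BosonPoly n) = x1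
    generalize (MvPolynomial.X (BosonMode.x i 2) : BosonPoly n) = x2
    generalize (MvPolynomial.X (BosonMode.y i 0) : BosonPoly n) = y0
    generalize (MvPolynomial.X (BosonMode.y i 1) : BosonPoly n) = y1
    generalize (MvPolynomial.X (BosonMode.y i 2) : BosonPoly n) = y2
    algebra

theorem gaugeA_vac (i : Fin n) :
    ((gaugeA i)[[-1]]) vac = ghostFree n (-(MvPolynomial.X (.x i 0) * MvPolynomial.X (.y i 0))) ∧
    ((gaugeA i)[[-2]]) vac = ghostFree n (-(MvPolynomial.X (.x i 0) * MvPolynomial.X (.y i 1) +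
        MvPolynomial.X (.x i 1) * MvPolynomial.X (.y i 0))) := by
  rw [ncoeff_gaugeA, ncoeff_gaugeA,
    nop_neg_one_vacuum (X_mem_vacuumFields i) (Y_mem_vacuumFields i),
    nop_neg_two_vacuum (X_mem_vacuumFields i) (Y_mem_vacuumFields i)]
  simp [ncoeff_X, ncoeff_Y, vac_eq]

theorem stateD_site0 (σ : Bool) (i : Fin n) :
    stateD i (ghostFree n (site0 σ i)) = ghostFree n (site1 σ i) := by
  rw [stateD_apply, gaugeA_site0]
  cases σ
  all_goals
    simp only [ncoeff_X, ncoeff_Y, site0, site1, siteA, letter, sgn]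
    norm_num
    simp only [← map_add, ← map_neg, ← map_sub, ← map_smul]
    refine congrArg _ ?_
  all_goals
    generalize (MvPolynomial.X (BosonMode.x i 0) : BosonPoly n) = x0
    generalize (MvPolynomial.X (BosonMode.x i 1) : BosonPoly n) = x1
    generalize (MvPolynomial.X (BosonMode.y i 0) : BosonPoly n) = y0
    generalize (MvPolynomial.X (BosonMode.y i 1) : BosonPoly n) = y1
    algebra

theorem sgn_mul_self (σ : Bool) : sgn σ * sgn σ = 1 := by
  cases σ <;> simp [sgn]

theorem sgn_ne_zero (σ : Bool) : sgn σ ≠ 0 := by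
  cases σ <;> simp [sgn]

/-- On a single letter `𝒟_i` is `± ∂`, so `D_i` is a derivative corrected by the gauge field `𝒜_i`.
-/
theorem site1_eq (σ : Bool) (i : Fin n) : ghostFree n (site1 σ i) =
    sgn σ • ghostFree n (translation n (site0 σ i)) +
      ((gaugeA i)[[-1]]) (ghostFree n (site0 σ i)) := by
  rw [gaugeA_site0]
  cases σ
  all_goals
    simp only [site0, site1, siteA, letter, sgn]
    simp only [← map_add, ← map_smul]
    refine congrArg _ ?_
    simp
  all_goals
    generalize (MvPolynomial.X (BosonMode.x i 0) : BosonPoly n) = x0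
    generalize (MvPolynomial.X (BosonMode.x i 1) : BosonPoly n) = x1
    generalize (MvPolynomial.X (BosonMode.y i 0) : BosonPoly n) = y0
    generalize (MvPolynomial.X (BosonMode.y i 1) : BosonPoly n) = y1
    algebra

theorem gaugeA_letter_one (σ : Bool) (i : Fin n) :
    ((gaugeA i)[[-1]]) (ghostFree n (MvPolynomial.X (letter σ i 1))) = ghostFree n
      (sgn σ • MvPolynomial.X (letter σ i 2) -
        MvPolynomial.X (.x i 0) * MvPolynomial.X (.y i 0) * MvPolynomial.X (letter σ i 1)) := by
  classical
  have hlow : IsLow 2 i (MvPolynomial.X (letter σ i 1) : BosonPoly n) := by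
    intro r hr
    cases σ <;> simp [letter, MvPolynomial.pderiv_X, show ¬ 1 = r by omega]
  rw [ncoeff_gaugeA, hlow.current_apply 3 (by omega) (by omega)]
  cases σ
  all_goals
    simp only [Finset.sum_range_succ, Finset.sum_range_zero, nopTerm, ncoeff_X, ncoeff_Y,
      letter, sgn]
    norm_num
    simp only [← map_add, ← map_neg, ← map_sub]
    refine congrArg _ ?_
    simp
  all_goals
    generalize (MvPolynomial.X (BosonMode.x i 0) : BosonPoly n) = x0
    generalize (MvPolynomial.X (BosonMode.x i 1) : BosonPoly n) = x1
    generalize (MvPolynomial.X (BosonMode.x i 2) : BosonPoly n) = x2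
    generalize (MvPolynomial.X (BosonMode.y i 0) : BosonPoly n) = y0
    generalize (MvPolynomial.X (BosonMode.y i 1) : BosonPoly n) = y1
    generalize (MvPolynomial.X (BosonMode.y i 2) : BosonPoly n) = y2
    algebra

theorem translation_site0 (σ : Bool) (i : Fin n) :
    translation n (site0 σ i) = MvPolynomial.X (letter σ i 1) := by
  cases σ <;> simp [site0, letter]

/-- The compatibility of `D_i` with translations. -/
theorem translation_site1 (σ : Bool) (i : Fin n) :
    ghostFree n (translation n (site1 σ i)) = stateD i (ghostFree n (translation n (site0 σ i))) +
      (((gaugeA i)[[-2]]) (ghostFree n (site0 σ i)) +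
      (((X i)[[-1]]) (((Y i)[[-2]]) (ghostFree n (site0 σ i))) +
      ((X i)[[-2]]) (((Y i)[[-1]]) (ghostFree n (site0 σ i)))) +
      ((gaugeA i)[[-2]]) (ghostFree n (site0 σ i))) := by
  rw [stateD_apply, translation_site0, gaugeA_letter_one, gaugeA_neg_two_site0]
  cases σ
  all_goals
    simp only [site0, site1, letter, sgn, ncoeff_X, ncoeff_Y]
    norm_num
    simp only [← map_add, ← map_neg, ← map_sub, ← map_smul]
    refine congrArg _ ?_
  all_goals
    generalize (MvPolynomial.X (BosonMode.x i 0) : BosonPoly n) = x0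
    generalize (MvPolynomial.X (BosonMode.x i 1) : BosonPoly n) = x1
    generalize (MvPolynomial.X (BosonMode.x i 2) : BosonPoly n) = x2
    generalize (MvPolynomial.X (BosonMode.y i 0) : BosonPoly n) = y0
    generalize (MvPolynomial.X (BosonMode.y i 1) : BosonPoly n) = y1
    generalize (MvPolynomial.X (BosonMode.y i 2) : BosonPoly n) = y2
    algebra

theorem gaugeA_zero_site0 (σ : Bool) (i : Fin n) :
    ((gaugeA i)[[0]]) (ghostFree n (site0 σ i)) = sgn σ • ghostFree n (site0 σ i) := by
  rw [ncoeff_gaugeA, site_current_zero σ i (.inl rfl)]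
  module

theorem gaugeA_pos_site0 (σ : Bool) (i : Fin n) {m : ℤ} (hm : 1 ≤ m) :
    ((gaugeA i)[[m]]) (ghostFree n (site0 σ i)) = 0 := by
  rw [ncoeff_gaugeA, site_current_pos σ i (.inl rfl) hm, neg_zero]

theorem gaugeA_gaugeA_site0 (σ : Bool) (i : Fin n) :
    ((nop 1 (gaugeA i) (gaugeA i))[[-1]]) (ghostFree n (site0 σ i)) =
      ((gaugeA i)[[-1]]) (ghostFree n (siteA σ i)) +
        (2 * sgn σ) • ((gaugeA i)[[-2]]) (ghostFree n (site0 σ i)) := by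
  rw [ncoeff_nop_eq_sum 2 1 (fun r hr => gaugeA_pos_site0 σ i (by omega))
    fun r hr => gaugeA_pos_site0 σ i (by omega)]
  simp only [Finset.sum_range_succ, Finset.sum_range_zero, nopTerm]
  norm_num
  rw [gaugeA_site0, gaugeA_zero_site0, gaugeA_pos_site0 σ i le_rfl, map_smul, map_zero]
  module

section

variable (σ : Bool) (i : Fin n)

/-- Modes of `(Y_i 𝒜_i)₀` enter because `T_i` contains `(X_i (Y_i 𝒜_i)₀)₀`. The contraction of `Y_i`
with the letter leaves a multiple of the vacuum, which nonnegative modes of `𝒜_i` annihilate. -/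
theorem Y_gaugeA_pos_site0 {m : ℤ} (hm : 1 ≤ m) :
    ((nop 1 (Y i) (gaugeA i))[[m]]) (ghostFree n (site0 σ i)) = 0 := by
  rw [ncoeff_nop_eq_sum 1 1 (fun r hr => (isLow_site0 σ i).Y_apply (by omega))
    fun r hr => gaugeA_pos_site0 σ i (by omega)]
  simp only [Finset.sum_range_succ, Finset.sum_range_zero, nopTerm]
  rw [gaugeA_pos_site0 σ i (by omega)]
  have h : ((gaugeA i)[[m - 1 - ((0 : ℕ) : ℤ)]]) (((Y i)[[((0 : ℕ) : ℤ)]])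
      (ghostFree n (site0 σ i))) = 0 := by
    cases σ
    · simp [ncoeff_Y, site0, letter]
    · have := apply_vacuum (gaugeA_mem_vacuumFields i) (show 0 ≤ m - 1 by omega)
      simpa [ncoeff_Y, site0, letter, vac_eq] using this
  rw [h]
  simp

theorem Y_gaugeA_zero_site0 :
    ((nop 1 (Y i) (gaugeA i))[[0]]) (ghostFree n (site0 σ i)) =
      sgn σ • ((Y i)[[-1]]) (ghostFree n (site0 σ i)) +
      ((gaugeA i)[[-1]]) (((Y i)[[0]]) (ghostFree n (site0 σ i))) := by
  rw [ncoeff_nop_eq_sum 1 1 (fun r hr => (isLow_site0 σ i).Y_apply (by omega))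
    fun r hr => gaugeA_pos_site0 σ i (by omega)]
  simp only [Finset.sum_range_succ, Finset.sum_range_zero, nopTerm]
  norm_num
  rw [gaugeA_zero_site0, map_smul]

theorem Y_gaugeA_neg_one_site0 :
    ((nop 1 (Y i) (gaugeA i))[[-1]]) (ghostFree n (site0 σ i)) =
      ((Y i)[[-1]]) (ghostFree n (siteA σ i)) +
      sgn σ • ((Y i)[[-2]]) (ghostFree n (site0 σ i)) +
      ((gaugeA i)[[-2]]) (((Y i)[[0]]) (ghostFree n (site0 σ i))) := by
  rw [ncoeff_nop_eq_sum 2 1 (fun r hr => (isLow_site0 σ i).Y_apply (by omega))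
    fun r hr => gaugeA_pos_site0 σ i (by omega)]
  simp only [Finset.sum_range_succ, Finset.sum_range_zero, nopTerm]
  norm_num
  rw [gaugeA_site0, gaugeA_zero_site0, (isLow_site0 σ i).Y_apply (m := 1) (by norm_num), map_smul, map_zero]
  module

theorem X_Y_gaugeA_site0 :
    ((nop 1 (X i) (nop 1 (Y i) (gaugeA i)))[[-1]]) (ghostFree n (site0 σ i)) =
      ((X i)[[-1]]) (((nop 1 (Y i) (gaugeA i))[[-1]]) (ghostFree n (site0 σ i))) +
      ((X i)[[-2]]) (((nop 1 (Y i) (gaugeA i))[[0]]) (ghostFree n (site0 σ i))) +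
      ((nop 1 (Y i) (gaugeA i))[[-2]]) (((X i)[[0]]) (ghostFree n (site0 σ i))) := by
  rw [ncoeff_nop_eq_sum 2 1 (fun r hr => (isLow_site0 σ i).X_apply (by omega))
    fun r hr => Y_gaugeA_pos_site0 σ i (by omega)]
  simp only [Finset.sum_range_succ, Finset.sum_range_zero, nopTerm]
  norm_num
  rw [(isLow_site0 σ i).X_apply (m := 1) (by norm_num), map_zero]
  module

/-- The null vector of the coset. -/
theorem opT_site0 :
    (2 * sgn σ) • ((opT i)[[-1]]) (ghostFree n (site0 σ i)) =
      ghostFree n (translation n (site1 σ i)) +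
      sgn σ • ((gaugeA i)[[-1]]) (ghostFree n (site1 σ i)) := by
  classical
  have h : ((opT i)[[-1]]) (ghostFree n (site0 σ i)) =
      ((nop 1 (gaugeA i) (gaugeA i))[[-1]]) (ghostFree n (site0 σ i)) +
      (1 / 2 : ℂ) • ((nop 1 (X i) (nop 1 (Y i) (gaugeA i)))[[-1]]) (ghostFree n (site0 σ i)) := by
    simp only [opT, covD_apply, map_smul, map_add, Pi.smul_apply, Pi.add_apply,
      LinearMap.smul_apply, LinearMap.add_apply]
    module
  have hvac := nop_neg_two_vacuum (Y_mem_vacuumFields i) (gaugeA_mem_vacuumFields i) 1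
  rw [(gaugeA_vac i).1, (gaugeA_vac i).2] at hvac
  have hv1 := (gaugeA_vac i).1
  have hv2 := (gaugeA_vac i).2
  rw [vac_eq] at hvac hv1 hv2
  rw [h, gaugeA_gaugeA_site0, X_Y_gaugeA_site0, Y_gaugeA_neg_one_site0, Y_gaugeA_zero_site0,
    gaugeA_siteA, gaugeA_neg_two_site0, gaugeA_site1]
  -- The factors here and in `hX` record in one formula that `Y_i` contracts only with `X_i` (value
  -- `-1`) and `X_i` only with `Y_i` (value `1`).
  have hY : ((Y i)[[0]]) (ghostFree n (site0 σ i)) =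
      ((-1 - sgn σ) / 2) • ghostFree n 1 := by
    cases σ <;> simp [ncoeff_Y, site0, letter, sgn]
    module
  have hX : ((X i)[[0]]) (ghostFree n (site0 σ i)) =
      ((1 - sgn σ) / 2) • ghostFree n 1 := by
    cases σ <;> simp [ncoeff_X, site0, letter, sgn]
  rw [hX, hY]
  simp only [map_smul]
  rw [hvac, hv1, hv2]
  clear h hvac hv1 hv2 hX hY
  cases σ
  all_goals
    simp only [ncoeff_X, ncoeff_Y, site0, site1, siteA, letter, sgn]
    norm_num
    simp only [← map_add, ← map_neg, ← map_sub, ← map_smul]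
    refine congrArg _ ?_
    simp
  all_goals
    generalize (MvPolynomial.X (BosonMode.x i 0) : BosonPoly n) = x0
    generalize (MvPolynomial.X (BosonMode.x i 1) : BosonPoly n) = x1
    generalize (MvPolynomial.X (BosonMode.x i 2) : BosonPoly n) = x2
    generalize (MvPolynomial.X (BosonMode.y i 0) : BosonPoly n) = y0
    generalize (MvPolynomial.X (BosonMode.y i 1) : BosonPoly n) = y1
    generalize (MvPolynomial.X (BosonMode.y i 2) : BosonPoly n) = y2
    algebra

end

/-! ### States of several sites -/

/-- Polynomials that do not involve the modes of the `i`-th symplectic boson. -/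
def IsFree (i : Fin n) (p : BosonPoly n) : Prop :=
  ∀ r, MvPolynomial.pderiv (.x i r) p = 0 ∧ MvPolynomial.pderiv (.y i r) p = 0

theorem IsFree.commutesWithSite {i : Fin n} {p : BosonPoly n} (hp : IsFree i p) :
    CommutesWithSite i (mulBoson p) :=
  commutesWithSite_mulBoson (fun r => (hp r).1) fun r => (hp r).2

theorem IsFree.mul {i : Fin n} {p q : BosonPoly n} (hp : IsFree i p) (hq : IsFree i q) :
    IsFree i (p * q) := fun r => by
  simp [Derivation.leibniz, (hp r).1, (hp r).2, (hq r).1, (hq r).2]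

theorem IsFree.add {i : Fin n} {p q : BosonPoly n} (hp : IsFree i p) (hq : IsFree i q) :
    IsFree i (p + q) := fun r => by
  simp [(hp r).1, (hp r).2, (hq r).1, (hq r).2]

theorem isFree_prod {ι : Type*} (i : Fin n) (s : Finset ι) (f : ι → BosonPoly n)
    (hf : ∀ j ∈ s, IsFree i (f j) ∧ IsFree i (translation n (f j))) :
    IsFree i (∏ j ∈ s, f j) ∧ IsFree i (translation n (∏ j ∈ s, f j)) := by
  classical
  induction s using Finset.induction_on with
  | empty => exact ⟨fun r => by simp, fun r => by simp⟩
  | insert a s ha ih =>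
    obtain ⟨h1, h2⟩ := ih fun j hj => hf j (Finset.mem_insert_of_mem hj)
    obtain ⟨h3, h4⟩ := hf a (Finset.mem_insert_self _ _)
    rw [Finset.prod_insert ha, Derivation.leibniz, smul_eq_mul, smul_eq_mul]
    exact ⟨h3.mul h1, (h3.mul h2).add (h1.mul h4)⟩

/-- The state of one site: `D_i X_i` (or `D_i Y_i`) if `b` holds, and `X_i` (or `Y_i`) otherwise. -/
def siteState (σ : Bool) (b : Prop) [Decidable b] (i : Fin n) : BosonPoly n :=
  if b then site1 σ i else site0 σ i

theorem siteState_eq (σ : Bool) (b : Prop) [Decidable b] (i : Fin n) :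
    siteState σ b i = site0 σ i ∨ siteState σ b i = site1 σ i := by
  unfold siteState
  split_ifs
  · exact .inr rfl
  · exact .inl rfl

theorem isFree_site (σ : Bool) {i j : Fin n} (h : j ≠ i) {p : BosonPoly n}
    (hp : p = site0 σ j ∨ p = site1 σ j) : IsFree i p ∧ IsFree i (translation n p) := by
  classical
  rcases hp with rfl | rfl <;> cases σ <;> constructor <;> intro r <;>
    simp [site0, site1, letter, sgn, MvPolynomial.pderiv_X, Derivation.leibniz, h]

/-- The state `O_I`, as a polynomial. -/
def levelPoly (σ : Bool) (I : Finset (Fin n)) : BosonPoly n := ∏ i, siteState σ (i ∈ I) i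

/-- The factor of `O_I` away from the site `i`. -/
def levelRest (σ : Bool) (I : Finset (Fin n)) (i : Fin n) : BosonPoly n :=
  ∏ j ∈ Finset.univ.erase i, siteState σ (j ∈ I) j

theorem levelPoly_eq (σ : Bool) (I : Finset (Fin n)) (i : Fin n) :
    levelPoly σ I = levelRest σ I i * siteState σ (i ∈ I) i :=
  (Finset.prod_erase_mul _ _ (Finset.mem_univ i)).symm

theorem levelRest_congr (σ : Bool) {I J : Finset (Fin n)} {i : Fin n}
    (h : ∀ j, j ≠ i → (j ∈ I ↔ j ∈ J)) : levelRest σ I i = levelRest σ J i := by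
  refine Finset.prod_congr rfl fun j hj => ?_
  simp only [siteState, h j (Finset.ne_of_mem_erase hj)]

theorem levelPoly_insert (σ : Bool) (I : Finset (Fin n)) (i : Fin n) :
    levelPoly σ (insert i I) = levelRest σ I i * site1 σ i := by
  rw [levelPoly_eq σ _ i, levelRest_congr σ (J := I) (fun j hj => by simp [hj]), siteState,
    if_pos (Finset.mem_insert_self _ _)]

theorem levelPoly_erase (σ : Bool) (I : Finset (Fin n)) (i : Fin n) :
    levelPoly σ (I.erase i) = levelRest σ I i * site0 σ i := by
  rw [levelPoly_eq σ _ i, levelRest_congr σ (J := I) (fun j hj => by simp [hj]), siteState,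
    if_neg (Finset.notMem_erase _ _)]

theorem levelPoly_of_mem (σ : Bool) {I : Finset (Fin n)} {i : Fin n} (hi : i ∈ I) :
    levelPoly σ I = levelRest σ I i * site1 σ i := by
  rw [levelPoly_eq σ _ i, siteState, if_pos hi]

theorem levelPoly_of_notMem (σ : Bool) {I : Finset (Fin n)} {i : Fin n} (hi : i ∉ I) :
    levelPoly σ I = levelRest σ I i * site0 σ i := by
  rw [levelPoly_eq σ _ i, siteState, if_neg hi]

theorem isFree_levelRest (σ : Bool) (I : Finset (Fin n)) (i : Fin n) :
    IsFree i (levelRest σ I i) ∧ IsFree i (translation n (levelRest σ I i)) :=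
  isFree_prod i _ _ fun j hj => isFree_site σ (Finset.ne_of_mem_erase hj) (siteState_eq σ _ j)

/-- The reduction to one site: a field supported at site `i` passes through the factors from all
other sites. -/
theorem ncoeff_levelPoly {i : Fin n} {A : VertexOperator ℂ (Fock n)}
    (hA : ∀ T, CommutesWithSite i T → A ∈ centralizer T) (σ : Bool) (I : Finset (Fin n)) (m : ℤ) :
    (A[[m]]) (ghostFree n (levelPoly σ I)) =
      mulBoson (levelRest σ I i) ((A[[m]]) (ghostFree n (siteState σ (i ∈ I) i))) := by
  rw [hA _ (isFree_levelRest σ I i).1.commutesWithSite, mulBoson_ghostFree, ← levelPoly_eq]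

theorem stateD_levelPoly (σ : Bool) {I : Finset (Fin n)} {i : Fin n} (hi : i ∉ I) :
    stateD i (ghostFree n (levelPoly σ I)) = ghostFree n (levelPoly σ (insert i I)) := by
  rw [levelPoly_of_notMem σ hi, ← mulBoson_ghostFree,
    ← (isFree_levelRest σ I i).1.commutesWithSite.stateD_apply, stateD_site0, mulBoson_ghostFree,
    levelPoly_insert]

/-! ### The operators `𝒳` and `𝒴` -/

/-- The field `X_i` (`true`) or `Y_i` (`false`). -/
def letterField : Bool → Fin n → VertexOperator ℂ (Fock n)
  | true => X
  | false => Y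

/-- The operator `𝒳` (`true`) or `𝒴` (`false`). -/
def opO (n : ℕ) : Bool → VertexOperator ℂ (Fock n)
  | true => opX n
  | false => opY n

theorem opO_eq (σ : Bool) :
    opO n σ = ((List.finRange n).map (letterField σ)).foldr (nop 1) idField := by
  rw [← List.ofFn_eq_map]
  cases σ <;> rfl

theorem letterField_vacuum (σ : Bool) (i : Fin n) :
    letterField σ i ∈ vacuumFields (vac : Fock n) := by
  cases σ
  · exact Y_mem_vacuumFields i
  · exact X_mem_vacuumFields i

theorem letterField_neg (σ : Bool) (i : Fin n) (p : BosonPoly n) :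
    ((letterField σ i)[[-1]]) (ghostFree n p) =
      ghostFree n (MvPolynomial.X (letter σ i 0) * p) ∧
    ((letterField σ i)[[-2]]) (ghostFree n p) =
      ghostFree n (MvPolynomial.X (letter σ i 1) * p) := by
  cases σ <;> simp [letterField, letter, ncoeff_X, ncoeff_Y]

/-- The mode `-2` on the vacuum is the state of the derivative. It is carried along because for a
product it requires both modes of each factor. -/
theorem foldr_letterField (σ : Bool) (l : List (Fin n)) :
    (l.map (letterField σ)).foldr (nop 1) idField ∈ vacuumFields (vac : Fock n) ∧
    (((l.map (letterField σ)).foldr (nop 1) idField)[[-1]]) vac =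
      ghostFree n (l.map (site0 σ)).prod ∧
    (((l.map (letterField σ)).foldr (nop 1) idField)[[-2]]) vac =
      ghostFree n (translation n (l.map (site0 σ)).prod) := by
  induction l with
  | nil =>
    refine ⟨idField_mem_vacuumFields, ?_, ?_⟩ <;>
      simp [ncoeff_idField, vac_eq]
  | cons i l ih =>
    obtain ⟨h1, h2, h3⟩ := ih
    simp only [List.map_cons, List.foldr_cons, List.prod_cons]
    refine ⟨nop_mem_vacuumFields (letterField_vacuum σ i) h1 1, ?_, ?_⟩
    · rw [nop_neg_one_vacuum (letterField_vacuum σ i) h1, h2, (letterField_neg σ i _).1, site0]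
    · rw [nop_neg_two_vacuum (letterField_vacuum σ i) h1, h2, h3, (letterField_neg σ i _).1,
        (letterField_neg σ i _).2, Derivation.leibniz, translation_site0, smul_eq_mul, smul_eq_mul,
        map_add, site0, mul_comm (MvPolynomial.X (letter σ i 1))]

theorem opO_mem_vacuumFields (σ : Bool) : opO n σ ∈ vacuumFields (vac : Fock n) := by
  rw [opO_eq]
  exact (foldr_letterField σ _).1

theorem prod_site0 (σ : Bool) : ((List.finRange n).map (site0 σ)).prod = levelPoly σ ∅ := by
  rw [← List.ofFn_eq_map, List.prod_ofFn, levelPoly]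
  simp [siteState]

theorem state_opO (σ : Bool) : state (opO n σ) = ghostFree n (levelPoly σ ∅) := by
  rw [opO_eq, state_apply, (foldr_letterField σ _).2.1, prod_site0]

theorem levelMap_sqfree (σ : Bool) (I : Finset (Fin n)) :
    levelMap (opO n σ) (sqfree I) = ghostFree n (levelPoly σ I) := by
  induction I using Finset.induction_on with
  | empty => simp [levelMap_apply, sqfree, state_opO]
  | insert a I ha ih =>
    rw [levelMap_apply] at ih ⊢
    have h : sqfree (insert a I) = MvPolynomial.X a * sqfree I := Finset.prod_insert ha
    rw [h, map_mul, Module.End.mul_apply, ih, polyD_X, stateD_levelPoly σ ha]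

theorem state_covSet (σ : Bool) (I : Finset (Fin n)) :
    state (covSet I (opO n σ)) = ghostFree n (levelPoly σ I) := by
  rw [← levelMap_sqfree, ((actsAs_covSet I) _ (opO_mem_vacuumFields σ)).2, levelMap_apply]

theorem covD_neg_two (i : Fin n) {A : VertexOperator ℂ (Fock n)}
    (hA : A ∈ vacuumFields (vac : Fock n)) : ((covD i A)[[-2]]) vac =
      stateD i ((A[[-2]]) vac) + (((gaugeA i)[[-2]]) ((A[[-1]]) vac) +
      (((X i)[[-1]]) (((Y i)[[-2]]) ((A[[-1]]) vac)) +
      ((X i)[[-2]]) (((Y i)[[-1]]) ((A[[-1]]) vac))) +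
      ((gaugeA i)[[-2]]) ((A[[-1]]) vac)) := by
  have hY := nop_mem_vacuumFields (Y_mem_vacuumFields i) hA 1
  rw [covD_apply, stateD_apply]
  simp only [map_add, Pi.add_apply, LinearMap.add_apply]
  rw [nop_neg_two_vacuum (gaugeA_mem_vacuumFields i) hA,
    nop_neg_two_vacuum (X_mem_vacuumFields i) hY, nop_neg_one_vacuum (Y_mem_vacuumFields i) hA,
    nop_neg_two_vacuum (Y_mem_vacuumFields i) hA, map_add]
  abel

/-- By the Leibniz rule the claim for the mode `-2` splits into the derivative at site `i`, which is
`translation_site1`, and that of the other factors, with which `D_i` commutes. -/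
theorem covSet_list (σ : Bool) (l : List (Fin n)) (hl : l.Nodup) :
    (l.map covD).prod (opO n σ) ∈ vacuumFields (vac : Fock n) ∧
    (((l.map covD).prod (opO n σ))[[-1]]) vac = ghostFree n (levelPoly σ l.toFinset) ∧
    (((l.map covD).prod (opO n σ))[[-2]]) vac =
      ghostFree n (translation n (levelPoly σ l.toFinset)) := by
  induction l with
  | nil =>
    refine ⟨opO_mem_vacuumFields σ, state_opO σ, ?_⟩
    simp only [List.map_nil, List.prod_nil, Module.End.one_apply, List.toFinset_nil]
    rw [opO_eq, (foldr_letterField σ _).2.2, prod_site0]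
  | cons i l ih =>
    obtain ⟨hi, hl⟩ := List.nodup_cons.1 hl
    obtain ⟨h1, h2, h3⟩ := ih hl
    have hi' : i ∉ l.toFinset := by simpa using hi
    simp only [List.map_cons, List.prod_cons, Module.End.mul_apply, List.toFinset_cons]
    refine ⟨covD_mem_vacuumFields i h1, ?_, ?_⟩
    · have := state_covD i h1
      rw [state_apply, state_apply, h2, stateD_levelPoly σ hi'] at this
      exact this
    · obtain ⟨hf1, hf2⟩ := isFree_levelRest σ l.toFinset i
      have hc1 := hf1.commutesWithSite
      have hc2 := hf2.commutesWithSite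
      rw [covD_neg_two i h1, h2, h3, levelPoly_insert, levelPoly_of_notMem σ hi',
        Derivation.leibniz, Derivation.leibniz]
      simp only [smul_eq_mul, map_add]
      rw [mul_comm (site0 σ i), mul_comm (site1 σ i)]
      simp only [← mulBoson_ghostFree]
      rw [← hc2.stateD_apply, ← hc1.stateD_apply, stateD_site0, translation_site1,
        ← hc1.gaugeA_mem _ _, ← hc1.Y_mem _ _, ← hc1.Y_mem _ _, ← hc1.X_mem _ _, ← hc1.X_mem _ _]
      simp only [map_add]
      abel

theorem state_deriv_covSet (σ : Bool) (I : Finset (Fin n)) :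
    state (deriv (covSet I (opO n σ))) = ghostFree n (translation n (levelPoly σ I)) := by
  have h := (covSet_list σ I.toList I.nodup_toList).2.2
  rw [Finset.toList_toFinset] at h
  rw [state_apply, ncoeff_deriv, covSet, ← h]
  simp

/-! ### Action of the stress tensor and of the BRST charge -/

theorem ncoeff_sum {ι : Type*} (s : Finset ι) (F : ι → VertexOperator ℂ (Fock n)) (m : ℤ)
    (v : Fock n) : ((∑ i ∈ s, F i)[[m]]) v = ∑ i ∈ s, ((F i)[[m]]) v := by
  simp [map_sum, Finset.sum_apply]

theorem pderiv_h_levelPoly (σ : Bool) (I : Finset (Fin n)) (a : Fin (n - 1)) (r : ℕ) :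
    MvPolynomial.pderiv (.h a r) (levelPoly σ I) = 0 := by
  classical
  have h : ∀ j ∈ Finset.univ, MvPolynomial.pderiv (.h a r) (siteState σ (j ∈ I) j) = 0 := by
    intro j _
    rcases siteState_eq σ (j ∈ I) j with h | h <;> rw [h] <;> cases σ <;>
      simp [site0, site1, letter, sgn, MvPolynomial.pderiv_X, Derivation.leibniz]
  rw [levelPoly]
  generalize (Finset.univ : Finset (Fin n)) = s at h ⊢
  induction s using Finset.induction_on with
  | empty => simp
  | insert a s ha ih =>
    rw [Finset.prod_insert ha, Derivation.leibniz, h a (Finset.mem_insert_self _ _),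
      ih fun j hj => h j (Finset.mem_insert_of_mem hj)]
    simp

theorem H_levelPoly (σ : Bool) (I : Finset (Fin n)) (a : Fin (n - 1)) {m : ℤ} (hm : 0 ≤ m) :
    ((H a)[[m]]) (ghostFree n (levelPoly σ I)) = 0 := by
  obtain ⟨r, rfl⟩ := Int.eq_ofNat_of_zero_le hm
  rw [ncoeff_H, if_pos hm]
  cases r with
  | zero => rfl
  | succ r => simp [hAnn, pderiv_h_levelPoly]

theorem C_ghostFree (a : Fin (n - 1)) (p : BosonPoly n) {m : ℤ} (hm : 0 ≤ m) :
    ((C a)[[m]]) (ghostFree n p) = 0 := by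
  obtain ⟨r, rfl⟩ := Int.eq_ofNat_of_zero_le hm
  rw [C, ncoeff_freeField_natCast, ghostAnn_ghostFree]

theorem B_ghostFree (a : Fin (n - 1)) (p : BosonPoly n) {m : ℤ} (hm : 0 ≤ m) :
    ((B a)[[m]]) (ghostFree n p) = 0 := by
  obtain ⟨r, rfl⟩ := Int.eq_ofNat_of_zero_le hm
  rw [B, ncoeff_freeField_natCast, ghostAnn_ghostFree]

/-- The states `O_I` contain neither Heisenberg modes nor ghosts, so the other two parts of `T` have
nothing to contract with. -/
theorem stress_levelPoly (σ : Bool) (I : Finset (Fin n)) {m : ℤ} (hm : 1 ≤ m) :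
    ((stress n)[[m]]) (ghostFree n (levelPoly σ I)) =
      ∑ i, ((siteStress i)[[m]]) (ghostFree n (levelPoly σ I)) := by
  have hH : ∀ a b : Fin (n - 1),
      ((nop 1 (H a) (H b))[[m]]) (ghostFree n (levelPoly σ I)) = 0 := by
    intro a b
    rw [ncoeff_nop_eq_sum 0 1 (fun r _ => H_levelPoly σ I a (by omega))
      fun r _ => H_levelPoly σ I b (by omega)]
    rfl
  have hBC : ∀ a : Fin (n - 1),
      ((nop (-1) (B a) (deriv (C a)))[[m]]) (ghostFree n (levelPoly σ I)) = 0 := by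
    intro a
    rw [ncoeff_nop_eq_sum 0 (-1) (fun r _ => B_ghostFree a _ (by omega)) fun r _ => ?_]
    · rfl
    · rw [ncoeff_deriv, LinearMap.smul_apply, C_ghostFree a _ (by omega), smul_zero]
  simp only [stress, siteStress, map_add, map_sub, map_smul, map_sum, Pi.add_apply, Pi.sub_apply,
    Pi.smul_apply, Finset.sum_apply, LinearMap.add_apply, LinearMap.sub_apply,
    LinearMap.smul_apply, LinearMap.sum_apply, hH, hBC, smul_zero, Finset.sum_const_zero, add_zero,
    sub_zero, Finset.smul_sum]

theorem CommutesWithSite.siteStress_mem {i : Fin n} {T : Module.End ℂ (Fock n)}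
    (hT : CommutesWithSite i T) : siteStress i ∈ centralizer T :=
  Submodule.smul_mem _ _ (sub_mem
    (nop_mem_centralizer hT.X_mem (deriv_mem_centralizer hT.Y_mem) 1)
    (nop_mem_centralizer (deriv_mem_centralizer hT.X_mem) hT.Y_mem 1))

theorem stress_ge_three (σ : Bool) (I : Finset (Fin n)) {m : ℤ} (hm : 3 ≤ m) :
    ((stress n)[[m]]) (ghostFree n (levelPoly σ I)) = 0 := by
  rw [stress_levelPoly σ I (by omega)]
  refine Finset.sum_eq_zero fun i _ => ?_
  rw [ncoeff_levelPoly (i := i) (fun T hT => hT.siteStress_mem),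
    siteStress_ge_three σ i (siteState_eq σ _ i) hm, map_zero]

theorem stress_one (σ : Bool) (I : Finset (Fin n)) :
    ((stress n)[[1]]) (ghostFree n (levelPoly σ I)) =
      ((n : ℂ) / 2 + I.card) • ghostFree n (levelPoly σ I) := by
  rw [stress_levelPoly σ I le_rfl]
  have h : ∀ i, ((siteStress i)[[1]]) (ghostFree n (levelPoly σ I)) =
      ((1 / 2 : ℂ) + if i ∈ I then 1 else 0) • ghostFree n (levelPoly σ I) := by
    intro i
    have : ((siteStress i)[[1]]) (ghostFree n (siteState σ (i ∈ I) i)) =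
        ((1 / 2 : ℂ) + if i ∈ I then 1 else 0) • ghostFree n (siteState σ (i ∈ I) i) := by
      unfold siteState
      split_ifs
      · rw [(siteStress_one σ i).2]
        norm_num
      · rw [(siteStress_one σ i).1, add_zero]
    rw [ncoeff_levelPoly (i := i) (fun T hT => hT.siteStress_mem), this, map_smul,
      mulBoson_ghostFree, ← levelPoly_eq]
  rw [Finset.sum_congr rfl fun i _ => h i, ← Finset.sum_smul]
  congr 1
  rw [Finset.sum_add_distrib, Finset.sum_boole]
  simp
  ring

theorem stress_two (σ : Bool) (I : Finset (Fin n)) :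
    ((stress n)[[2]]) (ghostFree n (levelPoly σ I)) =
      (2 * sgn σ) • ∑ i ∈ I, ghostFree n (levelPoly σ (I.erase i)) := by
  rw [stress_levelPoly σ I (by omega), ← Finset.sum_add_sum_compl I, Finset.smul_sum]
  have h : ∑ i ∈ Iᶜ, ((siteStress i)[[2]]) (ghostFree n (levelPoly σ I)) = 0 := by
    refine Finset.sum_eq_zero fun i hi => ?_
    rw [ncoeff_levelPoly (i := i) (fun T hT => hT.siteStress_mem), siteState,
      if_neg (Finset.mem_compl.1 hi), (siteStress_two σ i).1, map_zero]
  rw [h, add_zero]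
  refine Finset.sum_congr rfl fun i hi => ?_
  rw [ncoeff_levelPoly (i := i) (fun T hT => hT.siteStress_mem), siteState, if_pos hi,
    (siteStress_two σ i).2, map_smul, mulBoson_ghostFree, levelPoly_erase]

theorem current_levelPoly (σ : Bool) (I : Finset (Fin n)) (i : Fin n) {m : ℤ} (hm : 0 ≤ m) :
    ((nop 1 (X i) (Y i))[[m]]) (ghostFree n (levelPoly σ I)) =
      (if m = 0 then -sgn σ else 0) • ghostFree n (levelPoly σ I) := by
  rw [ncoeff_levelPoly (i := i) (fun T hT => nop_mem_centralizer hT.X_mem hT.Y_mem 1)]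
  split_ifs with h
  · rw [h, site_current_zero σ i (siteState_eq σ _ i), map_smul, mulBoson_ghostFree,
      ← levelPoly_eq]
  · rw [site_current_pos σ i (siteState_eq σ _ i) (by omega), map_zero, zero_smul]

/-- Nonnegative modes of `c^a` annihilate ghost-free states, and the nonnegative modes of the
current vanish since the charges at sites `a` and `a + 1` agree. -/
theorem brstCharge_levelPoly (σ : Bool) (I : Finset (Fin n)) :
    brstCharge n (ghostFree n (levelPoly σ I)) = 0 := by
  rw [brstCharge, brstCurrent, ncoeff_sum]
  refine Finset.sum_eq_zero fun a _ => ?_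
  rw [ncoeff_nop_eq_sum 0 1 (fun r _ => C_ghostFree a _ (by omega)) fun r _ => ?_]
  · rfl
  · simp only [matterCurrent, map_add, map_sub, Pi.add_apply, Pi.sub_apply, LinearMap.add_apply,
      LinearMap.sub_apply]
    rw [H_levelPoly σ I a (by omega), current_levelPoly σ I _ (by omega),
      current_levelPoly σ I _ (by omega), sub_self, add_zero]

/-! ### Composite operators -/

theorem translation_levelPoly (σ : Bool) (I : Finset (Fin n)) :
    ghostFree n (translation n (levelPoly σ I)) = ∑ i, mulBoson (levelRest σ I i)
      (ghostFree n (translation n (siteState σ (i ∈ I) i))) := by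
  have h : ∀ (s : Finset (Fin n)) (f : Fin n → BosonPoly n), translation n (∏ i ∈ s, f i) =
      ∑ i ∈ s, (∏ j ∈ s.erase i, f j) * translation n (f i) := by
    intro s f
    induction s using Finset.induction_on with
    | empty => simp
    | insert a s ha ih =>
      rw [Finset.prod_insert ha, Derivation.leibniz, ih, Finset.sum_insert ha,
        Finset.erase_insert ha, smul_eq_mul, smul_eq_mul, Finset.mul_sum, add_comm]
      congr 1
      refine Finset.sum_congr rfl fun i hi => ?_
      rw [Finset.erase_insert_of_ne (by rintro rfl; exact ha hi), Finset.prod_insert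
        fun h => ha (Finset.mem_of_mem_erase h), mul_assoc]
  simp only [mulBoson_ghostFree]
  rw [levelPoly, h, map_sum]
  rfl

/-- The lowering relation. -/
theorem sum_levelPoly_insert (σ : Bool) (I : Finset (Fin n)) :
    sgn σ • ∑ i ∈ Iᶜ, ghostFree n (levelPoly σ (insert i I)) =
      ghostFree n (translation n (levelPoly σ I)) +
      sgn σ • ∑ i, ((gaugeA i)[[-1]]) (ghostFree n (levelPoly σ I)) -
      (2 * sgn σ) • ∑ i ∈ I, ((opT i)[[-1]]) (ghostFree n (levelPoly σ (I.erase i))) := by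
  -- At `i ∈ I` the null vector turns the `i`-th part of `∂O_I ± 𝒜_i O_I` into `T_i O_{I \ i}`; at
  -- `i ∉ I` (`hI`) the same part is `± O_{I ∪ i}`. Summing over all sites leaves the total
  -- derivative.
  have hT : ∀ i ∈ I, (2 * sgn σ) • ((opT i)[[-1]]) (ghostFree n (levelPoly σ (I.erase i))) =
      mulBoson (levelRest σ I i) (ghostFree n (translation n (siteState σ (i ∈ I) i))) +
      sgn σ • ((gaugeA i)[[-1]]) (ghostFree n (levelPoly σ I)) := by
    intro i hi
    have hc := (isFree_levelRest σ I i).1.commutesWithSite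
    rw [levelPoly_erase, levelPoly_of_mem σ hi, siteState, if_pos hi, ← mulBoson_ghostFree,
      ← mulBoson_ghostFree, ← hc.opT_mem _ _, ← hc.gaugeA_mem _ _, ← map_smul, opT_site0, map_add,
      map_smul]
  have hI : ∀ i ∈ Iᶜ, sgn σ • ghostFree n (levelPoly σ (insert i I)) =
      mulBoson (levelRest σ I i) (ghostFree n (translation n (siteState σ (i ∈ I) i))) +
      sgn σ • ((gaugeA i)[[-1]]) (ghostFree n (levelPoly σ I)) := by
    intro i hi
    have hi := Finset.mem_compl.1 hi
    have hc := (isFree_levelRest σ I i).1.commutesWithSite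
    rw [levelPoly_insert, levelPoly_of_notMem σ hi, siteState, if_neg hi, ← mulBoson_ghostFree,
      ← mulBoson_ghostFree, ← hc.gaugeA_mem _ _, site1_eq, map_add, map_smul, smul_add, smul_smul,
      sgn_mul_self, one_smul]
  rw [Finset.smul_sum, Finset.smul_sum, Finset.smul_sum, Finset.sum_congr rfl hI,
    Finset.sum_congr rfl hT, translation_levelPoly, ← Finset.sum_add_distrib,
    ← Finset.sum_add_sum_compl I (fun i => mulBoson (levelRest σ I i)
      (ghostFree n (translation n (siteState σ (i ∈ I) i))) +
      sgn σ • ((gaugeA i)[[-1]]) (ghostFree n (levelPoly σ I))), add_sub_cancel_left]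

/-! ### Functionals that vanish on exact states -/

/-- The projection to the states without ghosts. -/
def ghostProj (n : ℕ) : Fock n →ₗ[ℂ] BosonPoly n :=
  (TensorProduct.rid ℂ (BosonPoly n)).toLinearMap ∘ₗ
    LinearMap.lTensor (BosonPoly n) (ExteriorAlgebra.algebraMapInv
      (R := ℂ) (M := GhostMode n →₀ ℂ)).toLinearMap

theorem ghostProj_tmul (p : BosonPoly n) (w : ExteriorAlgebra ℂ (GhostMode n →₀ ℂ)) :
    ghostProj n (p ⊗ₜ w) = ExteriorAlgebra.algebraMapInv w • p := by
  simp [ghostProj]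

@[simp]
theorem ghostProj_ghostFree (p : BosonPoly n) : ghostProj n (ghostFree n p) = p := by
  simp [ghostFree_apply, ghostProj_tmul]

theorem ghostProj_bosonCre (m : BosonMode n) (v : Fock n) :
    ghostProj n (bosonCre m v) = MvPolynomial.X m * ghostProj n v := by
  induction v using TensorProduct.induction_on with
  | zero => simp
  | tmul p w => simp [bosonCre, ghostProj_tmul]
  | add u v hu hv => simp only [map_add, hu, hv, mul_add]

theorem ghostProj_bosonAnn (m : BosonMode n) (v : Fock n) :
    ghostProj n (bosonAnn m v) = MvPolynomial.pderiv m (ghostProj n v) := by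
  induction v using TensorProduct.induction_on with
  | zero => simp
  | tmul p w => simp [bosonAnn, ghostProj_tmul]
  | add u v hu hv => simp only [map_add, hu, hv]

theorem ghostProj_ghostCre (g : GhostMode n) (v : Fock n) :
    ghostProj n (ghostCre g v) = 0 := by
  induction v using TensorProduct.induction_on with
  | zero => simp
  | tmul p w => simp [ghostCre, ghostProj_tmul, ExteriorAlgebra.algebraMapInv]
  | add u v hu hv => simp only [map_add, hu, hv, add_zero]

/-! ### The specialization of the modes -/

/-- The target of the specialization: polynomials in `t_i` (`Sum.inl i`) and `e_i`
(`Sum.inr i`). -/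
abbrev SpecPoly (n : ℕ) : Type := MvPolynomial (Fin n ⊕ Fin n) ℂ

/-- The value of the `r`-th mode of the charged letter at the site `i`. -/
def letterValue (i : Fin n) : ℕ → SpecPoly n
  | 0 => MvPolynomial.X (.inl i)
  | 1 => MvPolynomial.X (.inl i) * MvPolynomial.X (.inr i)
  | _ + 2 => 0

/-- The values of the modes under the specialization. -/
def specValue (σ : Bool) : BosonMode n → SpecPoly n
  | .x i r => bif σ then letterValue i r else 0
  | .y i r => bif σ then 0 else letterValue i r
  | .h a r => if r = 0 then sgn σ • (MvPolynomial.X (.inr ⟨a, by omega⟩) -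
      MvPolynomial.X (.inr ⟨a + 1, by omega⟩)) else 0

/-- The specialization of the modes: only the modes of index `0` and `1` of `X_i` (`true`) or
`Y_i` (`false`) survive, and `h_a` becomes the difference of the shifts at the sites `a` and
`a + 1`. -/
def spec (σ : Bool) : BosonPoly n →ₐ[ℂ] SpecPoly n := MvPolynomial.aeval (specValue σ)

@[simp]
theorem spec_X (σ : Bool) (m : BosonMode n) : spec σ (MvPolynomial.X m) = specValue σ m := by
  simp [spec]

/-- Chain rule: `t_i` occurs only in the values `t_i` and `t_i e_i` of the modes of index `0` and
`1` of the charged letter. -/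
theorem pderiv_spec (σ : Bool) (i : Fin n) (p : BosonPoly n) :
    MvPolynomial.pderiv (.inl i) (spec σ p) = spec σ (MvPolynomial.pderiv (letter σ i 0) p) +
      MvPolynomial.X (.inr i) * spec σ (MvPolynomial.pderiv (letter σ i 1) p) := by
  classical
  induction p using MvPolynomial.induction_on with
  | C a => simp [MvPolynomial.algebraMap_eq, spec]
  | add p q hp hq =>
    simp only [map_add, hp, hq]
    ring
  | mul_X p m hp =>
    have hX : MvPolynomial.pderiv (.inl i) (specValue σ m) =
        spec σ (MvPolynomial.pderiv (letter σ i 0) (MvPolynomial.X m)) +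
        MvPolynomial.X (.inr i) *
          spec σ (MvPolynomial.pderiv (letter σ i 1) (MvPolynomial.X m)) := by
      rcases m with ⟨j, r⟩ | ⟨j, r⟩ | ⟨a, r⟩ <;> cases σ
      · simp [specValue, letter, MvPolynomial.pderiv_X]
      · rcases eq_or_ne j i with rfl | hj <;> rcases r with _ | _ | r
        all_goals simp [specValue, letter, letterValue, MvPolynomial.pderiv_X, Pi.single_apply,
          Derivation.leibniz]
        all_goals simp [hj]
      · rcases eq_or_ne j i with rfl | hj <;> rcases r with _ | _ | r
        all_goals simp [specValue, letter, letterValue, MvPolynomial.pderiv_X, Pi.single_apply,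
          Derivation.leibniz]
        all_goals simp [hj]
      · simp [specValue, letter, MvPolynomial.pderiv_X]
      · by_cases hr : r = 0 <;>
          simp [specValue, letter, MvPolynomial.pderiv_X, hr]
      · by_cases hr : r = 0 <;>
          simp [specValue, letter, MvPolynomial.pderiv_X, hr]
    simp only [map_mul, map_add, Derivation.leibniz, smul_eq_mul, spec_X, hp, hX]
    ring

/-- The specialization of the ghost-free part of a state. -/
def specState (σ : Bool) : Fock n →ₗ[ℂ] SpecPoly n := (spec σ).toLinearMap ∘ₗ ghostProj n

theorem specState_apply (σ : Bool) (v : Fock n) : specState σ v = spec σ (ghostProj n v) := rfl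

theorem specState_bosonCre (σ : Bool) (m : BosonMode n) (v : Fock n) :
    specState σ (bosonCre m v) = specValue σ m * specState σ v := by
  simp [specState_apply, ghostProj_bosonCre]

theorem specState_bosonAnn (σ : Bool) (m : BosonMode n) (v : Fock n) :
    specState σ (bosonAnn m v) = spec σ (MvPolynomial.pderiv m (ghostProj n v)) := by
  rw [specState_apply, ghostProj_bosonAnn]

/-- Since one of the letters specializes to zero, only terms that contract the charged letter and
recreate it with index raised by at least `r + 1` survive. Letters of index at least `2` vanish,
which leaves the shift from `0` to `1` when `r = 0`. -/
theorem specState_current (σ : Bool) (i : Fin n) (r : ℕ) (v : Fock n) :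
    specState σ (((nop 1 (X i) (Y i))[[-1 - (r : ℤ)]]) v) = if r = 0 then
      (-sgn σ) • (MvPolynomial.X (.inl i) * MvPolynomial.X (.inr i) *
        spec σ (MvPolynomial.pderiv (letter σ i 0) (ghostProj n v))) else 0 := by
  rw [map_ncoeff_nop]
  cases σ
  · have h : ∀ s : ℕ, specState false (nopTerm 1 (X i) (Y i) (-1 - (r : ℤ)) v s) =
        letterValue i (1 + r + s) *
          spec false (MvPolynomial.pderiv (.y i s) (ghostProj n v)) := by
      intro s
      rw [nopTerm, ncoeff_X, ncoeff_X, if_neg (by omega), if_pos (by omega), ncoeff_Y i (_ - _ - _),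
        if_neg (by omega), map_add, specState_bosonCre, map_smul, specState_bosonCre,
        specState_bosonAnn]
      have e : (-1 - (-1 - (r : ℤ) - 1 - s)).toNat = 1 + r + s := by omega
      simp [specValue, e]
    simp only [h]
    split_ifs with hr
    · subst hr
      rw [finsum_eq_single _ 0]
      · simp [letterValue, letter, sgn]
      · intro s hs
        obtain ⟨s, rfl⟩ := Nat.exists_eq_succ_of_ne_zero hs
        rw [show 1 + 0 + s.succ = s + 2 by omega, letterValue, zero_mul]
    · refine (finsum_congr fun s => ?_).trans finsum_zero
      obtain ⟨k, hk⟩ : ∃ k, 1 + r + s = k + 2 := ⟨r + s - 1, by omega⟩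
      rw [hk, letterValue, zero_mul]
  · have h : ∀ s : ℕ, specState true (nopTerm 1 (X i) (Y i) (-1 - (r : ℤ)) v s) =
        if s ≤ r then 0 else -(letterValue i s *
          spec true (MvPolynomial.pderiv (.x i (s - 1 - r)) (ghostProj n v))) := by
      intro s
      rw [nopTerm, ncoeff_X, if_neg (by omega), ncoeff_Y i (_ - _ - _),
        if_neg (by omega), map_add, specState_bosonCre, map_smul, specState_bosonCre]
      have e : (-1 - (-1 - (s : ℤ))).toNat = s := by omega
      rw [e]
      split_ifs with hs
      · rw [ncoeff_Y, if_neg (by omega), specState_bosonCre]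
        simp [specValue]
      · have e : (-1 - (r : ℤ) + s).toNat = s - 1 - r := by omega
        rw [ncoeff_Y, if_pos (by omega), LinearMap.neg_apply, map_neg, specState_bosonAnn, e]
        simp [specValue]
    simp only [h]
    split_ifs with hr
    · subst hr
      rw [finsum_eq_single _ 1]
      · simp [letterValue, letter, sgn]
      · intro s hs
        rcases s with _ | _ | s
        · simp
        · exact absurd rfl hs
        · simp [letterValue]
    · refine (finsum_congr fun s => ?_).trans finsum_zero
      split_ifs with hs
      · rfl
      · obtain ⟨k, rfl⟩ : ∃ k, s = k + 2 := ⟨s - 2, by omega⟩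
        rw [letterValue, zero_mul, neg_zero]

theorem X_mul_pderiv_coeff {τ : Type*} [DecidableEq τ] (i : τ) (m : τ →₀ ℕ)
    (p : MvPolynomial τ ℂ) : MvPolynomial.coeff m (MvPolynomial.X i * MvPolynomial.pderiv i p) =
      m i * MvPolynomial.coeff m p := by
  induction p using MvPolynomial.induction_on' with
  | monomial s a =>
    have h : MvPolynomial.X i * MvPolynomial.pderiv i (MvPolynomial.monomial s a) =
        (s i : ℂ) • MvPolynomial.monomial s a := by
      rw [MvPolynomial.pderiv_monomial, MvPolynomial.X, MvPolynomial.monomial_mul,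
        MvPolynomial.smul_monomial]
      by_cases hs : s i = 0
      · simp [hs]
      · rw [add_comm, tsub_add_cancel_of_le (by
          rw [Finsupp.single_le_iff]
          omega)]
        congr 1
        rw [one_mul, smul_eq_mul, mul_comm]
    rw [h, MvPolynomial.coeff_smul, MvPolynomial.coeff_monomial]
    split_ifs with hs
    · rw [hs, smul_eq_mul]
    · simp
  | add p q hp hq => rw [map_add, mul_add, MvPolynomial.coeff_add, hp, hq, MvPolynomial.coeff_add,
      mul_add]

/-- A squarefree monomial is not divisible by a square; this permits calculating as if `e_i² = 0`.
-/
theorem coeff_X_mul_X_mul {τ : Type*} [DecidableEq τ] (i : τ) (S : Finset τ)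
    (p : MvPolynomial τ ℂ) : MvPolynomial.coeff (sqfreeExp S)
      (MvPolynomial.X i * (MvPolynomial.X i * p)) = 0 := by
  rw [MvPolynomial.coeff_X_mul']
  split_ifs
  · rw [MvPolynomial.coeff_X_mul', if_neg]
    rw [Finsupp.mem_support_iff, Finsupp.tsub_apply, sqfreeExp_apply, Finsupp.single_eq_same]
    split_ifs <;> simp
  · rfl

/-- The coefficient of `∏ t_i ∏_{i ∈ I} e_i` in the specialization of a state. -/
def levelCoeff (σ : Bool) (I : Finset (Fin n)) : Fock n →ₗ[ℂ] ℂ :=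
  MvPolynomial.lcoeff ℂ (sqfreeExp (Finset.univ.disjSum I)) ∘ₗ specState σ

theorem levelCoeff_apply (σ : Bool) (I : Finset (Fin n)) (v : Fock n) : levelCoeff σ I v =
    MvPolynomial.coeff (sqfreeExp (Finset.univ.disjSum I)) (specState σ v) := rfl

/-- The monomial has degree one in `t_i`, so the Euler operator `t_i ∂/∂t_i` acts as the identity on
its coefficient, and the second term of `pderiv_spec` contributes `e_i²`. Hence the current at site
`i` acts as multiplication by `∓ e_i`. -/
theorem coeff_shift (σ : Bool) (I : Finset (Fin n)) (i : Fin n) (p : BosonPoly n) :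
    MvPolynomial.coeff (sqfreeExp (Finset.univ.disjSum I)) (MvPolynomial.X (.inl i) *
        MvPolynomial.X (.inr i) * spec σ (MvPolynomial.pderiv (letter σ i 0) p)) =
      MvPolynomial.coeff (sqfreeExp (Finset.univ.disjSum I))
        (MvPolynomial.X (.inr i) * spec σ p) := by
  classical
  have h1 := X_mul_pderiv_coeff (.inl i) (sqfreeExp (Finset.univ.disjSum I))
    (MvPolynomial.X (.inr i) * spec σ p)
  rw [Derivation.leibniz, pderiv_spec, MvPolynomial.pderiv_X_of_ne (by simp), smul_zero, add_zero,
    sqfreeExp_apply, if_pos (by simp), Nat.cast_one, one_mul] at h1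
  have h2 := coeff_X_mul_X_mul (.inr i) (Finset.univ.disjSum I)
    (MvPolynomial.X (.inl i) * spec σ (MvPolynomial.pderiv (letter σ i 1) p))
  rw [← h1, ← add_zero (MvPolynomial.coeff _ _), ← h2, ← MvPolynomial.coeff_add]
  congr 1
  simp only [smul_eq_mul]
  ring

/-- The value `± (e_a - e_{a+1})` of `h_a` was chosen to cancel the two matter currents; for `r > 0`
all three terms vanish separately. -/
theorem levelCoeff_brst (σ : Bool) (I : Finset (Fin n)) (a : Fin (n - 1)) (r : ℕ) (v : Fock n) :
    levelCoeff σ I (((matterCurrent a + H a)[[-1 - (r : ℤ)]]) v) = 0 := by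
  have hH : specState σ (((H a)[[-1 - (r : ℤ)]]) v) = specValue σ (.h a r) * specState σ v := by
    rw [H, ncoeff_freeField_neg, specState_bosonCre]
  rw [levelCoeff_apply]
  simp only [matterCurrent, map_add, map_sub, Pi.add_apply, Pi.sub_apply, LinearMap.add_apply,
    LinearMap.sub_apply, hH, specState_current]
  by_cases hr : r = 0
  · simp only [hr, if_true, specValue, MvPolynomial.coeff_add, MvPolynomial.coeff_sub,
      MvPolynomial.coeff_smul, coeff_shift, smul_mul_assoc, sub_mul, specState_apply]
    simp only [smul_eq_mul]
    ring
  · simp [hr, specValue]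

/-- Terms of `Q` that create a `c`-ghost have no ghost-free part. In the remaining terms a creation
mode of the matter current plus `h_a` acts last, and `levelCoeff_brst` applies. -/
theorem levelCoeff_exact (σ : Bool) (I : Finset (Fin n)) {v : Fock n} (hv : v ∈ exact n) :
    levelCoeff σ I v = 0 := by
  obtain ⟨w, rfl⟩ := hv
  rw [brstCharge, brstCurrent, ncoeff_sum, map_sum]
  refine Finset.sum_eq_zero fun a _ => ?_
  rw [map_ncoeff_nop]
  refine (finsum_congr fun r => ?_).trans finsum_zero
  rw [nopTerm, map_add, map_smul, show (0 : ℤ) - 1 - r = -1 - r by omega, levelCoeff_brst,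
    smul_zero, add_zero, C, ncoeff_freeField_neg, levelCoeff_apply, specState_apply,
    ghostProj_ghostCre, map_zero, MvPolynomial.coeff_zero]

theorem spec_siteState (σ : Bool) (b : Prop) [Decidable b] (i : Fin n) :
    spec σ (siteState σ b i) = MvPolynomial.X (.inl i) *
      if b then (2 * sgn σ) • MvPolynomial.X (.inr i) else 1 := by
  unfold siteState
  split_ifs <;> cases σ <;> simp [site0, site1, letter, specValue, letterValue]

theorem spec_levelPoly (σ : Bool) (I : Finset (Fin n)) :
    spec σ (levelPoly σ I) =
      ((2 * sgn σ) ^ I.card) • sqfree (Finset.univ.disjSum I) := by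
  rw [levelPoly, map_prod, Finset.prod_congr rfl fun i _ => spec_siteState σ (i ∈ I) i,
    Finset.prod_mul_distrib, Finset.prod_ite_mem, Finset.univ_inter, Finset.prod_smul, sqfree,
    Finset.prod_disjSum, Finset.prod_const, mul_smul_comm]

theorem levelCoeff_levelPoly (σ : Bool) (I J : Finset (Fin n)) :
    levelCoeff σ I (ghostFree n (levelPoly σ J)) =
      if I = J then (2 * sgn σ) ^ J.card else 0 := by
  rw [levelCoeff_apply, specState_apply, ghostProj_ghostFree, spec_levelPoly,
    MvPolynomial.coeff_smul, coeff_sqfree]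
  have h : (Finset.univ : Finset (Fin n)).disjSum I = Finset.univ.disjSum J ↔ I = J := by
    constructor
    · intro h
      ext i
      have := congrArg (fun s => Sum.inr i ∈ s) h
      simpa using this
    · rintro rfl
      rfl
  simp [h]

/-- Every term at each site contains the letter that is specialized to zero, so one site suffices.
This separates `𝒳` from `𝒴`. -/
theorem levelCoeff_levelPoly_not (hn : 0 < n) (σ : Bool) (I J : Finset (Fin n)) :
    levelCoeff σ I (ghostFree n (levelPoly (!σ) J)) = 0 := by
  rw [levelCoeff_apply, specState_apply, ghostProj_ghostFree, levelPoly, map_prod,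
    Finset.prod_eq_zero (Finset.mem_univ ⟨0, hn⟩), MvPolynomial.coeff_zero]
  rcases siteState_eq (!σ) ((⟨0, hn⟩ : Fin n) ∈ J) ⟨0, hn⟩ with h | h <;> rw [h] <;> cases σ <;>
    simp [site0, site1, letter, specValue]

/-! ### Primary states -/

/-- The span of all squarefree monomials. -/
def multilinear (n : ℕ) : Submodule ℂ (MvPolynomial (Fin n) ℂ) :=
  Submodule.span ℂ (Set.range sqfree)

theorem sqfree_mem_multilinear (I : Finset (Fin n)) : sqfree I ∈ multilinear n :=
  Submodule.subset_span ⟨I, rfl⟩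

theorem sqfreeSpan_le (k : ℕ) : sqfreeSpan n k ≤ multilinear n := by
  refine Submodule.span_le.2 ?_
  rintro _ ⟨I, -, rfl⟩
  exact sqfree_mem_multilinear I

theorem mem_multilinear_iff {p : MvPolynomial (Fin n) ℂ} :
    p ∈ multilinear n ↔ ∃ c : Finset (Fin n) → ℂ, ∑ I, c I • sqfree I = p :=
  Submodule.mem_span_range_iff_exists_fun ℂ

theorem raising_mem_multilinear {p : MvPolynomial (Fin n) ℂ} (hp : p ∈ multilinear n) :
    raising (Fin n) p ∈ multilinear n := by
  have h : multilinear n ≤ (multilinear n).comap (raising (Fin n)).toLinearMap := by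
    refine Submodule.span_le.2 ?_
    rintro _ ⟨I, rfl⟩
    change raising (Fin n) (sqfree I) ∈ multilinear n
    rw [raising_sqfree]
    exact sum_mem fun i _ => sqfree_mem_multilinear _
  exact h hp

theorem coeff_sum_sqfree (c : Finset (Fin n) → ℂ) (I : Finset (Fin n)) :
    MvPolynomial.coeff (sqfreeExp I) (∑ J, c J • sqfree J) = c I := by
  simp [MvPolynomial.coeff_sum, coeff_sqfree]

theorem levelCoeff_levelMap (σ : Bool) (c : Finset (Fin n) → ℂ) (I : Finset (Fin n)) :
    levelCoeff σ I (levelMap (opO n σ) (∑ J, c J • sqfree J)) = c I * (2 * sgn σ) ^ I.card := by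
  simp [levelMap_sqfree, levelCoeff_levelPoly]

theorem levelCoeff_levelMap_not (hn : 0 < n) (σ : Bool) (c : Finset (Fin n) → ℂ)
    (I : Finset (Fin n)) :
    levelCoeff σ I (levelMap (opO n (!σ)) (∑ J, c J • sqfree J)) = 0 := by
  simp [levelMap_sqfree, levelCoeff_levelPoly_not hn]

/-- The functionals recover each coefficient up to a power of `±2`, and are blind to the other
family. All passages from "modulo exact" to polynomial identities rest on this. -/
theorem eq_zero_of_levelMap_mem_exact (hn : 0 < n) (σ : Bool) {p q : MvPolynomial (Fin n) ℂ}
    (hp : p ∈ multilinear n) (hq : q ∈ multilinear n)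
    (h : levelMap (opO n σ) p + levelMap (opO n (!σ)) q ∈ exact n) : p = 0 := by
  obtain ⟨c, rfl⟩ := mem_multilinear_iff.1 hp
  obtain ⟨d, rfl⟩ := mem_multilinear_iff.1 hq
  refine Finset.sum_eq_zero fun I _ => ?_
  have h1 := levelCoeff_exact σ I h
  rw [map_add, levelCoeff_levelMap, levelCoeff_levelMap_not hn, add_zero] at h1
  have h2 : (2 * sgn σ) ^ I.card ≠ 0 := pow_ne_zero _ (mul_ne_zero two_ne_zero (sgn_ne_zero σ))
  rw [(mul_eq_zero.1 h1).resolve_right h2, zero_smul]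

theorem levelMap_eq_of_sqfree {σ : Bool} {f : Module.End ℂ (Fock n)}
    {g : Module.End ℂ (MvPolynomial (Fin n) ℂ)} {p : MvPolynomial (Fin n) ℂ}
    (hp : p ∈ multilinear n)
    (h : ∀ I, f (ghostFree n (levelPoly σ I)) = levelMap (opO n σ) (g (sqfree I))) :
    f (levelMap (opO n σ) p) = levelMap (opO n σ) (g p) := by
  have := LinearMap.eqOn_span (f := f ∘ₗ levelMap (opO n σ)) (g := levelMap (opO n σ) ∘ₗ g)
    (s := Set.range sqfree) (by
      rintro _ ⟨I, rfl⟩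
      simpa [levelMap_sqfree] using h I)
  exact this hp

theorem stress_two_levelMap (σ : Bool) {p : MvPolynomial (Fin n) ℂ} (hp : p ∈ multilinear n) :
    ((stress n)[[2]]) (levelMap (opO n σ) p) =
      (2 * sgn σ) • levelMap (opO n σ) (raising (Fin n) p) := by
  rw [levelMap_eq_of_sqfree (g := (2 * sgn σ) • (raising (Fin n)).toLinearMap) hp fun I => ?_]
  · simp
  · rw [stress_two]
    simp [raising_sqfree, levelMap_sqfree]

theorem stress_ge_three_levelMap (σ : Bool) {p : MvPolynomial (Fin n) ℂ}
    (hp : p ∈ multilinear n) {m : ℤ} (hm : 3 ≤ m) :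
    ((stress n)[[m]]) (levelMap (opO n σ) p) = 0 := by
  rw [levelMap_eq_of_sqfree (g := 0) hp fun I => ?_]
  · simp
  · rw [stress_ge_three σ I hm]
    simp

theorem stress_one_levelMap (σ : Bool) (c : Finset (Fin n) → ℂ) :
    ((stress n)[[1]]) (levelMap (opO n σ) (∑ I, c I • sqfree I)) =
      levelMap (opO n σ) (∑ I : Finset (Fin n), (((n : ℂ) / 2 + I.card) * c I) • sqfree I) := by
  simp only [map_sum, map_smul, levelMap_sqfree, stress_one, smul_smul, mul_comm]

theorem stress_one_of_mem_sqfreeSpan (σ : Bool) {k : ℕ} {p : MvPolynomial (Fin n) ℂ}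
    (hp : p ∈ sqfreeSpan n k) : ((stress n)[[1]]) (levelMap (opO n σ) p) =
      ((n : ℂ) / 2 + k) • levelMap (opO n σ) p := by
  have h := LinearMap.eqOn_span (f := (stress n)[[1]] ∘ₗ levelMap (opO n σ))
    (g := ((n : ℂ) / 2 + k) • levelMap (opO n σ))
    (s := {p | ∃ I : Finset (Fin n), I.card = k ∧ p = sqfree I}) (by
      rintro _ ⟨I, rfl, rfl⟩
      simp [levelMap_sqfree, stress_one])
  exact h hp

theorem highestSpan_le (k : ℕ) : highestSpan n k ≤ sqfreeSpan n k := by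
  refine Submodule.span_le.2 ?_
  rintro _ ⟨P, hP, rfl, rfl⟩
  rw [← basisPoly_card]
  exact hP.basisPoly_mem le_rfl

theorem IsPrimary.modExact {v : Fock n} (h : IsPrimary v) : IsPrimaryModExact v := by
  obtain ⟨h, h1, h2⟩ := h
  refine ⟨h, ?_, fun m hm => ?_⟩
  · rw [h1, sub_self]
    exact zero_mem _
  · rw [h2 m hm]
    exact zero_mem _

theorem isPrimary_levelMap {k : ℕ} {p q : MvPolynomial (Fin n) ℂ} (hp : p ∈ highestSpan n k)
    (hq : q ∈ highestSpan n k) :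
    IsPrimary (levelMap (opO n true) p + levelMap (opO n false) q) := by
  have hp' := highestSpan_le k hp
  have hq' := highestSpan_le k hq
  refine ⟨(n : ℂ) / 2 + k, ?_, fun m hm => ?_⟩
  · rw [map_add, stress_one_of_mem_sqfreeSpan true hp', stress_one_of_mem_sqfreeSpan false hq',
      smul_add]
  · rw [map_add]
    rcases eq_or_ne m 2 with rfl | hm2
    · rw [stress_two_levelMap _ (sqfreeSpan_le k hp'), stress_two_levelMap _ (sqfreeSpan_le k hq'),
        (mem_highestSpan_iff hp').2 hp, (mem_highestSpan_iff hq').2 hq]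
      simp
    · rw [stress_ge_three_levelMap _ (sqfreeSpan_le k hp') (by omega),
        stress_ge_three_levelMap _ (sqfreeSpan_le k hq') (by omega), add_zero]

theorem raising_eq_zero_of_modExact (hn : 0 < n) {p q : MvPolynomial (Fin n) ℂ}
    (hp : p ∈ multilinear n) (hq : q ∈ multilinear n)
    (h : IsPrimaryModExact (levelMap (opO n true) p + levelMap (opO n false) q)) :
    raising (Fin n) p = 0 ∧ raising (Fin n) q = 0 := by
  obtain ⟨_, -, h2⟩ := h
  have h2 := h2 2 le_rfl
  rw [map_add, stress_two_levelMap _ hp, stress_two_levelMap _ hq, 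
    ← LinearMap.map_smul (levelMap (opO n true)), ← LinearMap.map_smul (levelMap (opO n false))]
    at h2
  have hp2 := Submodule.smul_mem _ (2 * sgn true) (raising_mem_multilinear hp)
  have hq2 := Submodule.smul_mem _ (2 * sgn false) (raising_mem_multilinear hq)
  have e1 := eq_zero_of_levelMap_mem_exact hn true hp2 hq2 h2
  rw [add_comm] at h2
  have e2 := eq_zero_of_levelMap_mem_exact hn false hq2 hp2 h2
  exact ⟨(smul_eq_zero.1 e1).resolve_left (mul_ne_zero two_ne_zero (sgn_ne_zero true)),
    (smul_eq_zero.1 e2).resolve_left (mul_ne_zero two_ne_zero (sgn_ne_zero false))⟩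

/-- A primary has a single weight, while level `k` has weight `n/2 + k` for both `𝒳` and `𝒴`; hence
only one common level can occur. -/
theorem exists_level_of_modExact (hn : 0 < n) {p q : MvPolynomial (Fin n) ℂ}
    (hp : p ∈ multilinear n) (hq : q ∈ multilinear n)
    (h : IsPrimaryModExact (levelMap (opO n true) p + levelMap (opO n false) q)) :
    ∃ k, p ∈ sqfreeSpan n k ∧ q ∈ sqfreeSpan n k := by
  obtain ⟨c, rfl⟩ := mem_multilinear_iff.1 hp
  obtain ⟨d, rfl⟩ := mem_multilinear_iff.1 hq
  obtain ⟨w, h1, -⟩ := h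
  have hrep : ∀ (σ : Bool) (c : Finset (Fin n) → ℂ),
      ((stress n)[[1]]) (levelMap (opO n σ) (∑ I, c I • sqfree I)) -
        w • levelMap (opO n σ) (∑ I, c I • sqfree I) = levelMap (opO n σ)
        (∑ I : Finset (Fin n), (((n : ℂ) / 2 + I.card - w) * c I) • sqfree I) := by
    intro σ c
    rw [stress_one_levelMap, ← map_smul, ← map_sub, Finset.smul_sum, ← Finset.sum_sub_distrib]
    congr 1
    refine Finset.sum_congr rfl fun I _ => ?_
    rw [smul_smul, ← sub_smul, sub_mul]
  rw [map_add, smul_add, add_sub_add_comm, hrep, hrep] at h1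
  have hm : ∀ c : Finset (Fin n) → ℂ, ∑ I, c I • sqfree I ∈ multilinear n := fun c =>
    mem_multilinear_iff.2 ⟨c, rfl⟩
  have e1 := eq_zero_of_levelMap_mem_exact hn true (hm _) (hm _) h1
  rw [add_comm] at h1
  have e2 := eq_zero_of_levelMap_mem_exact hn false (hm _) (hm _) h1
  have hz : ∀ c : Finset (Fin n) → ℂ,
      ∑ I : Finset (Fin n), (((n : ℂ) / 2 + I.card - w) * c I) • sqfree I = 0 →
      ∀ I, c I ≠ 0 → (n : ℂ) / 2 + I.card = w := by
    intro c hc I hI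
    have := coeff_sum_sqfree (fun I => ((n : ℂ) / 2 + I.card - w) * c I) I
    rw [hc, MvPolynomial.coeff_zero] at this
    exact sub_eq_zero.1 ((mul_eq_zero.1 this.symm).resolve_right hI)
  have hlev : ∀ (c : Finset (Fin n) → ℂ) (k : ℕ), (∀ I, c I ≠ 0 → I.card = k) →
      ∑ I, c I • sqfree I ∈ sqfreeSpan n k := by
    intro c k hk
    refine sum_mem fun I _ => ?_
    by_cases hI : c I = 0
    · rw [hI, zero_smul]
      exact zero_mem _
    · exact Submodule.smul_mem _ _ (Submodule.subset_span ⟨I, hk I hI, rfl⟩)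
  have huniq : ∀ I J : Finset (Fin n), (n : ℂ) / 2 + I.card = w → (n : ℂ) / 2 + J.card = w →
      I.card = J.card := by
    intro I J hI hJ
    exact_mod_cast add_left_cancel (hI.trans hJ.symm)
  by_cases hex : ∃ I : Finset (Fin n), (n : ℂ) / 2 + I.card = w
  · obtain ⟨I, hI⟩ := hex
    exact ⟨I.card, hlev c _ fun J hJ => huniq J I (hz c e1 J hJ) hI,
      hlev d _ fun J hJ => huniq J I (hz d e2 J hJ) hI⟩
  -- If no level has the weight `w`, all coefficients vanish and any `k` will do.
  · exact ⟨0, hlev c _ fun J hJ => absurd ⟨J, hz c e1 J hJ⟩ hex,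
      hlev d _ fun J hJ => absurd ⟨J, hz d e2 J hJ⟩ hex⟩

theorem levelMap_modExact_iff (hn : 0 < n) {k : ℕ} {p q : MvPolynomial (Fin n) ℂ}
    (hp : p ∈ sqfreeSpan n k) (hq : q ∈ sqfreeSpan n k)
    (h : IsPrimaryModExact (levelMap (opO n true) p + levelMap (opO n false) q)) :
    p ∈ highestSpan n k ∧ q ∈ highestSpan n k := by
  obtain ⟨h1, h2⟩ := raising_eq_zero_of_modExact hn (sqfreeSpan_le k hp) (sqfreeSpan_le k hq) h
  exact ⟨(mem_highestSpan_iff hp).1 h1, (mem_highestSpan_iff hq).1 h2⟩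

theorem mem_primarySpan_iff (hn : 0 < n) (σ : Bool) {k : ℕ} {v : Fock n}
    (hv : v ∈ levelSpan (opO n σ) k) :
    (IsPrimary v ↔ v ∈ primarySpan (opO n σ) k) ∧
      (IsPrimaryModExact v ↔ v ∈ primarySpan (opO n σ) k) := by
  rw [← map_sqfreeSpan (opO_mem_vacuumFields σ)] at hv
  obtain ⟨p, hp, rfl⟩ := hv
  rw [← map_highestSpan (opO_mem_vacuumFields σ)]
  have h1 : IsPrimaryModExact (levelMap (opO n σ) p) →
      levelMap (opO n σ) p ∈ (highestSpan n k).map (levelMap (opO n σ)) := by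
    intro h
    cases σ
    · exact ⟨p, (levelMap_modExact_iff hn (zero_mem _) hp (by simpa using h)).2, rfl⟩
    · exact ⟨p, (levelMap_modExact_iff hn hp (zero_mem _) (by simpa using h)).1, rfl⟩
  have h2 : levelMap (opO n σ) p ∈ (highestSpan n k).map (levelMap (opO n σ)) →
      IsPrimary (levelMap (opO n σ) p) := by
    rintro ⟨q, hq, h⟩
    rw [← h]
    cases σ
    · simpa using isPrimary_levelMap (zero_mem _) hq
    · simpa using isPrimary_levelMap hq (zero_mem _)
  exact ⟨⟨fun h => h1 h.modExact, h2⟩, ⟨h1, fun h => (h2 h).modExact⟩⟩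

theorem mem_primarySpan_sup_iff (hn : 0 < n) {v : Fock n}
    (hv : v ∈ ⨆ k : ℕ, levelSpan (opO n true) k ⊔ levelSpan (opO n false) k) :
    (IsPrimary v ↔
      ∃ k : ℕ, v ∈ primarySpan (opO n true) k ⊔ primarySpan (opO n false) k) ∧
    (IsPrimaryModExact v ↔
      ∃ k : ℕ, v ∈ primarySpan (opO n true) k ⊔ primarySpan (opO n false) k) := by
  have hle : ⨆ k : ℕ, levelSpan (opO n true) k ⊔ levelSpan (opO n false) k ≤
      (multilinear n).map (levelMap (opO n true)) ⊔
        (multilinear n).map (levelMap (opO n false)) := by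
    refine iSup_le fun k => sup_le_sup ?_ ?_ <;>
      exact (map_sqfreeSpan (opO_mem_vacuumFields _) k).symm.trans_le
        (Submodule.map_mono (sqfreeSpan_le k))
  obtain ⟨_, ⟨p, hp, rfl⟩, _, ⟨q, hq, rfl⟩, rfl⟩ := Submodule.mem_sup.1 (hle hv)
  simp only [← map_highestSpan (opO_mem_vacuumFields _)]
  have h1 : IsPrimaryModExact (levelMap (opO n true) p + levelMap (opO n false) q) →
      ∃ k : ℕ, levelMap (opO n true) p + levelMap (opO n false) q ∈
        (highestSpan n k).map (levelMap (opO n true)) ⊔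
          (highestSpan n k).map (levelMap (opO n false)) := by
    intro h
    obtain ⟨k, hpk, hqk⟩ := exists_level_of_modExact hn hp hq h
    obtain ⟨h1, h2⟩ := levelMap_modExact_iff hn hpk hqk h
    exact ⟨k, Submodule.add_mem_sup ⟨p, h1, rfl⟩ ⟨q, h2, rfl⟩⟩
  have h2 : (∃ k : ℕ, levelMap (opO n true) p + levelMap (opO n false) q ∈
        (highestSpan n k).map (levelMap (opO n true)) ⊔
          (highestSpan n k).map (levelMap (opO n false))) →
      IsPrimary (levelMap (opO n true) p + levelMap (opO n false) q) := by
    rintro ⟨k, hk⟩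
    obtain ⟨_, ⟨p', hp', rfl⟩, _, ⟨q', hq', rfl⟩, h⟩ := Submodule.mem_sup.1 hk
    rw [← h]
    exact isPrimary_levelMap hp' hq'
  exact ⟨⟨fun h => h1 h.modExact, h2⟩, ⟨h1, fun h => (h2 h).modExact⟩⟩

/-! ### The basis operators -/

theorem state_basisOp_opO (σ : Bool) (k : ℕ) (P : Finset (Fin n × Fin n)) :
    state (basisOp (opO n σ) k P) = levelMap (opO n σ) (basisPoly k P) :=
  state_basisOp (opO_mem_vacuumFields σ) k P

theorem linearIndependent_basisOp (hn : 0 < n) (σ : Bool) (k : ℕ) :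
    LinearIndependent ℂ (fun P : BasisIndex n k =>
      (exact n).mkQ (state (basisOp (opO n σ) k P.1))) := by
  have h := (linearIndependent_basisPoly n k).map
    (f := (exact n).mkQ ∘ₗ levelMap (opO n σ)) (by
      rw [span_basisPoly, Submodule.disjoint_def]
      intro p hp hker
      have hex : levelMap (opO n σ) p + levelMap (opO n (!σ)) 0 ∈ exact n := by
        rw [map_zero, add_zero]
        simpa using hker
      exact eq_zero_of_levelMap_mem_exact hn σ (sqfreeSpan_le k hp) (zero_mem _) hex)
  simpa only [Function.comp_def, LinearMap.comp_apply, ← state_basisOp_opO] using h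

theorem span_basisOp (σ : Bool) (k : ℕ) :
    Submodule.span ℂ (Set.range fun P : BasisIndex n k => state (basisOp (opO n σ) k P.1)) =
      levelSpan (opO n σ) k := by
  rw [← map_sqfreeSpan (opO_mem_vacuumFields σ), ← span_basisPoly, Submodule.map_span,
    ← Set.range_comp]
  simp only [Function.comp_def, state_basisOp_opO]

/-- The raising operator sends it to a nonzero multiple of a basis vector one level down, by
`raising_basisPoly` and `k + #P ≤ n`. -/
theorem not_isPrimaryModExact_basisOp (hn : 0 < n) (σ : Bool) {k : ℕ} (P : BasisIndex n k)
    (hP : P.1.card < k) : ¬ IsPrimaryModExact (state (basisOp (opO n σ) k P.1)) := by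
  intro h
  rw [state_basisOp_opO] at h
  obtain ⟨k, rfl⟩ : ∃ j, k = j + 1 := ⟨k - 1, by omega⟩
  have hmem := sqfreeSpan_le _ (P.2.1.basisPoly_mem P.2.2.1)
  have h0 : raising (Fin n) (basisPoly (k + 1) P.1) = 0 := by
    cases σ
    · refine (raising_eq_zero_of_modExact hn (zero_mem _) hmem ?_).2
      rw [map_zero, zero_add]
      exact h
    · refine (raising_eq_zero_of_modExact hn hmem (zero_mem _) ?_).1
      rw [map_zero, add_zero]
      exact h
  have hcard := P.2.2.2
  rw [raising_basisPoly P.2.1 (by omega)] at h0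
  rcases smul_eq_zero.1 h0 with h1 | h1
  · have h2 : (n : ℂ) = ((P.1.card + k : ℕ) : ℂ) := by
      push_cast
      linear_combination h1
    have h3 : n = P.1.card + k := by exact_mod_cast h2
    omega
  · have hlt : P.1.card ≤ k := Nat.lt_succ_iff.1 hP
    have hle : k + P.1.card ≤ n := by omega
    let P' : BasisIndex n k := ⟨P.1, P.2.1, hlt, hle⟩
    exact (linearIndependent_basisPoly n k).ne_zero P' h1

theorem opU_mem_vacuumFields : opU n ∈ vacuumFields (vac : Fock n) :=
  Submodule.smul_mem _ _ (sum_mem fun i _ =>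
    nop_mem_vacuumFields (X_mem_vacuumFields i) (Y_mem_vacuumFields i) 1)

theorem opT_mem_vacuumFields (i : Fin n) : opT i ∈ vacuumFields (vac : Fock n) :=
  Submodule.smul_mem _ _ (covD_mem_vacuumFields i (gaugeA_mem_vacuumFields i))

theorem sum_gaugeA (hn : 0 < n) (v : Fock n) :
    ∑ i : Fin n, ((gaugeA i)[[-1]]) v = (n : ℂ) • ((opU n)[[-1]]) v := by
  have hn' : (n : ℂ) ≠ 0 := Nat.cast_ne_zero.2 hn.ne'
  simp only [opU, map_smul, Pi.smul_apply, LinearMap.smul_apply, ncoeff_sum, ncoeff_gaugeA,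
    smul_smul, Finset.sum_neg_distrib]
  rw [mul_neg, mul_one_div_cancel hn', neg_one_smul]

/-- On monomials this is `sum_levelPoly_insert`, where the gauge fields add up to `n U`. -/
theorem levelMap_lowering_mem (hn : 0 < n) (σ : Bool) {k : ℕ} {p : MvPolynomial (Fin n) ℂ}
    (hp : p ∈ sqfreeSpan n k) :
    levelMap (opO n σ) (lowering (Fin n) p) ∈ compositeSpan (opO n σ) (k + 1) := by
  have hle : sqfreeSpan n k ≤ (compositeSpan (opO n σ) (k + 1)).comap
      (levelMap (opO n σ) ∘ₗ lowering (Fin n)) := by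
    refine Submodule.span_le.2 ?_
    rintro _ ⟨J, rfl, rfl⟩
    have hJ := sum_levelPoly_insert σ J
    have hvac : ∀ I : Finset (Fin n), covSet I (opO n σ) ∈ vacuumFields (vac : Fock n) := fun I =>
      ((actsAs_covSet I) _ (opO_mem_vacuumFields σ)).1
    have hmem : sgn σ • ∑ i ∈ Jᶜ, ghostFree n (levelPoly σ (insert i J)) ∈
        compositeSpan (opO n σ) (J.card + 1) := by
      rw [hJ, sum_gaugeA hn]
      refine sub_mem (add_mem ?_ (Submodule.smul_mem _ _ (Submodule.smul_mem _ _ ?_)))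
        (Submodule.smul_mem _ _ (sum_mem fun i hi => ?_))
      · exact Submodule.subset_span ⟨J, Nat.lt_succ_self _, .inl (state_deriv_covSet σ J).symm⟩
      · refine Submodule.subset_span ⟨J, Nat.lt_succ_self _, .inr (.inl ?_)⟩
        rw [state_apply, nop_neg_one_vacuum opU_mem_vacuumFields (hvac J), ← state_apply,
          state_covSet]
      · refine Submodule.subset_span ⟨J.erase i, ?_, .inr (.inr ⟨i, ?_⟩)⟩
        · exact (Finset.card_erase_lt_of_mem hi).trans (Nat.lt_succ_self _)
        · rw [state_apply, nop_neg_one_vacuum (opT_mem_vacuumFields i) (hvac _), ← state_apply,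
            state_covSet]
    rw [Submodule.smul_mem_iff _ (sgn_ne_zero σ)] at hmem
    simpa [lowering_sqfree, levelMap_sqfree] using hmem
  exact hle hp

/-- With fewer pairs than its level, the operator is a lowering of the one with the same pairing a
level below; the factor `k + 1 - #P` is nonzero. -/
theorem basisOp_mem_compositeSpan (hn : 0 < n) (σ : Bool) {k : ℕ} (P : BasisIndex n k)
    (hP : P.1.card < k) :
    state (basisOp (opO n σ) k P.1) ∈ compositeSpan (opO n σ) k := by
  obtain ⟨k, rfl⟩ : ∃ j, k = j + 1 := ⟨k - 1, by omega⟩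
  have hk : P.1.card ≤ k := Nat.lt_succ_iff.1 hP
  have h := levelMap_lowering_mem hn σ (P.2.1.basisPoly_mem hk)
  rw [lowering_basisPoly P.2.1 hk, map_smul, Submodule.smul_mem_iff] at h
  · rwa [state_basisOp_opO]
  · rw [add_sub_right_comm, ← Nat.cast_sub hk]
    exact Nat.cast_add_one_ne_zero _

end Fock

end

theorem mainTheorem6 (n : ℕ) (hn : 2 ≤ n) :
    (∀ O : VertexOperator ℂ (Fock n), O = Fock.opX n ∨ O = Fock.opY n →
      -- the operators `O_I` are closed
      (∀ I : Finset (Fin n), Fock.brstCharge n (Fock.state (Fock.covSet I O)) = 0) ∧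
      ∀ k : ℕ, k ≤ n →
        -- the listed operators are a basis of the span, even modulo exact states
        LinearIndependent ℂ (fun P : Fock.BasisIndex n k =>
          (Fock.exact n).mkQ (Fock.state (Fock.basisOp O k P.1))) ∧
        Submodule.span ℂ (Set.range fun P : Fock.BasisIndex n k =>
          Fock.state (Fock.basisOp O k P.1)) = Fock.levelSpan O k ∧
        -- the primaries of level `k` are the combinations of admissible products of differences
        (∀ v ∈ Fock.levelSpan O k,
          (Fock.IsPrimary v ↔ v ∈ Fock.primarySpan O k) ∧
          (Fock.IsPrimaryModExact v ↔ v ∈ Fock.primarySpan O k)) ∧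
        -- the remaining basis operators are not primary, and are composite
        (∀ P : Fock.BasisIndex n k, P.1.card < k →
          ¬ Fock.IsPrimaryModExact (Fock.state (Fock.basisOp O k P.1)) ∧
          ∃ w ∈ Fock.compositeSpan O k,
            Fock.state (Fock.basisOp O k P.1) - w ∈ Fock.exact n)) ∧
    -- all primaries among combinations of all `𝒳_I` and `𝒴_I`
    (∀ v ∈ ⨆ k : ℕ, Fock.levelSpan (Fock.opX n) k ⊔ Fock.levelSpan (Fock.opY n) k,
      (Fock.IsPrimary v ↔
        ∃ k : ℕ, v ∈ Fock.primarySpan (Fock.opX n) k ⊔ Fock.primarySpan (Fock.opY n) k) ∧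
      (Fock.IsPrimaryModExact v ↔
        ∃ k : ℕ, v ∈ Fock.primarySpan (Fock.opX n) k ⊔ Fock.primarySpan (Fock.opY n) k)) := by
  have hn0 : 0 < n := by omega
  refine ⟨fun O hO => ?_, fun v hv => Fock.mem_primarySpan_sup_iff hn0 hv⟩
  obtain ⟨σ, rfl⟩ : ∃ σ, O = Fock.opO n σ := hO.elim (fun h => ⟨true, h⟩) fun h => ⟨false, h⟩
  refine ⟨fun I => ?_, fun k _ => ⟨Fock.linearIndependent_basisOp hn0 σ k, Fock.span_basisOp σ k,
    fun v hv => Fock.mem_primarySpan_iff hn0 σ hv, fun P hP =>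
      ⟨Fock.not_isPrimaryModExact_basisOp hn0 σ P hP, _,
        Fock.basisOp_mem_compositeSpan hn0 σ P hP, ?_⟩⟩⟩
  · rw [Fock.state_covSet, Fock.brstCharge_levelPoly]
  -- The state itself lies in the composite span, so no exact correction is needed.
  · rw [sub_self]
    exact zero_mem _
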